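/- Consider bosonic systems with finitely many modes. For $N$ modes let $\hat a_n$ be the annihilation operators on the Fock space, $\hat x_n=(\hat a_n+\hat a_n^\dagger)/\sqrt2$, $\hat p_n=(\hat a_n-\hat a_n^\dagger)/(\sqrt2\,i)$, and $\hat{\boldsymbol R}=(\hat x_1,\hat p_1,\dots,\hat x_N,\hat p_N)^T$. A state is a positive operator $\hat\rho$ of trace one; with an eigenvalue decomposition $\hat\rho=\sum_i\lambda_i|i\rangle\langle i|$, its quadrature quantum Fisher information matrix is the real symmetric $2N\times 2N$ matrix $$F_{kl}=2\sum_{\lambda_i+\lambda_j>0}\frac{(\lambda_i-\lambda_j)^2}{\lambda_i+\lambda_j}\,\langle i|\hat R^{(k)}|j\rangle\langle j|\hat R^{(l)}|i\rangle =2\sum_{\lambda_i+\lambda_j>0}\frac{\langle i|[\hat R^{(k)},\hat\rho]|j\rangle\,\overline{\langle i|[\hat R^{(l)},\hat\rho]|j\rangle}}{\lambda_i+\lambda_j},$$ where the last expression is used for general states. The metrological power of $\hat\rho$ is $$\mathcal M(\hat\rho)=\max\{\lambda_{\max}(\boldsymbol F)/2-1,\,0\}\in[0,\infty],$$ with $\mathcal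 M(\hat\rho)=\infty$ if for some $k$ the commutator $[\hat R^{(k)},\hat\rho]$ is not bounded or the sum defining $F_{kk}$ diverges. A coherent state is $|\boldsymbol\alpha\rangle=\bigotimes_n e^{-|\alpha_n|^2/2}\sum_m \frac{\alpha_n^m}{\sqrt{m!}}|m\rangle$ with $\boldsymbol\alpha\in\mathbb C^N$. A state is classical if $\hat\rho=\int|\boldsymbol\alpha\rangle\langle\boldsymbol\alpha|\,dP(\boldsymbol\alpha)$ for a probability measure $P$ on $\mathbb C^N$. A linear optical unitary is a unitary $\hat U_L$ with $\hat U_L^\dagger\hat{\boldsymbol R}\hat U_L=O\hat{\boldsymbol R}+\boldsymbol d$ for some orthogonal $O\in O(2N)$ and $\boldsymbol d\in\mathbb R^{2N}$. A linear optical map is $\Phi_L(\hat\rho_A)=\mathrm{Tr}_E[\hat U_L(\hat\rho_A\otimes\hat\sigma_E)\hat U_L^\dagger]$ with $\hat U_L$ a linear optical unitary of the composite system and $\hat\sigma_E$ a classical state of finitely many ancilla modes. Then: 1. $\mathcal M(\hat\rho)\ge 0$ for every state, and $\mathcal M(\hat\rho)=0$ for every classical state. For a pure state, $\mathcal M=0$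 if and only if the state is a coherent state. 2. $\mathcal M(\hat U_L\hat\rho\hat U_L^\dagger)=\mathcal M(\hat\rho)$ for every linear optical unitary $\hat U_L$, and $\mathcal M(\Phi_L(\hat\rho))\le\mathcal M(\hat\rho)$ for every linear optical map $\Phi_L$. 3. $\mathcal M$ is convex: $\mathcal M(p\hat\rho+(1-p)\hat\sigma)\le p\,\mathcal M(\hat\rho)+(1-p)\,\mathcal M(\hat\sigma)$ for $0\le p\le1$ (with $0\cdot\infty=0$). 4. $\mathcal M(\hat\rho_A\otimes\hat\sigma_B)=\max\{\mathcal M(\hat\rho_A),\mathcal M(\hat\sigma_B)\}$. -/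

import Mathlib

open scoped InnerProductSpace ENNReal ComplexConjugate

set_option linter.unusedSectionVars false

noncomputable section

namespace Bosonic

universe u v w

/-! ### The Fock space of finitely many bosonic modes -/

/-- The Hilbert space of a bosonic system whose modes are labelled by `ι`, in the occupation number
representation: square summable amplitudes indexed by the photon numbers `m : ι → ℕ`. -/
abbrev Fock (ι : Type u) : Type u := lp (fun _ : ι → ℕ => ℂ) 2

section OneSystem

variable {ι : Type u} [Fintype ι] [DecidableEq ι]

/-- The Fock state `|m⟩`. -/
def ket (m : ι → ℕ) : Fock ι := lp.single 2 m 1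

theorem inner_ket (m : ι → ℕ) (ψ : Fock ι) : ⟪ket m, ψ⟫_ℂ = ψ m := by
  simp [ket, lp.inner_single_left]

theorem inner_ket' (m : ι → ℕ) (ψ : Fock ι) : ⟪ψ, ket m⟫_ℂ = conj (ψ m) := by
  rw [← inner_conj_symm, inner_ket]

/-- The Fock states as an orthonormal basis. -/
def ketBasis : HilbertBasis (ι → ℕ) ℂ (Fock ι) := ⟨LinearIsometryEquiv.refl ℂ _⟩

theorem ketBasis_apply (m : ι → ℕ) : (ketBasis m : Fock ι) = ket m := by
  apply lp.ext
  funext n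
  have h := ketBasis.repr_apply_apply (ket n : Fock ι) m
  rw [← inner_ket, ← inner_conj_symm, ← h, ← inner_ket n (ket m), ← inner_conj_symm (ket n) (ket m)]
  simp only [ketBasis, LinearIsometryEquiv.coe_refl, id]
  rw [inner_ket]

/-- The annihilation operator `a_n`, acting on amplitudes. -/
def annihilate (n : ι) : ((ι → ℕ) → ℂ) →ₗ[ℂ] ((ι → ℕ) → ℂ) where
  toFun ψ m := (Real.sqrt (m n + 1) : ℂ) * ψ (m + Pi.single n 1)
  map_add' ψ φ := by funext m; simp [mul_add]
  map_smul' c ψ := by funext m; simp [mul_left_comm]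

/-- The creation operator `a_n†`, acting on amplitudes; the prefactor vanishes for `m n = 0`. -/
def create (n : ι) : ((ι → ℕ) → ℂ) →ₗ[ℂ] ((ι → ℕ) → ℂ) where
  toFun ψ m := (Real.sqrt (m n) : ℂ) * ψ (m - Pi.single n 1)
  map_add' ψ φ := by funext m; simp [mul_add]
  map_smul' c ψ := by funext m; simp [mul_left_comm]

/-- The quadratures acting on amplitudes. The index `(n, 0)` stands for `x_n = (a_n + a_n†) / √2`
and `(n, 1)` for `p_n = (a_n - a_n†) / (√2 i)`. -/
def quadFun (k : ι × Fin 2) : ((ι → ℕ) → ℂ) →ₗ[ℂ] ((ι → ℕ) → ℂ) :=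
  if k.2 = 0 then ((Real.sqrt 2 : ℂ)⁻¹) • (annihilate k.1 + create k.1)
  else ((Real.sqrt 2 * Complex.I : ℂ)⁻¹) • (annihilate k.1 - create k.1)

/-- The common domain of the quadrature operators (the vectors of finite mean photon number). -/
def quadDomain (ι : Type u) [Fintype ι] [DecidableEq ι] : Submodule ℂ (Fock ι) where
  carrier := {ψ | ∀ k : ι × Fin 2, Memℓp (quadFun k ψ) 2}
  zero_mem' k := by
    simp only [lp.coeFn_zero, map_zero]
    exact zero_memℓp
  add_mem' {ψ φ} hψ hφ k := by
    simp only [lp.coeFn_add, map_add]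
    exact (hψ k).add (hφ k)
  smul_mem' c ψ hψ k := by
    simp only [lp.coeFn_smul, map_smul]
    exact (hψ k).const_smul c

/-- The quadrature operator `R^(k)`, an unbounded operator on `Fock ι` with domain `quadDomain`. -/
def quad (k : ι × Fin 2) : quadDomain ι →ₗ[ℂ] Fock ι where
  toFun ψ := ⟨quadFun k (ψ : Fock ι), ψ.2 k⟩
  map_add' ψ φ := by
    apply lp.ext
    exact map_add (quadFun k) _ _
  map_smul' c ψ := by
    apply lp.ext
    exact map_smul (quadFun k) _ _

theorem quadFun_zero (n : ι) (f : (ι → ℕ) → ℂ) :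
    quadFun (n, 0) f = ((Real.sqrt 2 : ℂ)⁻¹) • (annihilate n f + create n f) := by
  simp [quadFun]
theorem quadFun_one (n : ι) (f : (ι → ℕ) → ℂ) :
    quadFun (n, 1) f = ((Real.sqrt 2 * Complex.I : ℂ)⁻¹) • (annihilate n f - create n f) := by
  simp [quadFun]

theorem annihilate_eq (n : ι) (f : (ι → ℕ) → ℂ) : annihilate n f =
    ((Real.sqrt 2 : ℂ)⁻¹) • (quadFun (n, 0) f + Complex.I • quadFun (n, 1) f) := by
  rw [quadFun_zero, quadFun_one]
  funext m
  have h2 : (Real.sqrt 2 : ℂ) * (Real.sqrt 2 : ℂ) = 2 := by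
    rw [← Complex.ofReal_mul, Real.mul_self_sqrt (by norm_num)]; norm_num
  have h0 : (Real.sqrt 2 : ℂ) ≠ 0 := by intro h; simp [h] at h2
  simp only [Pi.smul_apply, Pi.add_apply, Pi.sub_apply, smul_eq_mul]
  field_simp
  rw [pow_two, h2]
  ring

theorem create_eq (n : ι) (f : (ι → ℕ) → ℂ) : create n f =
    ((Real.sqrt 2 : ℂ)⁻¹) • (quadFun (n, 0) f - Complex.I • quadFun (n, 1) f) := by
  rw [quadFun_zero, quadFun_one]
  funext m
  have h2 : (Real.sqrt 2 : ℂ) * (Real.sqrt 2 : ℂ) = 2 := by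
    rw [← Complex.ofReal_mul, Real.mul_self_sqrt (by norm_num)]; norm_num
  have h0 : (Real.sqrt 2 : ℂ) ≠ 0 := by intro h; simp [h] at h2
  simp only [Pi.smul_apply, Pi.add_apply, Pi.sub_apply, smul_eq_mul]
  field_simp
  rw [pow_two, h2]
  ring

/-- The annihilation operator on `quadDomain`. -/
def annVec (n : ι) (ψ : quadDomain ι) : Fock ι :=
  ⟨annihilate n (ψ : Fock ι), by
    rw [annihilate_eq]
    exact ((ψ.2 (n, 0)).add ((ψ.2 (n, 1)).const_smul _)).const_smul _⟩
/-- The creation operator on `quadDomain`. -/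
def creVec (n : ι) (ψ : quadDomain ι) : Fock ι :=
  ⟨create n (ψ : Fock ι), by
    rw [create_eq]
    exact ((ψ.2 (n, 0)).sub ((ψ.2 (n, 1)).const_smul _)).const_smul _⟩

theorem inner_annVec (n : ι) (φ ψ : quadDomain ι) :
    ⟪(φ : Fock ι), annVec n ψ⟫_ℂ = ⟪creVec n φ, (ψ : Fock ι)⟫_ℂ := by
  rw [lp.inner_eq_tsum, lp.inner_eq_tsum]
  have hinj : Function.Injective fun m : ι → ℕ => m + Pi.single n 1 := add_left_injective _
  rw [← hinj.tsum_eq (f := fun m => ⟪creVec n φ m, (ψ : Fock ι) m⟫_ℂ)]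
  · refine tsum_congr fun m => ?_
    simp [annVec, creVec, annihilate, create]
    ring
  · intro m hm
    by_cases h : m n = 0
    · exfalso; apply hm
      simp [creVec, create, h]
    · refine ⟨m - Pi.single n 1, ?_⟩
      funext j
      by_cases hj : j = n
      · subst hj; simp; omega
      · simp [hj]

theorem inner_creVec (n : ι) (φ ψ : quadDomain ι) :
    ⟪(φ : Fock ι), creVec n ψ⟫_ℂ = ⟪annVec n φ, (ψ : Fock ι)⟫_ℂ := by
  rw [← inner_conj_symm, ← inner_annVec, inner_conj_symm]

/-- The quadratures are symmetric operators. -/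
theorem quad_symmetric (k : ι × Fin 2) (φ ψ : quadDomain ι) :
    ⟪quad k φ, (ψ : Fock ι)⟫_ℂ = ⟪(φ : Fock ι), quad k ψ⟫_ℂ := by
  obtain ⟨n, j⟩ := k
  have h0 : ∀ χ : quadDomain ι, quad (n, 0) χ = ((Real.sqrt 2 : ℂ)⁻¹) • (annVec n χ + creVec n χ) :=
    fun χ => lp.ext (quadFun_zero n _)
  have h1 : ∀ χ : quadDomain ι, quad (n, 1) χ =
      ((Real.sqrt 2 * Complex.I : ℂ)⁻¹) • (annVec n χ - creVec n χ) :=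
    fun χ => lp.ext (quadFun_one n _)
  fin_cases j
  · simp only [Fin.zero_eta, h0, inner_smul_left, inner_smul_right, inner_add_left, inner_add_right,
      inner_annVec, inner_creVec]
    simp [add_comm]
  · simp only [Fin.mk_one, h1, inner_smul_left, inner_smul_right, inner_sub_left, inner_sub_right,
      inner_annVec, inner_creVec]
    simp
    ring

/-! ### Density operators -/

/-- A quantum state: a positive operator of trace one. -/
structure DensityOp (ι : Type u) [Fintype ι] [DecidableEq ι] where
  op : Fock ι →L[ℂ] Fock ι
  isPositive : op.IsPositive
  hasSum_trace : HasSum (fun m : ι → ℕ => ⟪ket m, op (ket m)⟫_ℂ) 1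

theorem tsum_enorm_inner_sq {α : Type*} {H : Type*} [NormedAddCommGroup H] [InnerProductSpace ℂ H]
    (b : HilbertBasis α ℂ H) (x : H) : ∑' i, ‖⟪b i, x⟫_ℂ‖ₑ ^ 2 = ‖x‖ₑ ^ 2 := by
  have h := lp.hasSum_norm (p := 2) (by norm_num) (b.repr x)
  simp only [ENNReal.toReal_ofNat, Real.rpow_two, LinearIsometryEquiv.norm_map,
    HilbertBasis.repr_apply_apply] at h
  rw [← ofReal_norm, ← ENNReal.ofReal_pow (norm_nonneg _), ← h.tsum_eq,
    ENNReal.ofReal_tsum_of_nonneg (fun _ => by positivity) h.summable]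
  refine tsum_congr fun i => ?_
  rw [← ofReal_norm, ENNReal.ofReal_pow (norm_nonneg _)]

/-- The Hilbert-Schmidt norms of an operator and of its adjoint agree, in any bases. -/
theorem tsum_enorm_adjoint {α β : Type*} {H K : Type*}
    [NormedAddCommGroup H] [InnerProductSpace ℂ H] [CompleteSpace H]
    [NormedAddCommGroup K] [InnerProductSpace ℂ K] [CompleteSpace K]
    (b : HilbertBasis α ℂ H) (c : HilbertBasis β ℂ K) (A : H →L[ℂ] K) :
    ∑' i, ‖A (b i)‖ₑ ^ 2 = ∑' j, ‖A.adjoint (c j)‖ₑ ^ 2 := by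
  simp_rw [← tsum_enorm_inner_sq c (A _), ← tsum_enorm_inner_sq b (A.adjoint _)]
  rw [ENNReal.tsum_comm]
  refine tsum_congr fun j => tsum_congr fun i => ?_
  rw [ContinuousLinearMap.adjoint_inner_right, ← inner_conj_symm]
  simp only [← ofReal_norm, RCLike.norm_conj]

theorem hasSum_norm_sq_iff {α : Type*} {H : Type*} [NormedAddCommGroup H] (v : α → H) :
    HasSum (fun a => ‖v a‖ ^ 2) 1 ↔ ∑' a, ‖v a‖ₑ ^ 2 = 1 := by
  have e : ∀ a, ‖v a‖ₑ ^ 2 = ENNReal.ofReal (‖v a‖ ^ 2) := fun a => by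
    rw [← ofReal_norm, ENNReal.ofReal_pow (norm_nonneg _)]
  simp_rw [e]
  constructor
  · intro h
    rw [← ENNReal.ofReal_tsum_of_nonneg (fun _ => by positivity) h.summable, h.tsum_eq]
    simp
  · intro h
    have hs : Summable fun a => ‖v a‖ ^ 2 := by
      have := ENNReal.summable_toReal (f := fun a => ENNReal.ofReal (‖v a‖ ^ 2)) (by rw [h]; simp)
      simpa [ENNReal.toReal_ofReal, sq_nonneg] using this
    rw [← ENNReal.ofReal_tsum_of_nonneg (fun _ => by positivity) hs] at h
    rw [ENNReal.ofReal_eq_one] at h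
    exact h ▸ hs.hasSum

theorem norm_sq_eq_tsum_ket (ψ : Fock ι) : ‖ψ‖ₑ ^ 2 = ∑' m, ‖ψ m‖ₑ ^ 2 := by
  rw [← tsum_enorm_inner_sq ketBasis ψ]
  simp_rw [ketBasis_apply, inner_ket]

theorem hasSum_inner_family {α : Type*} {v : α → Fock ι} (hv : HasSum (fun a => ‖v a‖ ^ 2) 1) :
    ∃ T : Fock ι →L[ℂ] Fock ι, ∀ φ ψ, HasSum (fun a => ⟪φ, v a⟫_ℂ * ⟪v a, ψ⟫_ℂ) ⟪φ, T ψ⟫_ℂ := by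
  have hs : Summable fun a => InnerProductSpace.rankOne ℂ (v a) (v a) := by
    apply Summable.of_norm
    simpa [InnerProductSpace.norm_rankOne, ← sq] using hv.summable
  refine ⟨∑' a, InnerProductSpace.rankOne ℂ (v a) (v a), fun φ ψ => ?_⟩
  have h1 := ((innerSL ℂ φ).comp (ContinuousLinearMap.apply ℂ (Fock ι) ψ)).hasSum hs.hasSum
  have e : (fun a => ⟪φ, v a⟫_ℂ * ⟪v a, ψ⟫_ℂ)
      = fun a => ⟪φ, InnerProductSpace.rankOne ℂ (v a) (v a) ψ⟫_ℂ := by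
    funext a
    rw [InnerProductSpace.rankOne_apply, inner_smul_right, mul_comm]
  rw [e]
  exact h1

/-- Every ensemble of (unnormalized) vectors of total weight one defines a state. -/
theorem exists_densityOp_of_family {α : Type*} {v : α → Fock ι}
    (hv : HasSum (fun a => ‖v a‖ ^ 2) 1) :
    ∃ ρ : DensityOp ι, ∀ φ ψ, HasSum (fun a => ⟪φ, v a⟫_ℂ * ⟪v a, ψ⟫_ℂ) ⟪φ, ρ.op ψ⟫_ℂ := by
  obtain ⟨T, hT⟩ := hasSum_inner_family hv
  have hdiag : ∀ φ, HasSum (fun a => (‖⟪φ, v a⟫_ℂ‖ ^ 2)) (⟪φ, T φ⟫_ℂ).re ∧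
      ((⟪φ, T φ⟫_ℂ).re : ℂ) = ⟪φ, T φ⟫_ℂ := by
    intro φ
    have h := hT φ φ
    have e : (fun a => ⟪φ, v a⟫_ℂ * ⟪v a, φ⟫_ℂ) = fun a => ((‖⟪φ, v a⟫_ℂ‖ ^ 2 : ℝ) : ℂ) := by
      funext a
      rw [← inner_conj_symm (v a) φ, Complex.mul_conj, Complex.normSq_eq_norm_sq]
    rw [e] at h
    have h2 : HasSum (fun a => ‖⟪φ, v a⟫_ℂ‖ ^ 2) (⟪φ, T φ⟫_ℂ).re := by
      exact Complex.hasSum_re h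
    exact ⟨h2, ((Complex.hasSum_ofReal.2 h2).unique h)⟩
  refine ⟨⟨T, ?_, ?_⟩, hT⟩
  · rw [ContinuousLinearMap.isPositive_iff_complex]
    intro φ
    have h0 : 0 ≤ (⟪φ, T φ⟫_ℂ).re := (hdiag φ).1.nonneg fun _ => by positivity
    have hre : (⟪T φ, φ⟫_ℂ).re = (⟪φ, T φ⟫_ℂ).re := by
      rw [← inner_conj_symm, Complex.conj_re]
    refine ⟨?_, by simpa [hre] using h0⟩
    change ((⟪T φ, φ⟫_ℂ).re : ℂ) = _
    rw [hre, ← inner_conj_symm (T φ) φ, ← (hdiag φ).2]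
    simp
  · have hval : ∀ m : ι → ℕ, ENNReal.ofReal (⟪ket m, T (ket m)⟫_ℂ).re
        = ∑' a, ‖(v a) m‖ₑ ^ 2 := by
      intro m
      have h := (hdiag (ket m)).1
      rw [← h.tsum_eq, ENNReal.ofReal_tsum_of_nonneg (fun _ => by positivity) h.summable]
      refine tsum_congr fun a => ?_
      rw [inner_ket, ← ofReal_norm, ENNReal.ofReal_pow (norm_nonneg _)]
    have htot : ∑' m : ι → ℕ, ENNReal.ofReal (⟪ket m, T (ket m)⟫_ℂ).re = 1 := by
      simp_rw [hval]
      rw [ENNReal.tsum_comm]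
      simp_rw [← norm_sq_eq_tsum_ket]
      exact (hasSum_norm_sq_iff v).1 hv
    have hnn : ∀ m : ι → ℕ, 0 ≤ (⟪ket m, T (ket m)⟫_ℂ).re := fun m =>
      (hdiag (ket m)).1.nonneg fun _ => by positivity
    have hs : Summable fun m : ι → ℕ => (⟪ket m, T (ket m)⟫_ℂ).re := by
      have := ENNReal.summable_toReal
        (f := fun m : ι → ℕ => ENNReal.ofReal (⟪ket m, T (ket m)⟫_ℂ).re) (by rw [htot]; simp)
      simpa [ENNReal.toReal_ofReal, hnn] using this
    rw [← ENNReal.ofReal_tsum_of_nonneg hnn hs, ENNReal.ofReal_eq_one] at htot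
    have h := Complex.hasSum_ofReal.2 (htot ▸ hs.hasSum)
    simpa [(hdiag _).2] using h

theorem exists_eq_adjoint_comp {H : Type*} [NormedAddCommGroup H] [InnerProductSpace ℂ H]
    [CompleteSpace H] (T : H →L[ℂ] H) (hT : T.IsPositive) :
    ∃ B : H →L[ℂ] H, T = B.adjoint ∘L B :=
  CStarAlgebra.nonneg_iff_eq_star_mul_self.1 ((ContinuousLinearMap.nonneg_iff_isPositive _).2 hT)

/-- Every state is a mixture of (unnormalized) pure states. -/
theorem DensityOp.exists_family (ρ : DensityOp ι) :
    ∃ v : (ι → ℕ) → Fock ι, HasSum (fun a => ‖v a‖ ^ 2) 1 ∧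
      ∀ φ ψ, HasSum (fun a => ⟪φ, v a⟫_ℂ * ⟪v a, ψ⟫_ℂ) ⟪φ, ρ.op ψ⟫_ℂ := by
  obtain ⟨B, hB⟩ := exists_eq_adjoint_comp ρ.op ρ.isPositive
  have hB' : ∀ φ ψ, ⟪φ, ρ.op ψ⟫_ℂ = ⟪B φ, B ψ⟫_ℂ := by
    intro φ ψ
    rw [hB]
    simp [ContinuousLinearMap.adjoint_inner_right]
  refine ⟨fun a => B.adjoint (ket a), ?_, fun φ ψ => ?_⟩
  · rw [hasSum_norm_sq_iff]
    have h1 := tsum_enorm_adjoint (ketBasis (ι := ι)) (ketBasis (ι := ι)) B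
    simp only [ketBasis_apply] at h1
    rw [← h1, ← hasSum_norm_sq_iff]
    have h2 := Complex.hasSum_re ρ.hasSum_trace
    simp only [hB', Complex.one_re] at h2
    convert h2 using 2 with a
    rw [inner_self_eq_norm_sq_to_K]
    norm_cast
  · have h := (ketBasis (ι := ι)).hasSum_inner_mul_inner (B φ) (B ψ)
    rw [hB']
    simpa only [ketBasis_apply, ContinuousLinearMap.adjoint_inner_right,
      ContinuousLinearMap.adjoint_inner_left] using h

/-- The pure state `|ψ⟩⟨ψ|`. -/
def DensityOp.pure (ψ : Fock ι) (hψ : ‖ψ‖ = 1) : DensityOp ι where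
  op := InnerProductSpace.rankOne ℂ ψ ψ
  isPositive := InnerProductSpace.isPositive_rankOne_self ψ
  hasSum_trace := by
    have h := (ketBasis (ι := ι)).hasSum_inner_mul_inner ψ ψ
    rw [inner_self_eq_norm_sq_to_K, hψ] at h
    simp only [ketBasis_apply] at h
    simpa [inner_smul_right] using h

open scoped ComplexOrder in
/-- The mixture `p ρ + (1 - p) σ`. -/
def DensityOp.mix (p : ℝ) (hp : p ∈ Set.Icc (0 : ℝ) 1) (ρ σ : DensityOp ι) : DensityOp ι where
  op := (p : ℂ) • ρ.op + ((1 - p : ℝ) : ℂ) • σ.op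
  isPositive := by
    have h1 : (0 : ℂ) ≤ (p : ℂ) := by exact_mod_cast hp.1
    have h2 : (0 : ℂ) ≤ ((1 - p : ℝ) : ℂ) := by exact_mod_cast sub_nonneg.2 hp.2
    exact (ρ.isPositive.smul_of_nonneg h1).add (σ.isPositive.smul_of_nonneg h2)
  hasSum_trace := by
    have h := (ρ.hasSum_trace.mul_left (p : ℂ)).add (σ.hasSum_trace.mul_left ((1 - p : ℝ) : ℂ))
    have e : (p : ℂ) * 1 + ((1 - p : ℝ) : ℂ) * 1 = 1 := by push_cast; ring
    rw [e] at h
    simpa only [add_apply, smul_apply, inner_add_right,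
      inner_smul_right] using h

/-- The transformed state `U ρ U†`. -/
def DensityOp.conj (U : Fock ι ≃ₗᵢ[ℂ] Fock ι) (ρ : DensityOp ι) : DensityOp ι where
  op := (U : Fock ι →L[ℂ] Fock ι) ∘L ρ.op ∘L (U.symm : Fock ι →L[ℂ] Fock ι)
  isPositive := by
    have h := ρ.isPositive.conj_adjoint (U : Fock ι →L[ℂ] Fock ι)
    rwa [LinearIsometryEquiv.adjoint_eq_symm] at h
  hasSum_trace := by
    obtain ⟨v, hv, hρ⟩ := ρ.exists_family
    have hv' : HasSum (fun a => ‖U (v a)‖ ^ 2) 1 := by simpa using hv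
    obtain ⟨τ, hτ⟩ := exists_densityOp_of_family hv'
    have h := τ.hasSum_trace
    convert h using 2 with m
    have h1 := hρ (U.symm (ket m)) (U.symm (ket m))
    have h2 := hτ (ket m) (ket m)
    have e : ∀ x y : Fock ι, ⟪U.symm x, y⟫_ℂ = ⟪x, U y⟫_ℂ := fun x y => by
      rw [← U.inner_map_map, U.apply_symm_apply]
    have e' : ∀ x y : Fock ι, ⟪y, U.symm x⟫_ℂ = ⟪U y, x⟫_ℂ := fun x y => by
      rw [← U.inner_map_map, U.apply_symm_apply]
    simp only [e, e'] at h1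
    exact h1.unique h2

end OneSystem

/-! ### Composite systems -/

section TwoSystems

variable {ι : Type u} [Fintype ι] [DecidableEq ι] {κ : Type v} [Fintype κ] [DecidableEq κ]

theorem tsum_sum_modes (f : (ι ⊕ κ → ℕ) → ℝ≥0∞) :
    ∑' m, f m = ∑' (m : ι → ℕ) (k : κ → ℕ), f (Sum.elim m k) := by
  rw [← ENNReal.tsum_prod, ← (Equiv.sumArrowEquivProdArrow ι κ ℕ).symm.tsum_eq f]
  rfl

theorem memℓp_iff_tsum {α : Type*} (f : α → ℂ) :
    Memℓp f 2 ↔ ∑' a, ‖f a‖ₑ ^ 2 ≠ ⊤ := by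
  rw [memℓp_gen_iff (by norm_num)]
  have e : ∀ a, ‖f a‖ₑ ^ 2 = ENNReal.ofReal (‖f a‖ ^ 2) := fun a => by
    rw [← ofReal_norm, ENNReal.ofReal_pow (norm_nonneg _)]
  simp only [ENNReal.toReal_ofNat, Real.rpow_two, e]
  constructor
  · intro h
    rw [← ENNReal.ofReal_tsum_of_nonneg (fun _ => by positivity) h]
    exact ENNReal.ofReal_ne_top
  · intro h
    have := ENNReal.summable_toReal h
    simpa [ENNReal.toReal_ofReal, sq_nonneg] using this

theorem tsum_product (ψ : Fock ι) (φ : Fock κ) :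
    ∑' m : ι ⊕ κ → ℕ, ‖ψ (m ∘ Sum.inl) * φ (m ∘ Sum.inr)‖ₑ ^ 2 = ‖ψ‖ₑ ^ 2 * ‖φ‖ₑ ^ 2 := by
  rw [tsum_sum_modes, norm_sq_eq_tsum_ket ψ, norm_sq_eq_tsum_ket φ]
  simp only [Sum.elim_comp_inl, Sum.elim_comp_inr, enorm_mul, mul_pow, ENNReal.tsum_mul_left,
    ENNReal.tsum_mul_right]

/-- The product vector `|ψ⟩ ⊗ |φ⟩` of the composite system. -/
def tensorVec (ψ : Fock ι) (φ : Fock κ) : Fock (ι ⊕ κ) :=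
  ⟨fun m => ψ (m ∘ Sum.inl) * φ (m ∘ Sum.inr), (memℓp_iff_tsum _).2 (by
    rw [tsum_product]
    exact ENNReal.mul_ne_top (by simp) (by simp))⟩

theorem tensorVec_apply (ψ : Fock ι) (φ : Fock κ) (m : ι ⊕ κ → ℕ) :
    tensorVec ψ φ m = ψ (m ∘ Sum.inl) * φ (m ∘ Sum.inr) := rfl

theorem enorm_tensorVec (ψ : Fock ι) (φ : Fock κ) :
    ‖tensorVec ψ φ‖ₑ ^ 2 = ‖ψ‖ₑ ^ 2 * ‖φ‖ₑ ^ 2 := by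
  rw [← tsum_product, norm_sq_eq_tsum_ket]
  rfl

theorem tsum_slices (Ψ : Fock (ι ⊕ κ)) :
    ∑' (k : κ → ℕ) (m : ι → ℕ), ‖Ψ (Sum.elim m k)‖ₑ ^ 2 = ‖Ψ‖ₑ ^ 2 := by
  rw [ENNReal.tsum_comm, ← tsum_sum_modes (fun m => ‖Ψ m‖ₑ ^ 2), norm_sq_eq_tsum_ket]

/-- The partial inner product `⟨k|_E Ψ` with a Fock state of the second system. -/
def slice (k : κ → ℕ) (Ψ : Fock (ι ⊕ κ)) : Fock ι :=
  ⟨fun m => Ψ (Sum.elim m k), (memℓp_iff_tsum _).2 (by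
    have h : ∑' (m : ι → ℕ), ‖Ψ (Sum.elim m k)‖ₑ ^ 2 ≤ ‖Ψ‖ₑ ^ 2 := by
      rw [← tsum_slices]
      exact ENNReal.le_tsum (f := fun k : κ → ℕ => ∑' (m : ι → ℕ), ‖Ψ (Sum.elim m k)‖ₑ ^ 2) k
    exact ne_top_of_le_ne_top (by simp) h)⟩

theorem slice_apply (k : κ → ℕ) (Ψ : Fock (ι ⊕ κ)) (m : ι → ℕ) :
    slice k Ψ m = Ψ (Sum.elim m k) := rfl

theorem hasSum_norm_tensorVec {α β : Type*} {v : α → Fock ι} {w : β → Fock κ}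
    (hv : HasSum (fun a => ‖v a‖ ^ 2) 1) (hw : HasSum (fun b => ‖w b‖ ^ 2) 1) :
    HasSum (fun a : α × β => ‖tensorVec (v a.1) (w a.2)‖ ^ 2) 1 := by
  rw [hasSum_norm_sq_iff] at hv hw ⊢
  simp_rw [enorm_tensorVec]
  rw [ENNReal.tsum_prod (f := fun a b => ‖v a‖ₑ ^ 2 * ‖w b‖ₑ ^ 2)]
  simp only [ENNReal.tsum_mul_left, hv, hw, mul_one]

theorem hasSum_mul_complex {α β : Type*} {f : α → ℂ} {g : β → ℂ} {x y : ℂ} (hf : HasSum f x)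
    (hg : HasSum g y) : HasSum (fun p : α × β => f p.1 * g p.2) (x * y) :=
  hf.mul hg (summable_mul_of_summable_norm hf.summable.norm hg.summable.norm)

theorem exists_tensor (ρ : DensityOp ι) (σ : DensityOp κ) :
    ∃ τ : DensityOp (ι ⊕ κ), ∀ (m m' : ι → ℕ) (k k' : κ → ℕ),
      ⟪ket (Sum.elim m k), τ.op (ket (Sum.elim m' k'))⟫_ℂ
        = ⟪ket m, ρ.op (ket m')⟫_ℂ * ⟪ket k, σ.op (ket k')⟫_ℂ := by
  obtain ⟨v, hv, hρ⟩ := ρ.exists_family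
  obtain ⟨w, hw, hσ⟩ := σ.exists_family
  obtain ⟨τ, hτ⟩ := exists_densityOp_of_family (hasSum_norm_tensorVec hv hw)
  refine ⟨τ, fun m m' k k' => ?_⟩
  have h3 := hτ (ket (Sum.elim m k)) (ket (Sum.elim m' k'))
  have h4 := hasSum_mul_complex (hρ (ket m) (ket m')) (hσ (ket k) (ket k'))
  have e : ∀ p : (ι → ℕ) × (κ → ℕ),
      ⟪ket (Sum.elim m k), tensorVec (v p.1) (w p.2)⟫_ℂ
          * ⟪tensorVec (v p.1) (w p.2), ket (Sum.elim m' k')⟫_ℂ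
        = ⟪ket m, v p.1⟫_ℂ * ⟪v p.1, ket m'⟫_ℂ * (⟪ket k, w p.2⟫_ℂ * ⟪w p.2, ket k'⟫_ℂ) := by
    intro p
    rw [inner_ket, inner_ket', inner_ket, inner_ket', inner_ket, inner_ket', tensorVec_apply,
      tensorVec_apply, Sum.elim_comp_inl, Sum.elim_comp_inr, Sum.elim_comp_inl, Sum.elim_comp_inr,
      map_mul]
    ring
  rw [← funext e] at h4
  exact h3.unique h4

/-- The product state `ρ ⊗ σ`, determined by its matrix elements in the Fock basis. -/
def DensityOp.tensor (ρ : DensityOp ι) (σ : DensityOp κ) : DensityOp (ι ⊕ κ) :=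
  (exists_tensor ρ σ).choose

theorem exists_partialTrace (τ : DensityOp (ι ⊕ κ)) :
    ∃ ρ : DensityOp ι, ∀ m m' : ι → ℕ,
      HasSum (fun k : κ → ℕ => ⟪ket (Sum.elim m k), τ.op (ket (Sum.elim m' k))⟫_ℂ)
        ⟪ket m, ρ.op (ket m')⟫_ℂ := by
  obtain ⟨v, hv, hτ⟩ := τ.exists_family
  have hs : HasSum (fun a : (κ → ℕ) × (ι ⊕ κ → ℕ) => ‖slice a.1 (v a.2)‖ ^ 2) 1 := by
    rw [hasSum_norm_sq_iff] at hv ⊢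
    rw [ENNReal.tsum_prod (f := fun k a => ‖slice k (v a)‖ₑ ^ 2), ENNReal.tsum_comm, ← hv]
    refine tsum_congr fun a => ?_
    rw [← tsum_slices]
    refine tsum_congr fun k => ?_
    rw [norm_sq_eq_tsum_ket]
    rfl
  obtain ⟨ρ, hρ⟩ := exists_densityOp_of_family hs
  refine ⟨ρ, fun m m' => (hρ (ket m) (ket m')).prod_fiberwise fun k => ?_⟩
  have h := hτ (ket (Sum.elim m k)) (ket (Sum.elim m' k))
  simp only [inner_ket, inner_ket', slice_apply] at h ⊢
  exact h

/-- The reduced state `Tr_E τ` of the first system, determined by its matrix elements in the Fock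
basis. -/
def DensityOp.partialTrace (τ : DensityOp (ι ⊕ κ)) : DensityOp ι :=
  (exists_partialTrace τ).choose

end TwoSystems

/-! ### Coherent and classical states -/

section Classical

variable {ι : Type u} [Fintype ι] [DecidableEq ι]

/-- The amplitudes of the multimode coherent state `|α⟩ = ⨂ |α_n⟩`. -/
def coherentFun (α : ι → ℂ) (m : ι → ℕ) : ℂ :=
  ∏ n, (Real.exp (-‖α n‖ ^ 2 / 2) : ℂ) * α n ^ m n / (Real.sqrt (m n).factorial : ℂ)

theorem tsum_prod_modes {ι : Type*} [Fintype ι] [DecidableEq ι] (g : ι → ℕ → ℝ≥0∞)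
    (hg : ∀ n, ∑' j, g n j = 1) : ∑' m : ι → ℕ, ∏ n, g n (m n) = 1 := by
  rw [ENNReal.tsum_eq_iSup_sum' (fun N : ℕ => Fintype.piFinset fun _ : ι => Finset.range N)]
  · simp_rw [Finset.sum_prod_piFinset]
    have hmono : Monotone fun N : ℕ => ∏ n, ∑ j ∈ Finset.range N, g n j := by
      intro N M h
      exact Finset.prod_le_prod' fun n _ =>
        Finset.sum_le_sum_of_subset (Finset.range_mono h)
    refine tendsto_nhds_unique (tendsto_atTop_iSup hmono) ?_
    have h := ENNReal.tendsto_finsetProd_of_ne_top (Finset.univ : Finset ι)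
      (f := fun n N => ∑ j ∈ Finset.range N, g n j) (x := Filter.atTop) (a := fun _ => 1)
      (fun n _ => hg n ▸ ENNReal.tendsto_nat_tsum (g n)) (by simp)
    simpa using h
  · intro t
    refine ⟨t.sup (fun m => Finset.univ.sup m) + 1, fun m hm => ?_⟩
    rw [Fintype.mem_piFinset]
    intro n
    rw [Finset.mem_range, Nat.lt_succ_iff]
    exact (Finset.le_sup (f := m) (Finset.mem_univ n)).trans
      (Finset.le_sup (f := fun m : ι → ℕ => Finset.univ.sup m) hm)

theorem tsum_poisson (z : ℂ) : ∑' j : ℕ,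
    ‖(Real.exp (-‖z‖ ^ 2 / 2) : ℂ) * z ^ j / (Real.sqrt j.factorial : ℂ)‖ₑ ^ 2 = 1 := by
  have h := ProbabilityTheory.hasSum_one_poissonMeasure (‖z‖₊ ^ 2)
  have e : ∀ j : ℕ, ‖(Real.exp (-‖z‖ ^ 2 / 2) : ℂ) * z ^ j / (Real.sqrt j.factorial : ℂ)‖ₑ ^ 2
      = ENNReal.ofReal (Real.exp (-(‖z‖₊ ^ 2 : NNReal)) * (‖z‖₊ ^ 2 : NNReal) ^ j / j.factorial) := by
    intro j
    rw [← ofReal_norm, ← ENNReal.ofReal_pow (norm_nonneg _)]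
    congr 1
    rw [norm_div, norm_mul, norm_pow, Complex.norm_real,
      Complex.norm_real, Real.norm_of_nonneg (Real.exp_nonneg _),
      Real.norm_of_nonneg (Real.sqrt_nonneg _), div_pow, mul_pow, Real.sq_sqrt (by positivity),
      ← Real.exp_nat_mul]
    push_cast
    congr 2
    · congr 1
      ring
    · ring
  simp_rw [e]
  rw [← ENNReal.ofReal_tsum_of_nonneg (fun _ => by positivity) h.summable, h.tsum_eq]
  simp

theorem tsum_coherentFun (α : ι → ℂ) : ∑' m, ‖coherentFun α m‖ₑ ^ 2 = 1 := by
  have e : ∀ m, ‖coherentFun α m‖ₑ ^ 2 = ∏ n, ‖(Real.exp (-‖α n‖ ^ 2 / 2) : ℂ) * α n ^ m n /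
      (Real.sqrt (m n).factorial : ℂ)‖ₑ ^ 2 := fun m => by
    rw [coherentFun, Finset.prod_pow]
    congr 1
    simp only [← ofReal_norm, norm_prod]
    exact ENNReal.ofReal_prod_of_nonneg fun _ _ => norm_nonneg _
  simp_rw [e]
  exact tsum_prod_modes _ fun n => tsum_poisson (α n)

/-- The multimode coherent state `|α⟩`. -/
def coherentVec (α : ι → ℂ) : Fock ι :=
  ⟨coherentFun α, (memℓp_iff_tsum _).2 (by rw [tsum_coherentFun]; simp)⟩

theorem norm_coherentVec (α : ι → ℂ) : ‖coherentVec α‖ = 1 := by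
  have h : ‖coherentVec α‖ₑ ^ 2 = 1 := by
    rw [norm_sq_eq_tsum_ket]
    exact tsum_coherentFun α
  rw [← ofReal_norm, ← ENNReal.ofReal_pow (norm_nonneg _), ENNReal.ofReal_eq_one] at h
  nlinarith [norm_nonneg (coherentVec α)]

/-- The coherent state `|α⟩⟨α|` as a density operator. -/
def DensityOp.coherent (α : ι → ℂ) : DensityOp ι :=
  .pure (coherentVec α) (norm_coherentVec α)

/-- A state is classical if it is a statistical mixture `∫ |α⟩⟨α| dP(α)` of coherent states, where
the (possibly singular) P function is a probability measure on phase space. -/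
def DensityOp.IsClassical (ρ : DensityOp ι) : Prop :=
  ∃ P : MeasureTheory.Measure (ι → ℂ), MeasureTheory.IsProbabilityMeasure P ∧
    ∀ φ ψ : Fock ι, ⟪φ, ρ.op ψ⟫_ℂ = ∫ α, ⟪φ, coherentVec α⟫_ℂ * ⟪coherentVec α, ψ⟫_ℂ ∂P

end Classical

/-! ### Linear optics -/

section LinearOptics

variable {ι : Type u} [Fintype ι] [DecidableEq ι] {κ : Type v} [Fintype κ] [DecidableEq κ]

/-- Linear optical unitaries: unitary operators that act on the quadratures by a rotation and a
displacement, `U† R^(k) U = ∑ l, O k l R^(l) + d k`. (By the canonical commutation relations, `O` is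
then automatically symplectic.) -/
def IsLinearOptical (U : Fock ι ≃ₗᵢ[ℂ] Fock ι) : Prop :=
  ∃ O ∈ Matrix.orthogonalGroup (ι × Fin 2) ℝ, ∃ d : ι × Fin 2 → ℝ,
    ∀ ψ : quadDomain ι, ∃ h : U ψ ∈ quadDomain ι, ∀ k,
      quad k ⟨U ψ, h⟩ = U (∑ l, (O k l : ℂ) • quad l ψ + (d k : ℂ) • (ψ : Fock ι))

/-- The map `ρ ↦ Tr_E [U (ρ ⊗ σ) U†]`, which is a linear optical map when `U` is a linear optical
unitary and the state `σ` of the ancilla is classical. -/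
def dilationMap (U : Fock (ι ⊕ κ) ≃ₗᵢ[ℂ] Fock (ι ⊕ κ)) (σ : DensityOp κ) (ρ : DensityOp ι) :
    DensityOp ι :=
  ((ρ.tensor σ).conj U).partialTrace

end LinearOptics

/-! ### Quantum Fisher information and metrological power -/

section Metrology

variable {ι : Type u} [Fintype ι] [DecidableEq ι]

/-- An eigenvalue decomposition `ρ = ∑ i, λ i |i⟩⟨i|` in an orthonormal basis of eigenvectors. -/
structure SpectralDecomposition (ρ : DensityOp ι) where
  index : Type u
  basis : HilbertBasis index ℂ (Fock ι)
  eigenvalue : index → ℝ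
  apply_basis : ∀ i, ρ.op (basis i) = (eigenvalue i : ℂ) • basis i

theorem isCompactOperator_rankOne {H : Type*} [NormedAddCommGroup H] [InnerProductSpace ℂ H]
    (x y : H) : IsCompactOperator (InnerProductSpace.rankOne ℂ x y) :=
  (isCompactOperator_of_locallyCompactSpace_rng
    (ContinuousLinearMap.toSpanSingleton ℂ x)).comp_clm (innerSL ℂ y)

theorem exists_eigenbasis {H : Type*} [NormedAddCommGroup H] [InnerProductSpace ℂ H]
    [CompleteSpace H] (T : H →L[ℂ] H) (hc : IsCompactOperator T) (hs : T.IsPositive) :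
    ∃ (w : (μ : ℂ) → Set (Module.End.eigenspace (T : H →ₗ[ℂ] H) μ))
      (b : HilbertBasis (Σ μ, w μ) ℂ H), ∀ i, T (b i) = (i.1.re : ℂ) • b i := by
  have hsym := hs.isSymmetric
  have hex : ∀ μ : ℂ, ∃ w : Set (Module.End.eigenspace (T : H →ₗ[ℂ] H) μ),
      ∃ b : HilbertBasis w ℂ (Module.End.eigenspace (T : H →ₗ[ℂ] H) μ), ⇑b = Subtype.val := by
    intro μ
    have : CompleteSpace (Module.End.eigenspace (T : H →ₗ[ℂ] H) μ) :=
      IsClosed.completeSpace_coe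
    exact exists_hilbertBasis ℂ _
  choose w c hwc using hex
  have hortho := hsym.orthogonalFamily_eigenspaces.orthonormal_sigma_orthonormal
    (fun μ => (c μ).orthonormal)
  have htot : (Submodule.span ℂ (Set.range fun a : Σ μ, w μ =>
      (Module.End.eigenspace (T : H →ₗ[ℂ] H) a.1).subtypeₗᵢ (c a.1 a.2)))ᗮ = ⊥ := by
    rw [eq_bot_iff, ← T.orthogonalComplement_iSup_eigenspaces_eq_bot hc hsym]
    intro x hx
    rw [Submodule.mem_orthogonal] at hx
    rw [← Submodule.iInf_orthogonal, Submodule.mem_iInf]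
    intro μ y hy
    have h := (c μ).hasSum_repr ⟨y, hy⟩
    have h2 := ((innerSL ℂ x).comp (Module.End.eigenspace (T : H →ₗ[ℂ] H) μ).subtypeL).hasSum h
    have h3 : ⟪x, y⟫_ℂ = 0 := by
      refine h2.unique ?_
      convert hasSum_zero with i
      have h4 := hx _ (Submodule.subset_span ⟨⟨μ, i⟩, rfl⟩)
      have h5 : ⟪x, ((c μ i : Module.End.eigenspace (T : H →ₗ[ℂ] H) μ) : H)⟫_ℂ = 0 := by
        rw [inner_eq_zero_symm]
        simpa using h4
      simp [h5]
    rw [← inner_conj_symm, h3, map_zero]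
  refine ⟨w, HilbertBasis.mkOfOrthogonalEqBot hortho htot, fun i => ?_⟩
  rw [HilbertBasis.coe_mkOfOrthogonalEqBot]
  have hm := Module.End.mem_eigenspace_iff.1 (c i.1 i.2).2
  have hne : ((c i.1 i.2 : Module.End.eigenspace (T : H →ₗ[ℂ] H) i.1) : H) ≠ 0 := by
    have := (c i.1).orthonormal.ne_zero i.2
    simpa using this
  have hreal := hsym.conj_eigenvalue_eq_self
    (Module.End.hasEigenvalue_of_hasEigenvector ⟨(c i.1 i.2).2, hne⟩)
  rw [Complex.conj_eq_iff_re.1 hreal]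
  exact hm

theorem DensityOp.isCompactOperator (ρ : DensityOp ι) : IsCompactOperator ρ.op := by
  obtain ⟨v, hv, hρ⟩ := ρ.exists_family
  have hs : Summable fun a => InnerProductSpace.rankOne ℂ (v a) (v a) := by
    apply Summable.of_norm
    simpa [InnerProductSpace.norm_rankOne, ← sq] using hv.summable
  have hsum : HasSum (fun a => InnerProductSpace.rankOne ℂ (v a) (v a)) ρ.op := by
    convert hs.hasSum
    refine ContinuousLinearMap.ext fun ψ => ext_inner_left ℂ fun φ => ?_
    refine (hρ φ ψ).unique ?_
    have h1 := ((innerSL ℂ φ).comp (ContinuousLinearMap.apply ℂ (Fock ι) ψ)).hasSum hs.hasSum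
    have e : (fun a => ⟪φ, v a⟫_ℂ * ⟪v a, ψ⟫_ℂ)
        = fun a => ⟪φ, InnerProductSpace.rankOne ℂ (v a) (v a) ψ⟫_ℂ := by
      funext a
      rw [InnerProductSpace.rankOne_apply, inner_smul_right, mul_comm]
    rw [e]
    exact h1
  refine isCompactOperator_of_tendsto hsum (Filter.Eventually.of_forall fun t => ?_)
  exact (compactOperator (RingHom.id ℂ) (Fock ι) (Fock ι)).sum_mem
    fun a _ => isCompactOperator_rankOne (v a) (v a)

theorem DensityOp.nonempty_spectralDecomposition (ρ : DensityOp ι) :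
    Nonempty (SpectralDecomposition ρ) := by
  obtain ⟨w, b, hb⟩ := exists_eigenbasis ρ.op ρ.isCompactOperator ρ.isPositive
  exact ⟨⟨_, b, fun i => i.1.re, hb⟩⟩

/-- A chosen eigenvalue decomposition. -/
def DensityOp.spectral (ρ : DensityOp ι) : SpectralDecomposition ρ :=
  Classical.choice ρ.nonempty_spectralDecomposition

/-- The bounded operator `C` is the commutator `[R^(k), ρ]` (in the sense of quadratic forms). -/
def IsQuadCommutator (ρ : DensityOp ι) (k : ι × Fin 2) (C : Fock ι →L[ℂ] Fock ι) : Prop :=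
  ∀ φ ψ : quadDomain ι,
    ⟪(φ : Fock ι), C ψ⟫_ℂ = ⟪quad k φ, ρ.op ψ⟫_ℂ - ⟪ρ.op φ, quad k ψ⟫_ℂ

/-- Between eigenvectors in the domain of the quadratures, `⟨i|[R^(k), ρ]|j⟩ = (λ j - λ i) ⟨i|R^(k)|j⟩`. -/
theorem inner_quadCommutator {ρ : DensityOp ι} {k : ι × Fin 2} {C : Fock ι →L[ℂ] Fock ι}
    (hC : IsQuadCommutator ρ k C) {φ ψ : quadDomain ι} {a b : ℝ}
    (hφ : ρ.op φ = (a : ℂ) • (φ : Fock ι)) (hψ : ρ.op ψ = (b : ℂ) • (ψ : Fock ι)) :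
    ⟪(φ : Fock ι), C ψ⟫_ℂ = ((b - a : ℝ) : ℂ) * ⟪(φ : Fock ι), quad k ψ⟫_ℂ := by
  rw [hC, hφ, hψ, inner_smul_left, inner_smul_right, quad_symmetric]
  simp [sub_mul]

open Classical in
/-- The commutator `[R^(k), ρ]`, if it is bounded (and `0` otherwise). -/
def quadCommutator (ρ : DensityOp ι) (k : ι × Fin 2) : Fock ι →L[ℂ] Fock ι :=
  if h : ∃ C, IsQuadCommutator ρ k C then h.choose else 0

/-- The quantum Fisher information `I_F(ρ, R^(k)) = 2 ∑ i j, (λ i - λ j)² / (λ i + λ j) |⟨i|R^(k)|j⟩|²`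
as an extended nonnegative real. It is written with `⟨i|[R^(k), ρ]|j⟩ = (λ j - λ i) ⟨i|R^(k)|j⟩`, since
the matrix elements of the commutator make sense without any assumption on the energy of `ρ`. -/
def quadQFI (ρ : DensityOp ι) (k : ι × Fin 2) : ℝ≥0∞ :=
  2 * ∑' p : ρ.spectral.index × ρ.spectral.index,
    ‖⟪ρ.spectral.basis p.1, quadCommutator ρ k (ρ.spectral.basis p.2)⟫_ℂ‖ₑ ^ 2 /
      ENNReal.ofReal (ρ.spectral.eigenvalue p.1 + ρ.spectral.eigenvalue p.2)

/-- The quantum Fisher information of every quadrature is defined and finite. This holds for all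
states of finite mean photon number, and for all classical states. -/
def HasFiniteQFI (ρ : DensityOp ι) : Prop :=
  ∀ k : ι × Fin 2, (∃ C, IsQuadCommutator ρ k C) ∧ quadQFI ρ k ≠ ⊤

/-- The quadrature QFI matrix
`F k l = 2 ∑ i j, (λ i - λ j)² / (λ i + λ j) ⟨i|R^(k)|j⟩ ⟨j|R^(l)|i⟩` (a real symmetric matrix), written
with the matrix elements of the commutators `[R^(k), ρ]` as in `quadQFI`. -/
def qfiMatrix (ρ : DensityOp ι) : Matrix (ι × Fin 2) (ι × Fin 2) ℝ :=
  Matrix.of fun k l => 2 * ∑' p : ρ.spectral.index × ρ.spectral.index,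
    (⟪ρ.spectral.basis p.1, quadCommutator ρ k (ρ.spectral.basis p.2)⟫_ℂ *
      conj ⟪ρ.spectral.basis p.1, quadCommutator ρ l (ρ.spectral.basis p.2)⟫_ℂ).re /
      (ρ.spectral.eigenvalue p.1 + ρ.spectral.eigenvalue p.2)

/-- The largest eigenvalue of a real symmetric matrix. -/
def lambdaMax {n : Type*} [Fintype n] [DecidableEq n] (F : Matrix n n ℝ) : ℝ :=
  sSup {x : ℝ | Module.End.HasEigenvalue (Matrix.toLin' F) x}

open Classical in
/-- The metrological power `max {λ_max(F) / 2 - 1, 0}`, which is `+∞` if the quantum Fisher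
information of some quadrature is infinite. -/
def metrologicalPower (ρ : DensityOp ι) : EReal :=
  if HasFiniteQFI ρ then ((max (lambdaMax (qfiMatrix ρ) / 2 - 1) 0 : ℝ) : EReal) else ⊤

end Metrology

end Bosonic

end

open Bosonic

/-!
Write `R_u = ∑ k, u k R^(k)` for the generalized quadrature in the direction `u` of phase space.
The quantum Fisher information of `ρ` for the generator `R_u` is the quadratic form `uᵀ F u`, so
that, for `c ≥ 0`, `metrologicalPower ρ ≤ c` means that it is at most `2 (c + 1) ‖u‖²` for all `u`.
The proof rests on two dual descriptions of this quantity, neither of which mentions the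
eigenvalues of `ρ`.

* As a minimum (`IsDecomposition`): it is four times the least value of `∑ a, ‖l a‖²`, where
  `ρ = ∑ a, |v a⟩⟨v a|` and `[R_u, ρ] = ∑ a, (|l a⟩⟨v a| - |v a⟩⟨l a|)`. The spectral decomposition
  provides a minimizer (`exists_isDecomposition`).
* As a maximum (`DualBound`): half of it is the supremum of `2 Re Tr (X† C) - Tr (X† (ρ X + X ρ))`
  over the operators `X` of finite rank, where `C = [R_u, ρ]` is the commutator. Completing the
  square shows that every decomposition bounds the supremum (`IsDecomposition.dualBound`), and
  operators `X` that are finite matrices in the eigenbasis show that the supremum bounds the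
  quantum Fisher information (`specNorm_le_of_dualBound`).

Hence `metrologicalPower ρ ≤ c` may be used in the form of decompositions
(`exists_isDecomposition_of_metrologicalPower_le`) and proved by exhibiting decompositions or dual
bounds (`metrologicalPower_le_of_isDecomposition`, `metrologicalPower_le_of_dualBound`). Only
bounded commutators occur in both descriptions, so the energy of the states need not be finite.

* Unitaries: a linear optical unitary maps the vectors of a decomposition for the rotated direction
  to one for `u`, and the displacement drops out of the commutator (`metrologicalPower_conj_le`).
  The inverse of a linear optical unitary is linear optical, hence equality.
* Partial trace: the vectors of a decomposition of the joint state can be sliced with the Fock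
  states of the discarded modes without changing `∑ a, ‖l a‖²` (`Subsystem.isDecomposition`).
* Products: decompositions of the factors combine by the Leibniz rule into `l a ⊗ w b + v a ⊗ r b`.
  The cross terms of the norms vanish, since the diagonal overlaps `⟨v a | l a⟩` of the optimal
  decompositions are imaginary, and since their sum is half the trace of a commutator with `ρ`,
  which is zero. The last fact holds although `R_u` is unbounded: the diagonal of the commutator is
  the discrete divergence of a current between photon number configurations, and a cutoff of slope
  `1 / K` beats the growth `√K` of the matrix elements (`IsDecomposition.hasSum_trace`). The total
  is at most the maximum of the two bounds, as the two parts of a direction have orthogonal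
  supports (`metrologicalPower_tensor_le`).
* Convexity and classical states: the dual bound is linear in `ρ`, `C` and the bound. So it can be
  mixed (`DualBound.mix`), and integrated over the coherent states, which satisfy it with the
  vacuum value `‖u‖²` (`coherentComm_spec`).
* Pure states: finiteness of the quantum Fisher information puts the vector into the domain of the
  quadratures, and metrological power `0` means that every quadrature has at most the vacuum
  variance. The canonical commutation relations then make the vector an eigenvector of all
  annihilation operators (`exists_annVec_eq`), which determines its amplitudes.

Monotonicity under linear optical maps combines these facts: the classical ancilla contributes `0`
to the maximum in the product rule.
-/

noncomputable section

namespace Bosonic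

universe u v w

/-! ### Ladder operators on Fock states -/

section Ladder

variable {ι : Type u} [Fintype ι] [DecidableEq ι]

theorem ket_apply (m j : ι → ℕ) : (ket m : Fock ι) j = if j = m then 1 else 0 := by
  rw [ket, lp.single_apply, Pi.single_apply]

theorem annihilate_ket (n : ι) (m : ι → ℕ) :
    annihilate n (ket m : Fock ι) = ((Real.sqrt (m n) : ℂ) • ket (m - Pi.single n 1) : Fock ι) := by
  funext j
  simp only [annihilate, LinearMap.coe_mk, AddHom.coe_mk, ket_apply, lp.coeFn_smul, Pi.smul_apply,
    smul_eq_mul]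
  by_cases h : j + Pi.single n 1 = m
  · subst h
    simp
  · rw [if_neg h, mul_zero]
    split_ifs with h2
    · have h0 : m n = 0 := by
        by_contra h0
        apply h
        funext i
        rw [h2]
        by_cases hi : i = n
        · subst hi; simp; omega
        · simp [hi]
      simp [h0]
    · simp

theorem create_ket (n : ι) (m : ι → ℕ) :
    create n (ket m : Fock ι) =
      ((Real.sqrt (m n + 1) : ℂ) • ket (m + Pi.single n 1) : Fock ι) := by
  funext j
  simp only [create, LinearMap.coe_mk, AddHom.coe_mk, ket_apply, lp.coeFn_smul, Pi.smul_apply,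
    smul_eq_mul]
  by_cases h : j = m + Pi.single n 1
  · subst h
    simp
  · rw [if_neg h, mul_zero]
    split_ifs with h2
    · have h0 : j n = 0 := by
        by_contra h0
        apply h
        funext i
        rw [← h2]
        by_cases hi : i = n
        · subst hi; simp; omega
        · simp [hi]
      simp [h0]
    · simp

/-- Fock states lie in the domain of the quadratures. -/
theorem ket_mem_quadDomain (m : ι → ℕ) : (ket m : Fock ι) ∈ quadDomain ι := by
  rintro ⟨n, j⟩
  have ha : Memℓp (annihilate n (ket m : Fock ι)) 2 := annihilate_ket n m ▸ lp.memℓp _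
  have hc : Memℓp (create n (ket m : Fock ι)) 2 := create_ket n m ▸ lp.memℓp _
  fin_cases j
  · simp only [Fin.zero_eta, quadFun_zero]
    exact (ha.add hc).const_smul _
  · simp only [Fin.mk_one, quadFun_one]
    exact (ha.sub hc).const_smul _

/-- The Fock state `|m⟩` as a vector of the domain of the quadratures. -/
def ketVec (m : ι → ℕ) : quadDomain ι := ⟨ket m, ket_mem_quadDomain m⟩

theorem coe_ketVec (m : ι → ℕ) : ((ketVec m : quadDomain ι) : Fock ι) = ket m := rfl

theorem annVec_ketVec (n : ι) (m : ι → ℕ) :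
    annVec n (ketVec m) = (Real.sqrt (m n) : ℂ) • ket (m - Pi.single n 1) :=
  lp.ext (annihilate_ket n m)

theorem creVec_ketVec (n : ι) (m : ι → ℕ) :
    creVec n (ketVec m) = (Real.sqrt (m n + 1) : ℂ) • ket (m + Pi.single n 1) :=
  lp.ext (create_ket n m)

/-- The generalized quadrature `∑ k, u k R^(k)`. -/
def quadDir (u : ι × Fin 2 → ℝ) : quadDomain ι →ₗ[ℂ] Fock ι := ∑ k, (u k : ℂ) • quad k

theorem quadDir_apply (u : ι × Fin 2 → ℝ) (ψ : quadDomain ι) :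
    quadDir u ψ = ∑ k, (u k : ℂ) • quad k ψ := by
  rw [quadDir, LinearMap.sum_apply]
  rfl

theorem quadDir_single (k : ι × Fin 2) :
    quadDir (Pi.single k 1) = (quad k : quadDomain ι →ₗ[ℂ] _) := by
  rw [quadDir, Finset.sum_eq_single k]
  · simp
  · intro l _ hl
    simp [hl]
  · simp

theorem quadDir_symmetric (u : ι × Fin 2 → ℝ) (φ ψ : quadDomain ι) :
    ⟪quadDir u φ, (ψ : Fock ι)⟫_ℂ = ⟪(φ : Fock ι), quadDir u ψ⟫_ℂ := by
  rw [quadDir_apply, quadDir_apply, sum_inner, inner_sum]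
  refine Finset.sum_congr rfl fun k _ => ?_
  rw [inner_smul_left, inner_smul_right, quad_symmetric, Complex.conj_ofReal]

/-- The coefficient of `a_n†` in the generalized quadrature `∑ k, u k R^(k)`. -/
def ladderCoeff (u : ι × Fin 2 → ℝ) (n : ι) : ℂ :=
  (Real.sqrt 2 : ℂ)⁻¹ * (u (n, 0) + Complex.I * u (n, 1))

theorem norm_sq_ladderCoeff (u : ι × Fin 2 → ℝ) (n : ι) :
    ‖ladderCoeff u n‖ ^ 2 = (u (n, 0) ^ 2 + u (n, 1) ^ 2) / 2 := by
  rw [← Complex.normSq_eq_norm_sq, ladderCoeff, map_mul, map_inv₀, Complex.normSq_ofReal,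
    Real.mul_self_sqrt (by norm_num), Complex.normSq_apply]
  simp
  ring

theorem sum_norm_sq_ladderCoeff (u : ι × Fin 2 → ℝ) :
    ∑ n, ‖ladderCoeff u n‖ ^ 2 = (∑ k, u k ^ 2) / 2 := by
  rw [Fintype.sum_prod_type, Finset.sum_div]
  refine Finset.sum_congr rfl fun n _ => ?_
  rw [norm_sq_ladderCoeff, Fin.sum_univ_two]

theorem quad_zero_eq (n : ι) (ψ : quadDomain ι) :
    quad (n, 0) ψ = ((Real.sqrt 2 : ℂ)⁻¹) • (annVec n ψ + creVec n ψ) :=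
  lp.ext (quadFun_zero n _)

theorem quad_one_eq (n : ι) (ψ : quadDomain ι) :
    quad (n, 1) ψ = ((Real.sqrt 2 * Complex.I : ℂ)⁻¹) • (annVec n ψ - creVec n ψ) :=
  lp.ext (quadFun_one n _)

theorem quadDir_eq_ladder (u : ι × Fin 2 → ℝ) (ψ : quadDomain ι) :
    quadDir u ψ = ∑ n, (conj (ladderCoeff u n) • annVec n ψ + ladderCoeff u n • creVec n ψ) := by
  rw [quadDir_apply, Fintype.sum_prod_type]
  refine Finset.sum_congr rfl fun n _ => ?_
  rw [Fin.sum_univ_two, quad_zero_eq, quad_one_eq, ladderCoeff]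
  simp only [smul_smul, smul_add, smul_sub, map_mul, map_add, map_inv₀, Complex.conj_ofReal,
    Complex.conj_I, mul_inv, Complex.inv_I]
  module

/-- The matrix elements `⟨m| R^(k) |ψ⟩` are those of the action on amplitudes, even outside the
domain of the quadratures. -/
theorem inner_quad_ketVec (k : ι × Fin 2) (m : ι → ℕ) (ψ : Fock ι) :
    ⟪quad k (ketVec m), ψ⟫_ℂ = quadFun k ψ m := by
  have ha : ∀ n, ⟪annVec n (ketVec m), ψ⟫_ℂ = create n ψ m := by
    intro n
    rw [annVec_ketVec, inner_smul_left, inner_ket]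
    simp [create]
  have hc : ∀ n, ⟪creVec n (ketVec m), ψ⟫_ℂ = annihilate n ψ m := by
    intro n
    rw [creVec_ketVec, inner_smul_left, inner_ket]
    simp [annihilate]
  obtain ⟨n, j⟩ := k
  fin_cases j
  · simp only [Fin.zero_eta, quad_zero_eq, quadFun_zero, inner_smul_left, inner_add_left, ha, hc,
      Pi.smul_apply, Pi.add_apply, smul_eq_mul]
    simp [add_comm]
  · simp only [Fin.mk_one, quad_one_eq, quadFun_one, inner_smul_left, inner_sub_left, ha, hc,
      Pi.smul_apply, Pi.sub_apply, smul_eq_mul]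
    simp
    ring

/-- A vector is in the domain of the quadratures as soon as all functionals
`φ ↦ ⟨R^(k) φ | ψ⟩` on Fock states are given by vectors. -/
theorem mem_quadDomain_of_inner {ψ : Fock ι} (χ : ι × Fin 2 → Fock ι)
    (h : ∀ k m, ⟪quad k (ketVec m), ψ⟫_ℂ = χ k m) : ψ ∈ quadDomain ι := by
  intro k
  have e : quadFun k ψ = χ k := funext fun m => by rw [← inner_quad_ketVec, h]
  rw [e]
  exact lp.memℓp _

theorem hasSum_ket (ψ : Fock ι) : HasSum (fun m => ψ m • ket m) ψ := by
  convert lp.hasSum_single (by norm_num) ψ with m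
  rw [ket, ← lp.single_smul, smul_eq_mul, mul_one]

theorem add_single_injective (n : ι) : Function.Injective fun m : ι → ℕ => m + Pi.single n 1 :=
  add_left_injective _

theorem mem_range_add_single {n : ι} {m : ι → ℕ} (h : m n ≠ 0) :
    m ∈ Set.range fun m : ι → ℕ => m + Pi.single n 1 := by
  refine ⟨m - Pi.single n 1, ?_⟩
  funext j
  by_cases hj : j = n
  · subst hj; simp; omega
  · simp [hj]

theorem hasSum_inner_apply (φ ψ : Fock ι) : HasSum (fun m => ψ m * conj (φ m)) ⟪φ, ψ⟫_ℂ :=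
  lp.hasSum_inner φ ψ

theorem hasSum_annVec (n : ι) (ψ : quadDomain ι) :
    HasSum (fun m => (ψ : Fock ι) m • annVec n (ketVec m)) (annVec n ψ) := by
  rw [← (add_single_injective n).hasSum_iff]
  · convert hasSum_ket (annVec n ψ) using 2 with m
    simp only [Function.comp, annVec_ketVec, smul_smul]
    simp [annVec, annihilate, mul_comm]
  · intro m hm
    have h : m n = 0 := by
      by_contra h
      exact hm (mem_range_add_single h)
    simp [annVec_ketVec, h]

theorem hasSum_creVec (n : ι) (ψ : quadDomain ι) :
    HasSum (fun m => (ψ : Fock ι) m • creVec n (ketVec m)) (creVec n ψ) := by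
  have h := hasSum_ket (creVec n ψ)
  rw [← (add_single_injective n).hasSum_iff] at h
  · convert h using 2 with m
    simp only [Function.comp, creVec_ketVec, smul_smul]
    simp [creVec, create, mul_comm]
  · intro m hm
    have h : m n = 0 := by
      by_contra h
      exact hm (mem_range_add_single h)
    simp [creVec, create, h]

/-- The Fock states span a core of every generalized quadrature. -/
theorem hasSum_quadDir (u : ι × Fin 2 → ℝ) (ψ : quadDomain ι) :
    HasSum (fun m => (ψ : Fock ι) m • quadDir u (ketVec m)) (quadDir u ψ) := by
  simp only [quadDir_eq_ladder, Finset.smul_sum, smul_add]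
  refine hasSum_sum fun n _ => ?_
  refine HasSum.add ?_ ?_
  · convert (hasSum_annVec n ψ).const_smul (conj (ladderCoeff u n)) using 2
    exact smul_comm _ _ _
  · convert (hasSum_creVec n ψ).const_smul (ladderCoeff u n) using 2
    exact smul_comm _ _ _

/-- The canonical commutation relations `[a_n, a_k†] = δ`, in the sense of quadratic forms. -/
theorem inner_creVec_creVec (n k : ι) (φ ψ : quadDomain ι) :
    ⟪creVec n φ, creVec k ψ⟫_ℂ =
      ⟪annVec k φ, annVec n ψ⟫_ℂ + if n = k then ⟪(φ : Fock ι), (ψ : Fock ι)⟫_ℂ else 0 := by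
  have h := hasSum_inner_apply (creVec n φ) (creVec k ψ)
  have ha := hasSum_inner_apply (annVec k φ) (annVec n ψ)
  have hs : ∀ a : ℕ, (Real.sqrt ((a : ℝ) + 1) : ℂ) * Real.sqrt ((a : ℝ) + 1) = a + 1 := by
    intro a
    rw [← Complex.ofReal_mul, Real.mul_self_sqrt (by positivity)]
    push_cast
    ring
  have hzero : ∀ (χ : quadDomain ι) (l : ι) (m : ι → ℕ),
      m ∉ Set.range (fun m : ι → ℕ => m + Pi.single l 1) → creVec l χ m = 0 := by
    intro χ l m hm
    have h : m l = 0 := by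
      by_contra h
      exact hm (mem_range_add_single h)
    simp [creVec, create, h]
  by_cases hnk : n = k
  · subst hnk
    rw [if_pos rfl]
    rw [← (add_single_injective n).hasSum_iff] at h
    swap
    · intro m hm
      simp [hzero φ n m hm]
    have hb : HasSum (fun m : ι → ℕ => (m n : ℂ) * ((ψ : Fock ι) m * conj ((φ : Fock ι) m)))
        ⟪annVec n φ, annVec n ψ⟫_ℂ := by
      rw [← (add_single_injective n).hasSum_iff]
      · convert ha using 2 with m
        simp only [annVec, annihilate, Function.comp, LinearMap.coe_mk,
          AddHom.coe_mk, map_mul, Complex.conj_ofReal, Pi.add_apply, Pi.single_eq_same]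
        push_cast
        rw [← hs (m n)]
        ring
      · intro m hm
        have h : m n = 0 := by
          by_contra h
          exact hm (mem_range_add_single h)
        simp [h]
    refine h.unique ?_
    convert hb.add (hasSum_inner_apply (φ : Fock ι) (ψ : Fock ι)) using 2 with m
    simp only [creVec, create, Function.comp, LinearMap.coe_mk,
      AddHom.coe_mk, map_mul, Complex.conj_ofReal, Pi.add_apply, Pi.single_eq_same,
      add_tsub_cancel_right]
    push_cast
    have := hs (m n)
    linear_combination ((ψ : Fock ι) m * conj ((φ : Fock ι) m)) * this
  · rw [if_neg hnk, add_zero]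
    have hinj : Function.Injective fun m : ι → ℕ => m + Pi.single n 1 + Pi.single k 1 :=
      (add_single_injective k).comp (add_single_injective n)
    rw [← hinj.hasSum_iff] at h
    swap
    · intro m hm
      by_cases h1 : m ∈ Set.range (fun m : ι → ℕ => m + Pi.single k 1)
      · obtain ⟨m, rfl⟩ := h1
        have h2 : m ∉ Set.range (fun m : ι → ℕ => m + Pi.single n 1) := by
          rintro ⟨m, rfl⟩
          exact hm ⟨m, rfl⟩
        have h3 : m n = 0 := by
          by_contra h
          exact h2 (mem_range_add_single h)
        simp [creVec, create, h3, hnk]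
      · simp [hzero ψ k m h1]
    refine h.unique ?_
    convert ha using 2 with m
    have e : m + Pi.single n 1 + Pi.single k 1 - Pi.single n 1 = m + Pi.single k 1 := by
      rw [add_right_comm, add_tsub_cancel_right]
    simp only [creVec, create, annVec, annihilate, Function.comp,
      LinearMap.coe_mk, AddHom.coe_mk, map_mul, Complex.conj_ofReal, Pi.add_apply,
      Pi.single_eq_same, add_tsub_cancel_right, e, Pi.single_eq_of_ne hnk,
      Pi.single_eq_of_ne (Ne.symm hnk)]
    push_cast
    simp only [add_zero]
    ring

end Ladder

/-! ### Commutators of generalized quadratures with a state -/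

section Commutator

theorem hasSum_of_eq {α M : Type*} [AddCommMonoid M] [TopologicalSpace M] {f g : α → M} {x y : M}
    (h : HasSum f x) (hfg : ∀ a, g a = f a)
    (hxy : y = x) : HasSum g y := by
  rw [hxy, funext hfg]
  exact h

theorem hasSum_inner_right {α : Type*} {H : Type*} [NormedAddCommGroup H] [InnerProductSpace ℂ H]
    (y : H) {f : α → H} {x : H} (h : HasSum f x) : HasSum (fun a => ⟪y, f a⟫_ℂ) ⟪y, x⟫_ℂ :=
  (innerSL ℂ y).hasSum h

theorem ext_hilbertBasis {β : Type*} {H : Type*} [NormedAddCommGroup H] [InnerProductSpace ℂ H]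
    (b : HilbertBasis β ℂ H) {A B : H →L[ℂ] H}
    (h : ∀ i j, ⟪b i, A (b j)⟫_ℂ = ⟪b i, B (b j)⟫_ℂ) : A = B := by
  have hvec : ∀ x y : H, (∀ i, ⟪b i, x⟫_ℂ = ⟪b i, y⟫_ℂ) → x = y := by
    intro x y hxy
    apply b.repr.injective
    apply lp.ext
    funext i
    rw [b.repr_apply_apply, b.repr_apply_apply, hxy]
  have hcol : ∀ j, A (b j) = B (b j) := fun j => hvec _ _ fun i => h i j
  ext x
  have hx := b.hasSum_repr x
  have hA := A.hasSum hx
  have hB := B.hasSum hx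
  simp only [map_smul, hcol] at hA hB
  exact hA.unique hB

variable {ι : Type u} [Fintype ι] [DecidableEq ι]

theorem ext_ket {A B : Fock ι →L[ℂ] Fock ι}
    (h : ∀ m n, ⟪ket m, A (ket n)⟫_ℂ = ⟪ket m, B (ket n)⟫_ℂ) : A = B :=
  ext_hilbertBasis ketBasis fun i j => by simpa only [ketBasis_apply] using h i j

theorem DensityOp.ext_op {ρ σ : DensityOp ι} (h : ρ.op = σ.op) : ρ = σ := by
  cases ρ; cases σ; cases h; rfl

theorem DensityOp.inner_op (ρ : DensityOp ι) (φ ψ : Fock ι) :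
    ⟪ρ.op φ, ψ⟫_ℂ = ⟪φ, ρ.op ψ⟫_ℂ :=
  ρ.isPositive.isSymmetric φ ψ

/-- The sesquilinear form `⟨φ| [∑ k, u k R^(k), ρ] |ψ⟩` on the domain of the quadratures. -/
def commForm (ρ : DensityOp ι) (u : ι × Fin 2 → ℝ) (φ ψ : quadDomain ι) : ℂ :=
  ⟪quadDir u φ, ρ.op ψ⟫_ℂ - ⟪ρ.op φ, quadDir u ψ⟫_ℂ

/-- The bounded operator `C` is the commutator `[∑ k, u k R^(k), ρ]`. -/
def IsCommutator (ρ : DensityOp ι) (u : ι × Fin 2 → ℝ) (C : Fock ι →L[ℂ] Fock ι) : Prop :=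
  ∀ φ ψ : quadDomain ι, ⟪(φ : Fock ι), C ψ⟫_ℂ = commForm ρ u φ ψ

theorem isQuadCommutator_iff {ρ : DensityOp ι} {k : ι × Fin 2} {C : Fock ι →L[ℂ] Fock ι} :
    IsQuadCommutator ρ k C ↔ IsCommutator ρ (Pi.single k 1) C := by
  simp only [IsQuadCommutator, IsCommutator, commForm, quadDir_single]

/-- Since Fock states span a core, a commutator can be recognized on Fock states. -/
theorem IsCommutator.of_ket {ρ : DensityOp ι} {u : ι × Fin 2 → ℝ} {C : Fock ι →L[ℂ] Fock ι}
    (h : ∀ m n, ⟪ket m, C (ket n)⟫_ℂ = commForm ρ u (ketVec m) (ketVec n)) :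
    IsCommutator ρ u C := by
  have hleft : ∀ (φ : quadDomain ι) (n : ι → ℕ),
      ⟪C (ket n), (φ : Fock ι)⟫_ℂ = conj (commForm ρ u φ (ketVec n)) := by
    intro φ n
    have h1 := hasSum_inner_right (C (ket n)) (hasSum_ket (φ : Fock ι))
    have h2 := hasSum_inner_right (ρ.op (ketVec n)) (hasSum_quadDir u φ)
    have h3 := hasSum_inner_right (quadDir u (ketVec n)) (ρ.op.hasSum (hasSum_ket (φ : Fock ι)))
    refine h1.unique (hasSum_of_eq (h2.sub h3) (fun m => ?_) ?_)
    · have h4 := congrArg conj (h m n)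
      simp only [commForm, map_sub, inner_conj_symm] at h4
      rw [map_smul, inner_smul_right, inner_smul_right, inner_smul_right, h4, coe_ketVec,
        coe_ketVec]
      ring
    · simp only [commForm, map_sub, inner_conj_symm]
  intro φ ψ
  have h1 := hasSum_inner_right (φ : Fock ι) (C.hasSum (hasSum_ket (ψ : Fock ι)))
  have h2 := hasSum_inner_right (quadDir u φ) (ρ.op.hasSum (hasSum_ket (ψ : Fock ι)))
  have h3 := hasSum_inner_right (ρ.op φ) (hasSum_quadDir u ψ)
  refine h1.unique (hasSum_of_eq (h2.sub h3) (fun n => ?_) rfl)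
  have h4 := congrArg conj (hleft φ n)
  rw [inner_conj_symm, Complex.conj_conj] at h4
  rw [map_smul, map_smul, inner_smul_right, inner_smul_right, inner_smul_right, h4, commForm,
    coe_ketVec]
  ring

theorem IsCommutator.sum {ρ : DensityOp ι} {C : ι × Fin 2 → Fock ι →L[ℂ] Fock ι}
    (h : ∀ k, IsQuadCommutator ρ k (C k)) (u : ι × Fin 2 → ℝ) :
    IsCommutator ρ u (∑ k, (u k : ℂ) • C k) := by
  intro φ ψ
  rw [commForm, quadDir_apply, quadDir_apply, sum_inner, inner_sum, ← Finset.sum_sub_distrib]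
  rw [sum_apply, inner_sum]
  refine Finset.sum_congr rfl fun k _ => ?_
  rw [smul_apply, inner_smul_right, h k, inner_smul_left, inner_smul_right,
    Complex.conj_ofReal, mul_sub]

theorem IsCommutator.unique {ρ : DensityOp ι} {u : ι × Fin 2 → ℝ} {C C' : Fock ι →L[ℂ] Fock ι}
    (h : IsCommutator ρ u C) (h' : IsCommutator ρ u C') : C = C' :=
  ext_ket fun m n => (h (ketVec m) (ketVec n)).trans (h' (ketVec m) (ketVec n)).symm

/-- Commutators of observables are antihermitian. -/
theorem IsCommutator.inner_left {ρ : DensityOp ι} {u : ι × Fin 2 → ℝ} {C : Fock ι →L[ℂ] Fock ι}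
    (h : IsCommutator ρ u C) (φ ψ : Fock ι) : ⟪C φ, ψ⟫_ℂ = -⟪φ, C ψ⟫_ℂ := by
  have e : C.adjoint = -C := by
    apply ext_ket
    intro m n
    rw [ContinuousLinearMap.adjoint_inner_right, neg_apply, inner_neg_right,
      ← inner_conj_symm, ← coe_ketVec, ← coe_ketVec, h, h, commForm, commForm, map_sub,
      inner_conj_symm, inner_conj_symm]
    ring
  rw [← ContinuousLinearMap.adjoint_inner_right, e, neg_apply, inner_neg_right]

end Commutator

/-! ### Decompositions of commutators and the dual bound -/

section Decomposition

theorem exists_hasSum_rankOne {α : Type*} {H : Type*} [NormedAddCommGroup H]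
    [InnerProductSpace ℂ H] [CompleteSpace H] {x y : α → H}
    (hx : Summable fun a => ‖x a‖ ^ 2) (hy : Summable fun a => ‖y a‖ ^ 2) :
    ∃ T : H →L[ℂ] H, ∀ φ ψ, HasSum (fun a => ⟪φ, x a⟫_ℂ * ⟪y a, ψ⟫_ℂ) ⟪φ, T ψ⟫_ℂ := by
  have hs : Summable fun a => InnerProductSpace.rankOne ℂ (x a) (y a) := by
    refine Summable.of_norm_bounded (hx.add hy) fun a => ?_
    rw [InnerProductSpace.norm_rankOne]
    nlinarith [sq_nonneg (‖x a‖ - ‖y a‖), sq_nonneg (‖x a‖ + ‖y a‖)]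
  refine ⟨∑' a, InnerProductSpace.rankOne ℂ (x a) (y a), fun φ ψ => ?_⟩
  have h1 := hasSum_inner_right φ ((ContinuousLinearMap.apply ℂ H ψ).hasSum hs.hasSum)
  refine hasSum_of_eq h1 (fun a => ?_) rfl
  simp [InnerProductSpace.rankOne_apply, mul_comm]

/-- The dual (variational) form of the bound `∑ i j, |⟨i|C|j⟩|² / (λ i + λ j) ≤ B`: for all test
operators `X = ∑ a ∈ s, |φ a⟩⟨ψ a|` one has `2 Re Tr (X† C) ≤ B + Tr (X† (T X + X T))`. -/
def DualBound {H : Type u} [NormedAddCommGroup H] [InnerProductSpace ℂ H] (T C : H →L[ℂ] H)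
    (B : ℝ) : Prop :=
  ∀ (α : Type u) (s : Finset α) (φ ψ : α → H),
    2 * (∑ a ∈ s, ⟪φ a, C (ψ a)⟫_ℂ).re ≤ B + (∑ a ∈ s, ∑ b ∈ s,
      (⟪φ a, T (φ b)⟫_ℂ * ⟪ψ b, ψ a⟫_ℂ + ⟪φ a, φ b⟫_ℂ * ⟪ψ b, T (ψ a)⟫_ℂ)).re

theorem DualBound.mono {H : Type u} [NormedAddCommGroup H] [InnerProductSpace ℂ H]
    {T C : H →L[ℂ] H} {B B' : ℝ} (h : DualBound T C B) (hB : B ≤ B') : DualBound T C B' :=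
  fun α s φ ψ => (h α s φ ψ).trans (by gcongr)

variable {ι : Type u} [Fintype ι] [DecidableEq ι]

theorem hasSum_norm_sq_of_state {α : Type*} {ρ : DensityOp ι} {v : α → Fock ι}
    (h : ∀ φ ψ, HasSum (fun a => ⟪φ, v a⟫_ℂ * ⟪v a, ψ⟫_ℂ) ⟪φ, ρ.op ψ⟫_ℂ) :
    HasSum (fun a => ‖v a‖ ^ 2) 1 := by
  have hdiag : ∀ m : ι → ℕ, HasSum (fun a => ‖v a m‖ ^ 2) (⟪ket m, ρ.op (ket m)⟫_ℂ).re := by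
    intro m
    have h1 := Complex.hasSum_re (h (ket m) (ket m))
    convert h1 using 2 with a
    rw [inner_ket, inner_ket', Complex.mul_conj, Complex.normSq_eq_norm_sq, Complex.ofReal_re]
  have htr := Complex.hasSum_re ρ.hasSum_trace
  rw [Complex.one_re] at htr
  rw [hasSum_norm_sq_iff]
  simp_rw [norm_sq_eq_tsum_ket]
  rw [ENNReal.tsum_comm]
  have e : ∀ m : ι → ℕ, ∑' a, ‖v a m‖ₑ ^ 2 = ENNReal.ofReal (⟪ket m, ρ.op (ket m)⟫_ℂ).re := by
    intro m
    rw [← (hdiag m).tsum_eq, ENNReal.ofReal_tsum_of_nonneg (fun _ => by positivity)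
      (hdiag m).summable]
    refine tsum_congr fun a => ?_
    rw [← ofReal_norm, ENNReal.ofReal_pow (norm_nonneg _)]
  simp_rw [e]
  rw [← ENNReal.ofReal_tsum_of_nonneg (fun m => (hdiag m).nonneg fun _ => by positivity)
    htr.summable, htr.tsum_eq, ENNReal.ofReal_one]

/-- A decomposition `ρ = ∑ a, |v a⟩⟨v a|` of the state together with vectors `l a` such that
`[∑ k, u k R^(k), ρ] = ∑ a, (|l a⟩⟨v a| - |v a⟩⟨l a|)`, on the domain of the quadratures. The
vectors `l a` replace `∑ k, u k R^(k) v a`, which need not make sense; the infimum of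
`∑ a, ‖l a‖²` over all decompositions is one quarter of the quantum Fisher information. -/
structure IsDecomposition {α : Type*} (ρ : DensityOp ι) (u : ι × Fin 2 → ℝ) (v l : α → Fock ι) :
    Prop where
  state : ∀ φ ψ, HasSum (fun a => ⟪φ, v a⟫_ℂ * ⟪v a, ψ⟫_ℂ) ⟪φ, ρ.op ψ⟫_ℂ
  summable : Summable fun a => ‖l a‖ ^ 2
  comm : ∀ φ ψ : quadDomain ι, HasSum
    (fun a => ⟪(φ : Fock ι), l a⟫_ℂ * ⟪v a, (ψ : Fock ι)⟫_ℂ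
      - ⟪(φ : Fock ι), v a⟫_ℂ * ⟪l a, (ψ : Fock ι)⟫_ℂ) (commForm ρ u φ ψ)

theorem exists_hasSum_antisymm {α : Type*} {v l : α → Fock ι}
    (hv : Summable fun a => ‖v a‖ ^ 2) (hl : Summable fun a => ‖l a‖ ^ 2) :
    ∃ C : Fock ι →L[ℂ] Fock ι, ∀ φ ψ : Fock ι,
      HasSum (fun a => ⟪φ, l a⟫_ℂ * ⟪v a, ψ⟫_ℂ - ⟪φ, v a⟫_ℂ * ⟪l a, ψ⟫_ℂ) ⟪φ, C ψ⟫_ℂ := by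
  obtain ⟨A, hA⟩ := exists_hasSum_rankOne hl hv
  obtain ⟨B, hB⟩ := exists_hasSum_rankOne hv hl
  refine ⟨A - B, fun φ ψ => ?_⟩
  rw [sub_apply, inner_sub_right]
  exact (hA φ ψ).sub (hB φ ψ)

/-- By the core property, it suffices to check a decomposition on Fock states. -/
theorem IsDecomposition.of_ket {α : Type*} {ρ : DensityOp ι} {u : ι × Fin 2 → ℝ}
    {v l : α → Fock ι}
    (hρ : ∀ φ ψ, HasSum (fun a => ⟪φ, v a⟫_ℂ * ⟪v a, ψ⟫_ℂ) ⟪φ, ρ.op ψ⟫_ℂ)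
    (hl : Summable fun a => ‖l a‖ ^ 2)
    (h : ∀ m n, HasSum (fun a => ⟪ket m, l a⟫_ℂ * ⟪v a, ket n⟫_ℂ - ⟪ket m, v a⟫_ℂ * ⟪l a, ket n⟫_ℂ)
      (commForm ρ u (ketVec m) (ketVec n))) : IsDecomposition ρ u v l := by
  obtain ⟨C, hC⟩ := exists_hasSum_antisymm (hasSum_norm_sq_of_state hρ).summable hl
  have hC' : IsCommutator ρ u C :=
    IsCommutator.of_ket fun m n => (hC (ket m) (ket n)).unique (h m n)
  exact ⟨hρ, hl, fun φ ψ => hC' φ ψ ▸ hC φ ψ⟩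

/-- A decomposition exhibits the commutator as a bounded operator and bounds it: completing the
square in `2 Re Tr (X† C) = 2 Re ∑ a, (⟨X v a | l a⟩ - ⟨l a | X† v a⟩)`. -/
theorem IsDecomposition.dualBound {α : Type*} {ρ : DensityOp ι} {u : ι × Fin 2 → ℝ}
    {v l : α → Fock ι} (h : IsDecomposition ρ u v l) :
    ∃ C, IsCommutator ρ u C ∧ (∀ φ ψ : Fock ι,
      HasSum (fun a => ⟪φ, l a⟫_ℂ * ⟪v a, ψ⟫_ℂ - ⟪φ, v a⟫_ℂ * ⟪l a, ψ⟫_ℂ) ⟪φ, C ψ⟫_ℂ) ∧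
      DualBound ρ.op C (2 * ∑' a, ‖l a‖ ^ 2) := by
  obtain ⟨C, hC⟩ := exists_hasSum_antisymm (hasSum_norm_sq_of_state h.state).summable h.summable
  refine ⟨C, fun φ ψ => (hC φ ψ).unique (h.comm φ ψ), hC, fun β s φ ψ => ?_⟩
  set X : α → Fock ι := fun a => ∑ b ∈ s, ⟪ψ b, v a⟫_ℂ • φ b with hX
  set Y : α → Fock ι := fun a => ∑ b ∈ s, ⟪φ b, v a⟫_ℂ • ψ b with hY
  have h1 : HasSum (fun a => ⟪X a, l a⟫_ℂ - ⟪l a, Y a⟫_ℂ) (∑ b ∈ s, ⟪φ b, C (ψ b)⟫_ℂ) := by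
    refine hasSum_of_eq (hasSum_sum fun b (_ : b ∈ s) => hC (φ b) (ψ b)) (fun a => ?_) rfl
    simp only [hX, hY, sum_inner, inner_sum, inner_smul_left, inner_smul_right, inner_conj_symm]
    rw [← Finset.sum_sub_distrib]
    refine Finset.sum_congr rfl fun b _ => ?_
    ring
  have h2 : HasSum (fun a => ⟪Y a, Y a⟫_ℂ + ⟪X a, X a⟫_ℂ) (∑ a ∈ s, ∑ b ∈ s,
      (⟪φ a, ρ.op (φ b)⟫_ℂ * ⟪ψ b, ψ a⟫_ℂ + ⟪φ a, φ b⟫_ℂ * ⟪ψ b, ρ.op (ψ a)⟫_ℂ)) := by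
    refine hasSum_of_eq (hasSum_sum fun a (_ : a ∈ s) => hasSum_sum fun b (_ : b ∈ s) =>
      ((h.state (φ a) (φ b)).mul_right ⟪ψ b, ψ a⟫_ℂ).add
        ((h.state (ψ b) (ψ a)).mul_left ⟪φ a, φ b⟫_ℂ)) (fun c => ?_) rfl
    simp only [hX, hY, sum_inner, inner_sum, inner_smul_left, inner_smul_right, inner_conj_symm,
      Finset.sum_add_distrib, Finset.mul_sum]
    congr 1
    · refine Finset.sum_congr rfl fun a _ => Finset.sum_congr rfl fun b _ => ?_
      ring
    · rw [Finset.sum_comm]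
      refine Finset.sum_congr rfl fun a _ => Finset.sum_congr rfl fun b _ => ?_
      ring
  have h3 := (Complex.hasSum_re h1).mul_left 2
  have h4 := (h.summable.hasSum.mul_left 2).add (Complex.hasSum_re h2)
  refine hasSum_le (fun a => ?_) h3 h4
  have e : ∀ x : Fock ι, (⟪x, x⟫_ℂ).re = ‖x‖ ^ 2 := fun x => inner_self_eq_norm_sq (𝕜 := ℂ) x
  have h5 : (⟪X a, l a⟫_ℂ).re ≤ ‖X a‖ * ‖l a‖ := re_inner_le_norm (𝕜 := ℂ) (X a) (l a)
  have h6 : -(⟪l a, Y a⟫_ℂ).re ≤ ‖l a‖ * ‖Y a‖ := by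
    have := re_inner_le_norm (𝕜 := ℂ) (l a) (-Y a)
    rw [inner_neg_right, norm_neg] at this
    simpa using this
  rw [Complex.sub_re, Complex.add_re, e, e]
  nlinarith [sq_nonneg (‖X a‖ - ‖l a‖), sq_nonneg (‖Y a‖ - ‖l a‖)]

end Decomposition

/-! ### The largest eigenvalue as the maximum of the Rayleigh quotient -/

section LambdaMax

variable {n : Type*} [Fintype n] [DecidableEq n]

theorem bddAbove_eigenvalues (F : Matrix n n ℝ) :
    BddAbove {x : ℝ | Module.End.HasEigenvalue (Matrix.toLin' F) x} :=
  (Module.End.finite_hasEigenvalue (Matrix.toLin' F)).bddAbove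

theorem quadForm_le_lambdaMax {F : Matrix n n ℝ} (hF : F.IsHermitian) (u : n → ℝ) :
    u ⬝ᵥ (F.mulVec u) ≤ lambdaMax F * (u ⬝ᵥ u) := by
  set D : Matrix n n ℝ := lambdaMax F • (1 : Matrix n n ℝ) - F with hD
  have hDH : D.IsHermitian := by
    refine Matrix.IsHermitian.sub ?_ hF
    exact (Matrix.isHermitian_one).smul (by simp [IsSelfAdjoint])
  have hpos : D.PosSemidef := by
    rw [hDH.posSemidef_iff_eigenvalues_nonneg]
    intro i
    have h1 := hDH.mulVec_eigenvectorBasis i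
    set w : n → ℝ := (hDH.eigenvectorBasis i).ofLp with hw
    have hw0 : w ≠ 0 := by
      intro h0
      have := hDH.eigenvectorBasis.orthonormal.ne_zero i
      apply this
      exact (WithLp.ofLp_eq_zero 2).1 h0
    have h2 : F.mulVec w = (lambdaMax F - hDH.eigenvalues i) • w := by
      rw [sub_smul, ← h1, hD, Matrix.sub_mulVec, Matrix.smul_mulVec, Matrix.one_mulVec]
      abel
    have h3 : Module.End.HasEigenvalue (Matrix.toLin' F) (lambdaMax F - hDH.eigenvalues i) :=
      Module.End.hasEigenvalue_of_hasEigenvector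
        ⟨Module.End.mem_eigenspace_iff.2 (by simpa using h2), hw0⟩
    have h4 : lambdaMax F - hDH.eigenvalues i ≤ lambdaMax F :=
      le_csSup (bddAbove_eigenvalues F) h3
    simpa using h4
  have h := hpos.dotProduct_mulVec_nonneg u
  simp only [hD, Matrix.sub_mulVec, Matrix.smul_mulVec, Matrix.one_mulVec, star_trivial,
    dotProduct_sub, dotProduct_smul, smul_eq_mul] at h
  linarith

theorem lambdaMax_le {F : Matrix n n ℝ} {K : ℝ} (hK : 0 ≤ K)
    (h : ∀ u : n → ℝ, u ⬝ᵥ (F.mulVec u) ≤ K * (u ⬝ᵥ u)) : lambdaMax F ≤ K := by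
  refine Real.sSup_le (fun x hx => ?_) hK
  obtain ⟨w, hw⟩ := hx.exists_hasEigenvector
  have h1 : F.mulVec w = x • w := by simpa using hw.apply_eq_smul
  have h2 := h w
  rw [h1, dotProduct_smul, smul_eq_mul] at h2
  have h3 : 0 < w ⬝ᵥ w := by
    have := Matrix.dotProduct_star_self_pos_iff (v := w)
    simp only [star_trivial] at this
    exact this.2 hw.2
  exact le_of_mul_le_mul_right h2 h3

end LambdaMax

/-! ### Quantum Fisher information in an eigenbasis -/

section Fisher

variable {ι : Type u} [Fintype ι] [DecidableEq ι]

theorem SpectralDecomposition.eigenvalue_nonneg {ρ : DensityOp ι} (E : SpectralDecomposition ρ)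
    (i : E.index) : 0 ≤ E.eigenvalue i := by
  have h := (ContinuousLinearMap.isPositive_iff_complex ρ.op).1 ρ.isPositive (E.basis i)
  have h1 := h.2
  rw [E.apply_basis, inner_smul_left, inner_self_eq_norm_sq_to_K, E.basis.orthonormal.1 i] at h1
  simpa using h1

theorem enorm_sq_eq_ofReal {H : Type*} [NormedAddCommGroup H] (x : H) :
    ‖x‖ₑ ^ 2 = ENNReal.ofReal (‖x‖ ^ 2) := by
  rw [← ofReal_norm, ENNReal.ofReal_pow (norm_nonneg _)]

theorem enorm_sq_div_ofReal {z : ℂ} {s : ℝ} (hs : 0 ≤ s) (h : s = 0 → z = 0) :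
    ‖z‖ₑ ^ 2 / ENNReal.ofReal s = ENNReal.ofReal (‖z‖ ^ 2 / s) := by
  rcases hs.eq_or_lt with h0 | h0
  · simp [h h0.symm]
  · rw [ENNReal.ofReal_div_of_pos h0, enorm_sq_eq_ofReal]

theorem eq_zero_of_div_ne_top {z : ℂ} {s : ℝ} (h : ‖z‖ₑ ^ 2 / ENNReal.ofReal s ≠ ⊤)
    (hs : s = 0) : z = 0 := by
  by_contra hz
  apply h
  rw [hs, ENNReal.ofReal_zero, ENNReal.div_zero]
  simpa using hz

/-- The matrix elements of the operator `C` in the chosen eigenbasis of `ρ`. -/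
def specCoeff (ρ : DensityOp ι) (C : Fock ι →L[ℂ] Fock ι)
    (p : ρ.spectral.index × ρ.spectral.index) : ℂ :=
  ⟪ρ.spectral.basis p.1, C (ρ.spectral.basis p.2)⟫_ℂ

/-- The sums `λ i + λ j` of eigenvalues. -/
def specSum (ρ : DensityOp ι) (p : ρ.spectral.index × ρ.spectral.index) : ℝ :=
  ρ.spectral.eigenvalue p.1 + ρ.spectral.eigenvalue p.2

theorem specSum_nonneg (ρ : DensityOp ι) (p : ρ.spectral.index × ρ.spectral.index) :
    0 ≤ specSum ρ p :=
  add_nonneg (ρ.spectral.eigenvalue_nonneg _) (ρ.spectral.eigenvalue_nonneg _)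

/-- Half the quantum Fisher information of a generator whose commutator with `ρ` is `C`. -/
def specNorm (ρ : DensityOp ι) (C : Fock ι →L[ℂ] Fock ι) : ℝ≥0∞ :=
  ∑' p, ‖specCoeff ρ C p‖ₑ ^ 2 / ENNReal.ofReal (specSum ρ p)

theorem specCoeff_eq_zero {ρ : DensityOp ι} {C : Fock ι →L[ℂ] Fock ι} (h : specNorm ρ C ≠ ⊤)
    (p) (hp : specSum ρ p = 0) : specCoeff ρ C p = 0 :=
  eq_zero_of_div_ne_top (ENNReal.ne_top_of_tsum_ne_top h p) hp

theorem hasSum_of_specNorm {ρ : DensityOp ι} {C : Fock ι →L[ℂ] Fock ι} (h : specNorm ρ C ≠ ⊤) :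
    HasSum (fun p => ‖specCoeff ρ C p‖ ^ 2 / specSum ρ p) (specNorm ρ C).toReal := by
  have e : ∀ p, ‖specCoeff ρ C p‖ₑ ^ 2 / ENNReal.ofReal (specSum ρ p)
      = ENNReal.ofReal (‖specCoeff ρ C p‖ ^ 2 / specSum ρ p) := fun p =>
    enorm_sq_div_ofReal (specSum_nonneg ρ p) (specCoeff_eq_zero h p)
  have hn : ∀ p, 0 ≤ ‖specCoeff ρ C p‖ ^ 2 / specSum ρ p := fun p =>
    div_nonneg (by positivity) (specSum_nonneg ρ p)
  have h' := h
  rw [specNorm] at h' ⊢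
  simp_rw [e] at h' ⊢
  have hs := ENNReal.summable_toReal h'
  have h2 := hs.hasSum
  rw [← ENNReal.tsum_toReal_eq (fun p => ENNReal.ofReal_ne_top)] at h2
  simpa only [ENNReal.toReal_ofReal (hn _)] using h2

/-- The spectral decomposition yields an optimal decomposition of the commutator, with
`v i = √(λ i) |i⟩` and `⟨j | l i⟩ = √(λ i) ⟨j|C|i⟩ / (λ i + λ j)`. -/
theorem exists_isDecomposition {ρ : DensityOp ι} {u : ι × Fin 2 → ℝ} {C : Fock ι →L[ℂ] Fock ι}
    (hC : IsCommutator ρ u C) (hfin : specNorm ρ C ≠ ⊤) :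
    ∃ v l : ρ.spectral.index → Fock ι, IsDecomposition ρ u v l ∧
      ∑' a, ‖l a‖ ^ 2 = (specNorm ρ C).toReal / 2 ∧ ∀ a, (⟪v a, l a⟫_ℂ).re = 0 := by
  classical
  set b := ρ.spectral.basis with hb
  set lam := ρ.spectral.eigenvalue with hlam
  have hlam0 : ∀ i, 0 ≤ lam i := ρ.spectral.eigenvalue_nonneg
  have hss : ∀ p, specSum ρ p = lam p.1 + lam p.2 := fun p => rfl
  have hq := hasSum_of_specNorm hfin
  have hconj : ∀ i j, conj (specCoeff ρ C (i, j)) = -specCoeff ρ C (j, i) := by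
    intro i j
    rw [specCoeff, inner_conj_symm, hC.inner_left]
    rfl
  have hnorm : ∀ i j, ‖specCoeff ρ C (j, i)‖ = ‖specCoeff ρ C (i, j)‖ := by
    intro i j
    rw [← norm_neg, ← hconj, RCLike.norm_conj]
  set e : ρ.spectral.index → ρ.spectral.index → ℂ := fun i j =>
    (Real.sqrt (lam i) : ℂ) * specCoeff ρ C (j, i) / (specSum ρ (i, j) : ℂ) with he
  have hw : ∀ i j, ‖e i j‖ ^ 2 + ‖e j i‖ ^ 2 = ‖specCoeff ρ C (i, j)‖ ^ 2 / specSum ρ (i, j) := by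
    intro i j
    have h1 : specSum ρ (j, i) = specSum ρ (i, j) := by simp only [hss]; ring
    simp only [he, norm_div, norm_mul, Complex.norm_real, div_pow, mul_pow, h1, hnorm i j,
      Real.norm_eq_abs, sq_abs, Real.sq_sqrt (hlam0 _)]
    by_cases h0 : specSum ρ (i, j) = 0
    · simp [h0]
    · rw [← add_div, ← add_mul, ← hss (i, j)]
      field_simp
  have hws : Summable fun p : ρ.spectral.index × ρ.spectral.index => ‖e p.1 p.2‖ ^ 2 := by
    refine Summable.of_nonneg_of_le (fun _ => by positivity) (fun p => ?_) hq.summable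
    have := hw p.1 p.2
    have h2 : 0 ≤ ‖e p.2 p.1‖ ^ 2 := by positivity
    linarith
  have hwt : ∑' p : ρ.spectral.index × ρ.spectral.index, ‖e p.1 p.2‖ ^ 2
      = (specNorm ρ C).toReal / 2 := by
    have h1 := hws.hasSum
    have h2 := (Equiv.prodComm ρ.spectral.index ρ.spectral.index).hasSum_iff.2 h1
    have h3 := h1.add h2
    have h4 : HasSum (fun p : ρ.spectral.index × ρ.spectral.index =>
        ‖e p.1 p.2‖ ^ 2 + ‖e p.2 p.1‖ ^ 2) (specNorm ρ C).toReal := by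
      rw [funext fun p : ρ.spectral.index × ρ.spectral.index => hw p.1 p.2]
      exact hq
    have h5 := h3.unique h4
    linarith
  have hmem : ∀ i, Memℓp (e i) 2 := fun i =>
    (memℓp_gen_iff (by norm_num)).2 (by simpa using hws.prod_factor i)
  set l : ρ.spectral.index → Fock ι := fun i => b.repr.symm ⟨e i, hmem i⟩ with hl
  set v : ρ.spectral.index → Fock ι := fun i => (Real.sqrt (lam i) : ℂ) • b i with hv
  have hbl : ∀ i j, ⟪b j, l i⟫_ℂ = e i j := by
    intro i j
    rw [← b.repr_apply_apply, hl, LinearIsometryEquiv.apply_symm_apply]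
  have hbv : ∀ i j, ⟪b j, v i⟫_ℂ = if i = j then (Real.sqrt (lam i) : ℂ) else 0 := by
    intro i j
    rw [hv, inner_smul_right, orthonormal_iff_ite.1 b.orthonormal]
    simp [eq_comm]
  have hlnorm : ∀ i, HasSum (fun j => ‖e i j‖ ^ 2) (‖l i‖ ^ 2) := by
    intro i
    have h := lp.hasSum_norm (p := 2) (by norm_num) (b.repr (l i))
    simp only [ENNReal.toReal_ofNat, Real.rpow_two, LinearIsometryEquiv.norm_map,
      HilbertBasis.repr_apply_apply, hbl] at h
    exact h
  have hlsum : HasSum (fun i => ‖l i‖ ^ 2) ((specNorm ρ C).toReal / 2) :=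
    (hwt ▸ hws.hasSum).prod_fiberwise hlnorm
  have hstate : ∀ φ ψ, HasSum (fun a => ⟪φ, v a⟫_ℂ * ⟪v a, ψ⟫_ℂ) ⟪φ, ρ.op ψ⟫_ℂ := by
    intro φ ψ
    refine hasSum_of_eq (b.hasSum_inner_mul_inner φ (ρ.op ψ)) (fun a => ?_) rfl
    rw [← ρ.inner_op, hb, ρ.spectral.apply_basis, ← hb, hv, inner_smul_left, inner_smul_left,
      inner_smul_right, Complex.conj_ofReal, Complex.conj_ofReal, ← hlam]
    have h2 : (Real.sqrt (lam a) : ℂ) * Real.sqrt (lam a) = lam a := by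
      rw [← Complex.ofReal_mul, Real.mul_self_sqrt (hlam0 a)]
    rw [← h2]
    ring
  obtain ⟨T, hT⟩ := exists_hasSum_antisymm (hasSum_norm_sq_of_state hstate).summable hlsum.summable
  have hTC : T = C := by
    refine ext_hilbertBasis b fun i j => (hT (b i) (b j)).unique ?_
    have h1 : HasSum (fun a => ⟪b i, l a⟫_ℂ * ⟪v a, b j⟫_ℂ) (e j i * Real.sqrt (lam j)) := by
      refine hasSum_of_eq (hasSum_ite_eq j (e j i * Real.sqrt (lam j))) (fun a => ?_) rfl
      rw [hbl, ← inner_conj_symm, hbv]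
      split_ifs with h
      · rw [h, Complex.conj_ofReal]
      · simp
    have h2 : HasSum (fun a => ⟪b i, v a⟫_ℂ * ⟪l a, b j⟫_ℂ)
        ((Real.sqrt (lam i) : ℂ) * conj (e i j)) := by
      refine hasSum_of_eq (hasSum_ite_eq i ((Real.sqrt (lam i) : ℂ) * conj (e i j)))
        (fun a => ?_) rfl
      rw [hbv, ← inner_conj_symm (l a), hbl]
      split_ifs with h
      · rw [h]
      · simp
    refine hasSum_of_eq (h1.sub h2) (fun a => rfl) ?_
    have h3 : ∀ i, (Real.sqrt (lam i) : ℂ) * Real.sqrt (lam i) = lam i := fun i => by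
      rw [← Complex.ofReal_mul, Real.mul_self_sqrt (hlam0 i)]
    have h4 : specSum ρ (j, i) = specSum ρ (i, j) := by simp only [hss]; ring
    simp only [he, map_div₀, map_mul, Complex.conj_ofReal, hconj, h4]
    change specCoeff ρ C (i, j) = _
    by_cases h0 : specSum ρ (i, j) = 0
    · rw [specCoeff_eq_zero hfin _ h0]
      simp
    · have h0' : (specSum ρ (i, j) : ℂ) ≠ 0 := by exact_mod_cast h0
      field_simp
      have h5 : (specSum ρ (i, j) : ℂ) = lam i + lam j := by rw [hss]; push_cast; rfl
      rw [h5, ← h3 i, ← h3 j]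
      ring
  refine ⟨v, l, ⟨hstate, hlsum.summable, fun φ ψ => ?_⟩, hlsum.tsum_eq, fun a => ?_⟩
  · rw [← hC φ ψ, ← hTC]
    exact hT φ ψ
  · have h1 : (specCoeff ρ C (a, a)).re = 0 := by
      have := congrArg Complex.re (hconj a a)
      simp at this
      linarith
    rw [hv, inner_smul_left, hbl, he, Complex.conj_ofReal, Complex.re_ofReal_mul,
      Complex.div_ofReal_re, Complex.re_ofReal_mul, h1]
    simp

/-- The dual bound, tested on operators that are finite matrices in the eigenbasis, bounds the
quantum Fisher information. -/
theorem specNorm_le_of_dualBound {ρ : DensityOp ι} {C : Fock ι →L[ℂ] Fock ι} {B : ℝ}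
    (h : DualBound ρ.op C B) : specNorm ρ C ≤ ENNReal.ofReal B := by
  classical
  set b := ρ.spectral.basis with hb
  set lam := ρ.spectral.eigenvalue with hlam
  -- the dual bound for the test operator `∑ p ∈ S, x p |p.1⟩⟨p.2|`
  have key : ∀ (S : Finset (ρ.spectral.index × ρ.spectral.index))
      (x : ρ.spectral.index × ρ.spectral.index → ℂ),
      2 * (∑ p ∈ S, conj (x p) * specCoeff ρ C p).re ≤ B + ∑ p ∈ S, ‖x p‖ ^ 2 * specSum ρ p := by
    intro S x
    have h1 := h _ S (fun p => x p • b p.1) (fun p => b p.2)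
    simp only [inner_smul_left, inner_smul_right, map_smul, hb, ρ.spectral.apply_basis,
      orthonormal_iff_ite.1 ρ.spectral.basis.orthonormal] at h1
    refine h1.trans (le_of_eq ?_)
    congr 1
    rw [Complex.re_sum]
    refine Finset.sum_congr rfl fun p hp => ?_
    rw [Finset.sum_eq_single p]
    · have h2 : conj (x p) * x p = ((‖x p‖ ^ 2 : ℝ) : ℂ) := by
        rw [mul_comm, Complex.mul_conj, Complex.normSq_eq_norm_sq]
      rw [specSum]
      simp only [if_true, mul_one]
      have h3 : conj (x p) * (ρ.spectral.eigenvalue p.1 * x p) +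
          conj (x p) * x p * ρ.spectral.eigenvalue p.2 =
          ((‖x p‖ ^ 2 * (ρ.spectral.eigenvalue p.1 + ρ.spectral.eigenvalue p.2) : ℝ) : ℂ) := by
        push_cast at h2 ⊢
        rw [← h2]
        ring
      rw [← Complex.ofReal_re (‖x p‖ ^ 2 * _), ← h3]
      congr 1
      ring
    · intro q _ hqp
      by_cases h1 : p.1 = q.1
      · have h2 : ¬ q.2 = p.2 := fun h2 => hqp (Prod.ext h1.symm h2)
        simp [h2]
      · simp [h1]
    · exact fun h => absurd hp h
  have hB : 0 ≤ B := by simpa using key ∅ 0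
  have hker : ∀ p, specSum ρ p = 0 → specCoeff ρ C p = 0 := by
    intro p hp
    by_contra hc
    have hn : 0 < ‖specCoeff ρ C p‖ ^ 2 := by positivity
    have h1 := key {p} fun p => (((B + 1) / ‖specCoeff ρ C p‖ ^ 2 : ℝ) : ℂ) * specCoeff ρ C p
    simp only [Finset.sum_singleton, hp, mul_zero, add_zero, map_mul, Complex.conj_ofReal] at h1
    rw [mul_assoc, mul_comm (conj _), Complex.mul_conj, Complex.normSq_eq_norm_sq,
      ← Complex.ofReal_mul, Complex.ofReal_re, div_mul_cancel₀ _ hn.ne'] at h1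
    linarith
  rw [specNorm, ENNReal.tsum_eq_iSup_sum]
  refine iSup_le fun S => ?_
  have e : ∀ p, ‖specCoeff ρ C p‖ₑ ^ 2 / ENNReal.ofReal (specSum ρ p)
      = ENNReal.ofReal (‖specCoeff ρ C p‖ ^ 2 / specSum ρ p) := fun p =>
    enorm_sq_div_ofReal (specSum_nonneg ρ p) (hker p)
  simp_rw [e]
  rw [← ENNReal.ofReal_sum_of_nonneg fun p _ => div_nonneg (by positivity) (specSum_nonneg ρ p)]
  refine ENNReal.ofReal_le_ofReal ?_
  have h1 := key S fun p => specCoeff ρ C p / (specSum ρ p : ℂ)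
  have h2 : (∑ p ∈ S, conj (specCoeff ρ C p / (specSum ρ p : ℂ)) * specCoeff ρ C p).re
      = ∑ p ∈ S, ‖specCoeff ρ C p‖ ^ 2 / specSum ρ p := by
    rw [Complex.re_sum]
    refine Finset.sum_congr rfl fun p _ => ?_
    rw [map_div₀, Complex.conj_ofReal, div_mul_eq_mul_div, mul_comm, Complex.mul_conj,
      Complex.normSq_eq_norm_sq, ← Complex.ofReal_div, Complex.ofReal_re]
  have h3 : ∀ p, ‖specCoeff ρ C p / (specSum ρ p : ℂ)‖ ^ 2 * specSum ρ p
      = ‖specCoeff ρ C p‖ ^ 2 / specSum ρ p := by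
    intro p
    rw [norm_div, div_pow, Complex.norm_real, Real.norm_eq_abs, sq_abs]
    by_cases h0 : specSum ρ p = 0
    · simp [h0]
    · field_simp
  rw [h2] at h1
  simp_rw [h3] at h1
  linarith

/-! ### The metrological power as a bound on all generalized quadratures -/

theorem quadQFI_eq {ρ : DensityOp ι} (k : ι × Fin 2) :
    quadQFI ρ k = 2 * specNorm ρ (quadCommutator ρ k) := rfl

theorem isQuadCommutator_quadCommutator {ρ : DensityOp ι} {k : ι × Fin 2}
    (h : ∃ C, IsQuadCommutator ρ k C) : IsQuadCommutator ρ k (quadCommutator ρ k) := by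
  rw [quadCommutator, dif_pos h]
  exact h.choose_spec

theorem specNorm_ne_top {ρ : DensityOp ι} (h : HasFiniteQFI ρ) (k : ι × Fin 2) :
    specNorm ρ (quadCommutator ρ k) ≠ ⊤ := by
  intro h1
  apply (h k).2
  rw [quadQFI_eq, h1]
  simp

/-- The QFI matrix as a quadratic form: `uᵀ F u` is the quantum Fisher information of the
generalized quadrature `∑ k, u k R^(k)`. -/
theorem specNorm_sum {ρ : DensityOp ι} (h : HasFiniteQFI ρ) (u : ι × Fin 2 → ℝ) :
    specNorm ρ (∑ k, (u k : ℂ) • quadCommutator ρ k) ≠ ⊤ ∧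
    u ⬝ᵥ ((qfiMatrix ρ).mulVec u) =
      2 * (specNorm ρ (∑ k, (u k : ℂ) • quadCommutator ρ k)).toReal := by
  set c : ι × Fin 2 → ρ.spectral.index × ρ.spectral.index → ℂ := fun k p =>
    specCoeff ρ (quadCommutator ρ k) p with hc
  have hcu : ∀ p, specCoeff ρ (∑ k, (u k : ℂ) • quadCommutator ρ k) p = ∑ k, (u k : ℂ) * c k p := by
    intro p
    simp only [specCoeff, hc, sum_apply, smul_apply, inner_sum, inner_smul_right]
  have hq := fun k => hasSum_of_specNorm (specNorm_ne_top h k)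
  have hsum : ∀ k l, Summable fun p => (c k p * conj (c l p)).re / specSum ρ p := by
    intro k l
    refine Summable.of_norm_bounded ((hq k).summable.add (hq l).summable) fun p => ?_
    rw [norm_div, Real.norm_of_nonneg (specSum_nonneg ρ p), ← add_div]
    refine div_le_div_of_nonneg_right ?_ (specSum_nonneg ρ p)
    have h1 : ‖(c k p * conj (c l p)).re‖ ≤ ‖c k p‖ * ‖c l p‖ := by
      refine (Complex.abs_re_le_norm _).trans ?_
      rw [norm_mul, RCLike.norm_conj]
    refine h1.trans ?_
    nlinarith [sq_nonneg (‖c k p‖ - ‖c l p‖), sq_nonneg (‖c k p‖ + ‖c l p‖)]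
  have hF : ∀ k l, qfiMatrix ρ k l = 2 * ∑' p, (c k p * conj (c l p)).re / specSum ρ p :=
    fun k l => rfl
  have htot : HasSum (fun p => ‖∑ k, (u k : ℂ) * c k p‖ ^ 2 / specSum ρ p)
      (∑ k, ∑ l, u k * u l * ∑' p, (c k p * conj (c l p)).re / specSum ρ p) := by
    have h1 := hasSum_sum fun k (_ : k ∈ Finset.univ) => hasSum_sum fun l (_ : l ∈ Finset.univ) =>
      (hsum k l).hasSum.mul_left (u k * u l)
    refine hasSum_of_eq h1 (fun p => ?_) rfl
    rw [← Complex.ofReal_re (‖_‖ ^ 2), ← Complex.normSq_eq_norm_sq, ← Complex.mul_conj, map_sum,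
      Finset.sum_mul_sum, Complex.re_sum, Finset.sum_div]
    refine Finset.sum_congr rfl fun k _ => ?_
    rw [Complex.re_sum, Finset.sum_div]
    refine Finset.sum_congr rfl fun l _ => ?_
    rw [map_mul, Complex.conj_ofReal, mul_mul_mul_comm, ← Complex.ofReal_mul,
      Complex.re_ofReal_mul, mul_div_assoc]
  have hker : ∀ p, specSum ρ p = 0 → specCoeff ρ (∑ k, (u k : ℂ) • quadCommutator ρ k) p = 0 := by
    intro p hp
    rw [hcu]
    refine Finset.sum_eq_zero fun k _ => ?_
    rw [hc]
    simp only
    rw [specCoeff_eq_zero (specNorm_ne_top h k) p hp, mul_zero]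
  have heq : specNorm ρ (∑ k, (u k : ℂ) • quadCommutator ρ k)
      = ENNReal.ofReal (∑ k, ∑ l, u k * u l * ∑' p, (c k p * conj (c l p)).re / specSum ρ p) := by
    rw [specNorm, ← htot.tsum_eq, ENNReal.ofReal_tsum_of_nonneg
      (fun p => div_nonneg (by positivity) (specSum_nonneg ρ p)) htot.summable]
    refine tsum_congr fun p => ?_
    rw [enorm_sq_div_ofReal (specSum_nonneg ρ p) (hker p), hcu]
  refine ⟨by rw [heq]; exact ENNReal.ofReal_ne_top, ?_⟩
  rw [heq, ENNReal.toReal_ofReal (htot.nonneg fun p =>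
    div_nonneg (by positivity) (specSum_nonneg ρ p))]
  simp only [dotProduct, Matrix.mulVec, hF, Finset.mul_sum]
  refine Finset.sum_congr rfl fun k _ => Finset.sum_congr rfl fun l _ => ?_
  ring

theorem qfiMatrix_isHermitian (ρ : DensityOp ι) : (qfiMatrix ρ).IsHermitian := by
  ext k l
  simp only [Matrix.conjTranspose_apply, star_trivial, qfiMatrix, Matrix.of_apply]
  congr 1
  refine tsum_congr fun p => ?_
  congr 1
  rw [← Complex.conj_re, map_mul, Complex.conj_conj, mul_comm]

/-- A finite metrological power yields decompositions of the commutators with all generalized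
quadratures. -/
theorem exists_isDecomposition_of_metrologicalPower_le {ρ : DensityOp ι} {c : ℝ}
    (h : metrologicalPower ρ ≤ (c : EReal)) (u : ι × Fin 2 → ℝ) :
    ∃ v l : ρ.spectral.index → Fock ι, IsDecomposition ρ u v l ∧
      ∑' a, ‖l a‖ ^ 2 ≤ (c + 1) * (∑ k, u k ^ 2) / 2 ∧ ∀ a, (⟪v a, l a⟫_ℂ).re = 0 := by
  rw [metrologicalPower] at h
  split_ifs at h with hfin
  · have h1 : max (lambdaMax (qfiMatrix ρ) / 2 - 1) 0 ≤ c := by exact_mod_cast h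
    have h2 : lambdaMax (qfiMatrix ρ) ≤ 2 * (c + 1) := by
      have := (le_max_left _ _).trans h1
      linarith
    obtain ⟨h3, h4⟩ := specNorm_sum hfin u
    obtain ⟨v, l, hd, hl, hre⟩ := exists_isDecomposition
      (IsCommutator.sum (fun k => isQuadCommutator_quadCommutator (hfin k).1) u) h3
    refine ⟨v, l, hd, ?_, hre⟩
    have h5 := quadForm_le_lambdaMax (qfiMatrix_isHermitian ρ) u
    have h6 : u ⬝ᵥ u = ∑ k, u k ^ 2 := by simp [dotProduct, sq]
    rw [h4, h6] at h5
    have h7 : 0 ≤ ∑ k, u k ^ 2 := Finset.sum_nonneg fun _ _ => by positivity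
    rw [hl]
    nlinarith [mul_le_mul_of_nonneg_right h2 h7]
  · exact absurd h (by simp)

/-- The metrological power is bounded by `c` if all generalized quadratures satisfy the
corresponding dual bound. -/
theorem metrologicalPower_le_of_dualBound {ρ : DensityOp ι} {c : ℝ} (hc : 0 ≤ c)
    (h : ∀ u : ι × Fin 2 → ℝ, ∃ C, IsCommutator ρ u C ∧
      DualBound ρ.op C ((c + 1) * ∑ k, u k ^ 2)) : metrologicalPower ρ ≤ (c : EReal) := by
  have hfin : HasFiniteQFI ρ := by
    intro k
    obtain ⟨C, hC, hd⟩ := h (Pi.single k 1)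
    have hex : ∃ C, IsQuadCommutator ρ k C := ⟨C, isQuadCommutator_iff.2 hC⟩
    refine ⟨hex, ?_⟩
    have h1 := isQuadCommutator_iff.1 (isQuadCommutator_quadCommutator hex)
    rw [quadQFI_eq, h1.unique hC]
    exact ENNReal.mul_ne_top (by simp)
      (ne_top_of_le_ne_top ENNReal.ofReal_ne_top (specNorm_le_of_dualBound hd))
  rw [metrologicalPower, if_pos hfin]
  refine EReal.coe_le_coe_iff.2 (max_le ?_ hc)
  have h1 : lambdaMax (qfiMatrix ρ) ≤ 2 * (c + 1) := by
    refine lambdaMax_le (by linarith) fun u => ?_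
    obtain ⟨C, hC, hd⟩ := h u
    have h2 := IsCommutator.sum (fun k => isQuadCommutator_quadCommutator (hfin k).1) u
    rw [(specNorm_sum hfin u).2, h2.unique hC]
    have h6 : u ⬝ᵥ u = ∑ k, u k ^ 2 := by simp [dotProduct, sq]
    have h7 : 0 ≤ ∑ k, u k ^ 2 := Finset.sum_nonneg fun _ _ => by positivity
    have h8 := ENNReal.toReal_mono ENNReal.ofReal_ne_top (specNorm_le_of_dualBound hd)
    rw [ENNReal.toReal_ofReal (by positivity)] at h8
    rw [h6]
    linarith
  linarith

theorem metrologicalPower_le_of_isDecomposition {ρ : DensityOp ι} {c : ℝ} (hc : 0 ≤ c)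
    (h : ∀ u : ι × Fin 2 → ℝ, ∃ (α : Type w) (v l : α → Fock ι), IsDecomposition ρ u v l ∧
      ∑' a, ‖l a‖ ^ 2 ≤ (c + 1) * (∑ k, u k ^ 2) / 2) : metrologicalPower ρ ≤ (c : EReal) := by
  refine metrologicalPower_le_of_dualBound hc fun u => ?_
  obtain ⟨α, v, l, hd, hl⟩ := h u
  obtain ⟨C, hC, -, hb⟩ := hd.dualBound
  exact ⟨C, hC, hb.mono (by linarith)⟩

theorem metrologicalPower_nonneg (ρ : DensityOp ι) : 0 ≤ metrologicalPower ρ := by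
  rw [metrologicalPower]
  split_ifs
  · exact_mod_cast le_max_right _ _
  · exact le_top

/-- To bound a metrological power by another one, one may assume the latter to be a real number. -/
theorem metrologicalPower_le_of_forall {ρ : DensityOp ι} {x : EReal} (hx : 0 ≤ x)
    (h : ∀ c : ℝ, 0 ≤ c → x = (c : EReal) → metrologicalPower ρ ≤ (c : EReal)) :
    metrologicalPower ρ ≤ x := by
  induction x with
  | bot => simp at hx
  | top => exact le_top
  | coe c => exact h c (by exact_mod_cast hx) rfl

end Fisher

/-! ### Linear optical unitaries -/

section Unitary

variable {ι : Type u} [Fintype ι] [DecidableEq ι]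

theorem inner_symm_apply (U : Fock ι ≃ₗᵢ[ℂ] Fock ι) (φ ψ : Fock ι) :
    ⟪φ, U.symm ψ⟫_ℂ = ⟪U φ, ψ⟫_ℂ := by
  rw [← U.inner_map_map, U.apply_symm_apply]

theorem DensityOp.conj_op_apply (ρ : DensityOp ι) (U : Fock ι ≃ₗᵢ[ℂ] Fock ι) (ψ : Fock ι) :
    (ρ.conj U).op ψ = U (ρ.op (U.symm ψ)) := rfl

/-- A linear optical transformation solved for the untransformed quadratures. -/
theorem map_quad_of_orthogonal {U : Fock ι ≃ₗᵢ[ℂ] Fock ι} {O : Matrix (ι × Fin 2) (ι × Fin 2) ℝ}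
    (hO : O ∈ Matrix.orthogonalGroup (ι × Fin 2) ℝ) {d : ι × Fin 2 → ℝ} (ψ : quadDomain ι)
    {h : U ψ ∈ quadDomain ι}
    (hU : ∀ k, quad k ⟨U ψ, h⟩ = U (∑ l, (O k l : ℂ) • quad l ψ + (d k : ℂ) • (ψ : Fock ι)))
    (k : ι × Fin 2) :
    U (quad k ψ) = ∑ l, (O l k : ℂ) • (quad l ⟨U ψ, h⟩ - (d l : ℂ) • U ψ) := by
  have hOO : ∀ j, ∑ l, O l k * O l j = if k = j then 1 else 0 := by
    intro j
    have h1 : O.transpose * O = 1 := (Matrix.mem_orthogonalGroup_iff' (ι × Fin 2) ℝ).1 hO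
    have h2 := congrFun (congrFun h1 k) j
    rwa [Matrix.mul_apply, Matrix.one_apply] at h2
  have h1 : ∀ l, quad l ⟨U ψ, h⟩ - (d l : ℂ) • U ψ = ∑ j, (O l j : ℂ) • U (quad j ψ) := by
    intro l
    rw [hU, map_add, map_smul, add_sub_cancel_right, map_sum]
    simp only [map_smul]
  simp only [h1, Finset.smul_sum, smul_smul]
  rw [Finset.sum_comm]
  simp only [← Finset.sum_smul]
  have h2 : ∀ j, ∑ l, (O l k : ℂ) * (O l j : ℂ) = if k = j then 1 else 0 := by
    intro j
    have := hOO j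
    rw [← Complex.ofReal_inj] at this
    push_cast at this
    rw [this]
    split_ifs <;> simp
  simp [h2]

/-- Linear optical unitaries map the domain of the quadratures onto itself. -/
theorem IsLinearOptical.symm {U : Fock ι ≃ₗᵢ[ℂ] Fock ι} (hU : IsLinearOptical U) :
    IsLinearOptical U.symm := by
  obtain ⟨O, hO, d, hd⟩ := hU
  refine ⟨O.transpose, ?_, fun k => -∑ l, O l k * d l, fun φ => ?_⟩
  · rw [Matrix.mem_orthogonalGroup_iff]
    simpa [Matrix.star_eq_conjTranspose] using (Matrix.mem_orthogonalGroup_iff' (ι × Fin 2) ℝ).1 hO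
  set χ : ι × Fin 2 → Fock ι := fun k =>
    U.symm (∑ l, (O l k : ℂ) • (quad l φ - (d l : ℂ) • (φ : Fock ι))) with hχ
  have hmem : U.symm φ ∈ quadDomain ι := by
    refine mem_quadDomain_of_inner χ fun k m => ?_
    obtain ⟨h, hk⟩ := hd (ketVec m)
    rw [inner_symm_apply, map_quad_of_orthogonal hO _ hk, ← inner_ket, hχ, inner_symm_apply,
      sum_inner, inner_sum]
    refine Finset.sum_congr rfl fun l _ => ?_
    rw [inner_smul_left, inner_smul_right, inner_sub_left, inner_sub_right, inner_smul_left,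
      inner_smul_right, quad_symmetric, Complex.conj_ofReal, Complex.conj_ofReal]
    rfl
  refine ⟨hmem, fun k => ?_⟩
  obtain ⟨h, hk⟩ := hd ⟨U.symm φ, hmem⟩
  have h1 := map_quad_of_orthogonal hO _ hk k
  have h2 : (⟨U (U.symm φ), h⟩ : quadDomain ι) = φ := Subtype.ext (U.apply_symm_apply _)
  simp only [h2] at h1
  rw [← U.symm_apply_apply (quad k ⟨U.symm φ, hmem⟩), h1]
  congr 1
  simp only [smul_sub, smul_smul, Finset.sum_sub_distrib, Matrix.transpose_apply,
    U.apply_symm_apply]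
  push_cast
  rw [← Finset.sum_smul, neg_smul, sub_eq_add_neg]

theorem DensityOp.conj_conj_symm (ρ : DensityOp ι) (U : Fock ι ≃ₗᵢ[ℂ] Fock ι) :
    (ρ.conj U).conj U.symm = ρ := by
  apply DensityOp.ext_op
  ext1 ψ
  simp [DensityOp.conj_op_apply]

theorem metrologicalPower_conj_le (ρ : DensityOp ι) {U : Fock ι ≃ₗᵢ[ℂ] Fock ι}
    (hU : IsLinearOptical U) : metrologicalPower (ρ.conj U) ≤ metrologicalPower ρ := by
  refine metrologicalPower_le_of_forall (metrologicalPower_nonneg ρ) fun c hc hρ => ?_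
  refine metrologicalPower_le_of_isDecomposition hc fun u => ?_
  have hU' := hU.symm
  obtain ⟨O, hO, d, hd⟩ := hU
  obtain ⟨v, l, hdec, hl, -⟩ :=
    exists_isDecomposition_of_metrologicalPower_le hρ.le (O.transpose.mulVec u)
  have hnorm : ∑ k, (O.transpose.mulVec u) k ^ 2 = ∑ k, u k ^ 2 := by
    have h1 : O * O.transpose = 1 := (Matrix.mem_orthogonalGroup_iff (ι × Fin 2) ℝ).1 hO
    have h2 : (O.transpose.mulVec u) ⬝ᵥ (O.transpose.mulVec u) = u ⬝ᵥ u := by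
      rw [Matrix.dotProduct_mulVec, Matrix.vecMul_transpose, Matrix.mulVec_mulVec, h1,
        Matrix.one_mulVec]
    simpa [dotProduct, sq] using h2
  rw [hnorm] at hl
  have hsum : Summable fun a => ‖U (l a)‖ ^ 2 := by simpa using hdec.summable
  have e1 : ∀ φ x, ⟪φ, U x⟫_ℂ = ⟪U.symm φ, x⟫_ℂ := fun φ x => by
    rw [← U.inner_map_map (U.symm φ), U.apply_symm_apply]
  have e2 : ∀ x ψ, ⟪U x, ψ⟫_ℂ = ⟪x, U.symm ψ⟫_ℂ := fun x ψ => (inner_symm_apply U x ψ).symm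
  refine ⟨_, fun a => U (v a), fun a => U (l a), ⟨fun φ ψ => ?_, hsum, fun φ ψ => ?_⟩, by simpa⟩
  · refine hasSum_of_eq (hdec.state (U.symm φ) (U.symm ψ)) (fun a => ?_) ?_
    · rw [e1, e2]
    · rw [DensityOp.conj_op_apply, e1]
  · obtain ⟨_, _, _, hd'⟩ := hU'
    obtain ⟨hφ, -⟩ := hd' φ
    obtain ⟨hψ, -⟩ := hd' ψ
    have hdir : ∀ χ : quadDomain ι, ∀ hχ : U.symm χ ∈ quadDomain ι, quadDir u χ =
        U (quadDir (O.transpose.mulVec u) ⟨U.symm χ, hχ⟩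
          + ((∑ k, u k * d k : ℝ) : ℂ) • U.symm χ) := by
      intro χ hχ
      obtain ⟨h, hk⟩ := hd ⟨U.symm χ, hχ⟩
      have h2 : (⟨U (U.symm χ), h⟩ : quadDomain ι) = χ := Subtype.ext (U.apply_symm_apply _)
      simp only [h2] at hk
      rw [quadDir_apply, quadDir_apply]
      simp only [hk, map_add, map_sum, map_smul, smul_add, Finset.sum_add_distrib, Finset.smul_sum,
        smul_smul]
      congr 1
      · rw [Finset.sum_comm]
        refine Finset.sum_congr rfl fun j _ => ?_
        rw [← Finset.sum_smul]
        congr 1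
        simp only [Matrix.mulVec, dotProduct, Matrix.transpose_apply]
        push_cast
        exact Finset.sum_congr rfl fun k _ => mul_comm _ _
      · rw [← Finset.sum_smul]
        push_cast
        rfl
    have h := hdec.comm ⟨U.symm φ, hφ⟩ ⟨U.symm ψ, hψ⟩
    refine hasSum_of_eq h (fun a => ?_) ?_
    · simp only [e1, e2]
    · rw [commForm, commForm, hdir φ hφ, hdir ψ hψ, DensityOp.conj_op_apply,
        DensityOp.conj_op_apply, U.inner_map_map, U.inner_map_map, inner_add_left, inner_add_right,
        inner_smul_left, inner_smul_right, Complex.conj_ofReal, ρ.inner_op (U.symm φ) (U.symm ψ)]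
      ring

end Unitary

/-! ### Subsystems -/

section Subsystem

/-- An embedding of the modes `ι` as a subsystem into the modes `ι'`, where the Fock states of the
remaining modes are labelled by `K`: `fock m k` is the joint photon number configuration. -/
structure Subsystem (ι : Type u) (ι' : Type v) (K : Type w) [DecidableEq ι] [DecidableEq ι'] where
  mode : ι → ι'
  fock : (ι → ℕ) → K → ι' → ℕ
  mode_injective : Function.Injective mode
  fock_mode : ∀ m k n, fock m k (mode n) = m n
  fock_add : ∀ m k n, fock (m + Pi.single n 1) k = fock m k + Pi.single (mode n) 1
  fock_sub : ∀ m k n, fock (m - Pi.single n 1) k = fock m k - Pi.single (mode n) 1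
  tsum_fock : ∀ f : (ι' → ℕ) → ℝ≥0∞, ∑' (k) (m), f (fock m k) = ∑' m, f m

variable {ι : Type u} [Fintype ι] [DecidableEq ι] {ι' : Type v} [Fintype ι'] [DecidableEq ι']
  {K : Type w}

theorem Subsystem.tsum_slice (S : Subsystem ι ι' K) (Ψ : Fock ι') :
    ∑' (k) (m), ‖Ψ (S.fock m k)‖ₑ ^ 2 = ‖Ψ‖ₑ ^ 2 := by
  rw [S.tsum_fock fun m => ‖Ψ m‖ₑ ^ 2, norm_sq_eq_tsum_ket]

/-- The partial inner product of a vector with the Fock state `k` of the remaining modes. -/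
def Subsystem.slice (S : Subsystem ι ι' K) (k : K) (Ψ : Fock ι') : Fock ι :=
  ⟨fun m => Ψ (S.fock m k), (memℓp_iff_tsum _).2 (ne_top_of_le_ne_top (b := ‖Ψ‖ₑ ^ 2) (by simp) (by
    rw [← S.tsum_slice]
    exact ENNReal.le_tsum (f := fun k : K => ∑' m, ‖Ψ (S.fock m k)‖ₑ ^ 2) k))⟩

theorem Subsystem.inner_ket_slice (S : Subsystem ι ι' K) (k : K) (m : ι → ℕ) (Ψ : Fock ι') :
    ⟪ket m, S.slice k Ψ⟫_ℂ = ⟪ket (S.fock m k), Ψ⟫_ℂ := by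
  rw [inner_ket, inner_ket]
  rfl

theorem Subsystem.hasSum_norm_slice {α : Type*} (S : Subsystem ι ι' K) {x : α → Fock ι'}
    (hx : Summable fun a => ‖x a‖ ^ 2) :
    HasSum (fun p : K × α => ‖S.slice p.1 (x p.2)‖ ^ 2) (∑' a, ‖x a‖ ^ 2) := by
  have h1 : ∑' p : K × α, ‖S.slice p.1 (x p.2)‖ₑ ^ 2 = ENNReal.ofReal (∑' a, ‖x a‖ ^ 2) := by
    rw [ENNReal.tsum_prod (f := fun k a => ‖S.slice k (x a)‖ₑ ^ 2), ENNReal.tsum_comm,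
      ENNReal.ofReal_tsum_of_nonneg (fun _ => by positivity) hx]
    refine tsum_congr fun a => ?_
    rw [← enorm_sq_eq_ofReal, ← S.tsum_slice]
    exact tsum_congr fun k => norm_sq_eq_tsum_ket _
  simp_rw [enorm_sq_eq_ofReal] at h1
  have hs := ENNReal.summable_toReal (h1 ▸ ENNReal.ofReal_ne_top)
  simp only [ENNReal.toReal_ofReal (sq_nonneg _)] at hs
  rw [← ENNReal.ofReal_tsum_of_nonneg (fun _ => by positivity) hs,
    ENNReal.ofReal_eq_ofReal_iff (tsum_nonneg fun _ => by positivity)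
      (tsum_nonneg fun _ => by positivity)] at h1
  exact h1 ▸ hs.hasSum

/-- The direction `u` of phase space, extended by zero to the remaining modes. -/
def Subsystem.extend (S : Subsystem ι ι' K) (u : ι × Fin 2 → ℝ) : ι' × Fin 2 → ℝ :=
  Function.extend (Prod.map S.mode id) u 0

theorem Subsystem.prodMap_injective (S : Subsystem ι ι' K) :
    Function.Injective (Prod.map S.mode (id : Fin 2 → Fin 2)) :=
  S.mode_injective.prodMap Function.injective_id

theorem Subsystem.sum_extend_sq (S : Subsystem ι ι' K) (u : ι × Fin 2 → ℝ) :
    ∑ k, S.extend u k ^ 2 = ∑ k, u k ^ 2 := by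
  symm
  refine Fintype.sum_of_injective _ S.prodMap_injective _ _ (fun k hk => ?_) fun k => ?_
  · rw [Subsystem.extend, Function.extend_apply' _ _ _ hk]
    simp
  · rw [Subsystem.extend, S.prodMap_injective.extend_apply]

theorem Subsystem.quadFun_slice (S : Subsystem ι ι' K) (p : ι × Fin 2) (k : K) (m : ι → ℕ)
    (Ψ : Fock ι') :
    quadFun (Prod.map S.mode id p) Ψ (S.fock m k) = quadFun p (S.slice k Ψ) m := by
  have ha : ∀ n, annihilate (S.mode n) Ψ (S.fock m k) = annihilate n (S.slice k Ψ) m := by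
    intro n
    simp [annihilate, Subsystem.slice, S.fock_mode, S.fock_add]
  have hc : ∀ n, create (S.mode n) Ψ (S.fock m k) = create n (S.slice k Ψ) m := by
    intro n
    simp [create, Subsystem.slice, S.fock_mode, S.fock_sub]
  obtain ⟨n, j⟩ := p
  fin_cases j
  · simp [quadFun_zero, ha, hc]
  · simp [quadFun_one, ha, hc]

theorem Subsystem.inner_quadDir_slice (S : Subsystem ι ι' K) (u : ι × Fin 2 → ℝ) (k : K)
    (m : ι → ℕ) (Ψ : Fock ι') :
    ⟪quadDir u (ketVec m), S.slice k Ψ⟫_ℂ = ⟪quadDir (S.extend u) (ketVec (S.fock m k)), Ψ⟫_ℂ := by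
  simp only [quadDir_apply, sum_inner, inner_smul_left, inner_quad_ketVec, Complex.conj_ofReal]
  refine Fintype.sum_of_injective _ S.prodMap_injective _ _ (fun p hp => ?_) fun p => ?_
  · rw [Subsystem.extend, Function.extend_apply' _ _ _ hp]
    simp
  · rw [Subsystem.extend, S.prodMap_injective.extend_apply, S.quadFun_slice]

/-- Decompositions restrict to subsystems: slicing all vectors with the Fock states of the
remaining modes preserves the total weight. -/
theorem Subsystem.isDecomposition {α : Type*} (S : Subsystem ι ι' K) {ρ : DensityOp ι}
    {τ : DensityOp ι'} (hρ : ∀ m n, HasSum (fun k => ⟪ket (S.fock m k), τ.op (ket (S.fock n k))⟫_ℂ)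
      ⟪ket m, ρ.op (ket n)⟫_ℂ) {u : ι × Fin 2 → ℝ} {v l : α → Fock ι'}
    (h : IsDecomposition τ (S.extend u) v l) :
    IsDecomposition ρ u (fun p : K × α => S.slice p.1 (v p.2)) fun p => S.slice p.1 (l p.2) := by
  have hv := (S.hasSum_norm_slice (hasSum_norm_sq_of_state h.state).summable).summable
  have hl := (S.hasSum_norm_slice h.summable).summable
  have hket : ∀ (k : K) (m : ι → ℕ) (Ψ : Fock ι'),
      ⟪S.slice k Ψ, ket m⟫_ℂ = ⟪Ψ, ket (S.fock m k)⟫_ℂ := fun k m Ψ => by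
    rw [← inner_conj_symm, S.inner_ket_slice, inner_conj_symm]
  have hquad : ∀ (k : K) (m : ι → ℕ) (Ψ : Fock ι'), ⟪S.slice k Ψ, quadDir u (ketVec m)⟫_ℂ =
      ⟪Ψ, quadDir (S.extend u) (ketVec (S.fock m k))⟫_ℂ := fun k m Ψ => by
    rw [← inner_conj_symm, S.inner_quadDir_slice, inner_conj_symm]
  have hstate : ∀ φ ψ, HasSum (fun p : K × α =>
      ⟪φ, S.slice p.1 (v p.2)⟫_ℂ * ⟪S.slice p.1 (v p.2), ψ⟫_ℂ) ⟪φ, ρ.op ψ⟫_ℂ := by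
    obtain ⟨T, hT⟩ := exists_hasSum_rankOne hv hv
    have e : T = ρ.op := by
      refine ext_ket fun m n => ((hT (ket m) (ket n)).prod_fiberwise fun k => ?_).unique (hρ m n)
      simp only [S.inner_ket_slice, hket]
      exact h.state _ _
    rw [← e]
    exact hT
  refine IsDecomposition.of_ket hstate hl fun m n => ?_
  obtain ⟨C, hC⟩ := exists_hasSum_antisymm hv hl
  convert hC (ket m) (ket n) using 1
  have h1 : HasSum (fun k => commForm τ (S.extend u) (ketVec (S.fock m k)) (ketVec (S.fock n k)))
      ⟪ket m, C (ket n)⟫_ℂ := by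
    refine (hC (ket m) (ket n)).prod_fiberwise fun k => ?_
    simp only [S.inner_ket_slice, hket]
    exact h.comm (ketVec _) (ketVec _)
  have h2 : HasSum (fun k => ⟪quadDir (S.extend u) (ketVec (S.fock m k)),
      τ.op (ket (S.fock n k))⟫_ℂ) ⟪quadDir u (ketVec m), ρ.op (ket n)⟫_ℂ := by
    refine (hstate _ (ket n)).prod_fiberwise fun k => ?_
    simp only [S.inner_quadDir_slice, hket]
    exact h.state _ _
  have h3 : HasSum (fun k => ⟪τ.op (ket (S.fock m k)),
      quadDir (S.extend u) (ketVec (S.fock n k))⟫_ℂ) ⟪ρ.op (ket m), quadDir u (ketVec n)⟫_ℂ := by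
    simp only [DensityOp.inner_op]
    refine (hstate (ket m) _).prod_fiberwise fun k => ?_
    simp only [S.inner_ket_slice, hquad]
    exact h.state _ _
  exact (h2.sub h3).unique h1

/-- The metrological power does not increase when modes are discarded. -/
theorem Subsystem.metrologicalPower_le (S : Subsystem ι ι' K) {ρ : DensityOp ι}
    {τ : DensityOp ι'} (hρ : ∀ m n, HasSum (fun k => ⟪ket (S.fock m k), τ.op (ket (S.fock n k))⟫_ℂ)
      ⟪ket m, ρ.op (ket n)⟫_ℂ) : metrologicalPower ρ ≤ metrologicalPower τ := by
  refine metrologicalPower_le_of_forall (metrologicalPower_nonneg τ) fun c hc hτ => ?_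
  refine metrologicalPower_le_of_isDecomposition hc fun u => ?_
  obtain ⟨v, l, hdec, hl, -⟩ := exists_isDecomposition_of_metrologicalPower_le hτ.le (S.extend u)
  refine ⟨_, _, _, S.isDecomposition hρ hdec, ?_⟩
  rw [(S.hasSum_norm_slice hdec.summable).tsum_eq, ← S.sum_extend_sq]
  exact hl

variable {κ : Type v} [Fintype κ] [DecidableEq κ]

/-- The first factor of a composite system. -/
def subsystemInl : Subsystem ι (ι ⊕ κ) (κ → ℕ) where
  mode := Sum.inl
  fock m k := Sum.elim m k
  mode_injective := Sum.inl_injective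
  fock_mode _ _ _ := rfl
  fock_add m k n := by
    funext x
    cases x <;> simp [Pi.single_apply]
  fock_sub m k n := by
    funext x
    cases x <;> simp [Pi.single_apply]
  tsum_fock f := by rw [ENNReal.tsum_comm, tsum_sum_modes]

/-- The second factor of a composite system. -/
def subsystemInr : Subsystem κ (ι ⊕ κ) (ι → ℕ) where
  mode := Sum.inr
  fock k m := Sum.elim m k
  mode_injective := Sum.inr_injective
  fock_mode _ _ _ := rfl
  fock_add k m n := by
    funext x
    cases x <;> simp [Pi.single_apply]
  fock_sub k m n := by
    funext x
    cases x <;> simp [Pi.single_apply]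
  tsum_fock f := by rw [tsum_sum_modes]

theorem metrologicalPower_partialTrace_le (τ : DensityOp (ι ⊕ κ)) :
    metrologicalPower τ.partialTrace ≤ metrologicalPower τ :=
  subsystemInl.metrologicalPower_le (exists_partialTrace τ).choose_spec

theorem DensityOp.inner_tensor (ρ : DensityOp ι) (σ : DensityOp κ) (m m' : ι → ℕ)
    (k k' : κ → ℕ) : ⟪ket (Sum.elim m k), (ρ.tensor σ).op (ket (Sum.elim m' k'))⟫_ℂ
      = ⟪ket m, ρ.op (ket m')⟫_ℂ * ⟪ket k, σ.op (ket k')⟫_ℂ :=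
  (exists_tensor ρ σ).choose_spec m m' k k'

theorem metrologicalPower_le_tensor_left (ρ : DensityOp ι) (σ : DensityOp κ) :
    metrologicalPower ρ ≤ metrologicalPower (ρ.tensor σ) := by
  refine subsystemInl.metrologicalPower_le fun m n => ?_
  have h := σ.hasSum_trace.mul_left ⟪ket m, ρ.op (ket n)⟫_ℂ
  exact hasSum_of_eq h (fun k => ρ.inner_tensor σ m n k k) (mul_one _).symm

theorem metrologicalPower_le_tensor_right (ρ : DensityOp ι) (σ : DensityOp κ) :
    metrologicalPower σ ≤ metrologicalPower (ρ.tensor σ) := by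
  refine subsystemInr.metrologicalPower_le fun k l => ?_
  have h := ρ.hasSum_trace.mul_right ⟪ket k, σ.op (ket l)⟫_ℂ
  exact hasSum_of_eq h (fun m => ρ.inner_tensor σ m m k l) (one_mul _).symm

end Subsystem

/-! ### The trace of a commutator -/

section Trace

variable {ι : Type u} [Fintype ι] [DecidableEq ι]

theorem hasSum_norm_sq_apply (ψ : Fock ι) : HasSum (fun m => ‖ψ m‖ ^ 2) (‖ψ‖ ^ 2) := by
  have h := lp.hasSum_norm (p := 2) (by norm_num) ψ
  simpa only [ENNReal.toReal_ofNat, Real.rpow_two] using h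

/-- A cutoff in the total photon number. -/
def cutoff (K : ℕ) (m : ι → ℕ) : ℝ := ((K - ∑ i, m i : ℕ) : ℝ) / K

theorem cutoff_nonneg (K : ℕ) (m : ι → ℕ) : 0 ≤ cutoff K m := by
  rw [cutoff]; positivity

theorem cutoff_le_one (K : ℕ) (m : ι → ℕ) : cutoff K m ≤ 1 := by
  rw [cutoff]
  refine div_le_one_of_le₀ ?_ (by positivity)
  exact_mod_cast Nat.sub_le _ _

theorem tendsto_cutoff (m : ι → ℕ) :
    Filter.Tendsto (fun K => cutoff K m) Filter.atTop (nhds 1) := by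
  have h : Filter.Tendsto (fun K : ℕ => 1 - ((∑ i, m i : ℕ) : ℝ) / K) Filter.atTop (nhds (1 - 0)) :=
    tendsto_const_nhds.sub (tendsto_const_div_atTop_nhds_zero_nat _)
  rw [sub_zero] at h
  refine h.congr' ?_
  filter_upwards [Filter.eventually_ge_atTop (∑ i, m i + 1)] with K hK
  have hK' : 0 < K := by omega
  have h0 : (K : ℝ) ≠ 0 := by positivity
  rw [cutoff, Nat.cast_sub (by omega), sub_div, div_self h0]

theorem sum_add_single (m : ι → ℕ) (n : ι) :
    ∑ i, (m + Pi.single n 1 : ι → ℕ) i = ∑ i, m i + 1 := by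
  simp [Finset.sum_add_distrib]

theorem cutoff_add_single_le (K : ℕ) (m : ι → ℕ) (n : ι) :
    cutoff K (m + Pi.single n 1) ≤ cutoff K m := by
  rw [cutoff, cutoff, sum_add_single]
  gcongr
  omega

theorem cutoff_mul_sqrt_le (K : ℕ) (m : ι → ℕ) (n : ι) :
    cutoff K m * Real.sqrt (m n + 1) ≤ Real.sqrt K := by
  by_cases h : K ≤ ∑ i, m i
  · have h1 : cutoff K m = 0 := by rw [cutoff, Nat.sub_eq_zero_of_le h]; simp
    rw [h1, zero_mul]
    positivity
  · have h2 : m n ≤ ∑ i, m i := Finset.single_le_sum (fun _ _ => Nat.zero_le _) (Finset.mem_univ n)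
    calc cutoff K m * Real.sqrt (m n + 1) ≤ 1 * Real.sqrt (m n + 1) := by
          gcongr; exact cutoff_le_one K m
      _ ≤ Real.sqrt K := by
          rw [one_mul]
          apply Real.sqrt_le_sqrt
          exact_mod_cast (by omega : m n + 1 ≤ K)

/-- The slope `1 / K` of the cutoff beats the growth `√K` of the matrix elements of the
quadratures. -/
theorem cutoff_sub_mul_sqrt_le (K : ℕ) (m : ι → ℕ) (n : ι) :
    (cutoff K m - cutoff K (m + Pi.single n 1)) * Real.sqrt (m n + 1) ≤ (Real.sqrt K)⁻¹ := by
  by_cases h : K ≤ ∑ i, m i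
  · have h1 : cutoff K m = 0 := by rw [cutoff, Nat.sub_eq_zero_of_le h]; simp
    have h2 := cutoff_add_single_le K m n
    have h3 := cutoff_nonneg K (m + Pi.single n 1)
    rw [show cutoff K m - cutoff K (m + Pi.single n 1) = 0 by linarith, zero_mul]
    positivity
  · have h2 : m n ≤ ∑ i, m i := Finset.single_le_sum (fun _ _ => Nat.zero_le _) (Finset.mem_univ n)
    have hK : (0 : ℝ) < K := by exact_mod_cast (by omega : 0 < K)
    have h3 : cutoff K m - cutoff K (m + Pi.single n 1) = 1 / K := by
      rw [cutoff, cutoff, sum_add_single, ← sub_div]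
      congr 1
      rw [Nat.cast_sub (by omega), Nat.cast_sub (by omega)]
      push_cast
      ring
    have h4 : Real.sqrt (m n + 1) ≤ Real.sqrt K := by
      apply Real.sqrt_le_sqrt
      exact_mod_cast (by omega : m n + 1 ≤ K)
    rw [h3, div_mul_eq_mul_div, one_mul, div_le_iff₀ hK]
    refine h4.trans (le_of_eq ?_)
    rw [inv_mul_eq_div, eq_div_iff (by positivity), Real.mul_self_sqrt hK.le]

theorem norm_inner_ket_op_le (ρ : DensityOp ι) (m n : ι → ℕ) :
    ‖⟪ket m, ρ.op (ket n)⟫_ℂ‖ ≤ (⟪ket m, ρ.op (ket m)⟫_ℂ).re + (⟪ket n, ρ.op (ket n)⟫_ℂ).re := by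
  obtain ⟨v, -, hv⟩ := ρ.exists_family
  have hd : ∀ m : ι → ℕ, HasSum (fun a => ‖v a m‖ ^ 2) (⟪ket m, ρ.op (ket m)⟫_ℂ).re := by
    intro m
    refine hasSum_of_eq (Complex.hasSum_re (hv (ket m) (ket m))) (fun a => ?_) rfl
    rw [inner_ket, inner_ket', Complex.mul_conj, Complex.normSq_eq_norm_sq, Complex.ofReal_re]
  refine (hv (ket m) (ket n)).norm_le_of_bounded ((hd m).add (hd n)) fun a => ?_
  rw [inner_ket, inner_ket', norm_mul, RCLike.norm_conj]
  nlinarith [sq_nonneg (‖v a m‖ - ‖v a n‖), sq_nonneg (‖v a m‖ + ‖v a n‖)]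

/-- The current of photons from the configuration `m` to `m + e_n` under the generator
`∑ k, u k R^(k)`. The diagonal of the commutator is the discrete divergence of these currents. -/
def current (ρ : DensityOp ι) (u : ι × Fin 2 → ℝ) (n : ι) (m : ι → ℕ) : ℂ :=
  (Real.sqrt (m n + 1) : ℂ) *
    (conj (ladderCoeff u n) * ⟪ket (m + Pi.single n 1), ρ.op (ket m)⟫_ℂ
      - ladderCoeff u n * ⟪ket m, ρ.op (ket (m + Pi.single n 1))⟫_ℂ)

/-- The current into the configuration `m` from `m - e_n`. -/
def currentIn (ρ : DensityOp ι) (u : ι × Fin 2 → ℝ) (n : ι) (m : ι → ℕ) : ℂ :=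
  (Real.sqrt (m n) : ℂ) *
    (conj (ladderCoeff u n) * ⟪ket m, ρ.op (ket (m - Pi.single n 1))⟫_ℂ
      - ladderCoeff u n * ⟪ket (m - Pi.single n 1), ρ.op (ket m)⟫_ℂ)

theorem commForm_diag (ρ : DensityOp ι) (u : ι × Fin 2 → ℝ) (m : ι → ℕ) :
    commForm ρ u (ketVec m) (ketVec m) = ∑ n, (current ρ u n m - currentIn ρ u n m) := by
  rw [commForm, quadDir_eq_ladder, sum_inner, inner_sum, ← Finset.sum_sub_distrib]
  refine Finset.sum_congr rfl fun n _ => ?_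
  simp only [annVec_ketVec, creVec_ketVec, inner_add_left, inner_add_right, inner_smul_left,
    inner_smul_right, Complex.conj_conj, Complex.conj_ofReal, coe_ketVec, DensityOp.inner_op,
    current, currentIn]
  ring

theorem currentIn_add_single (ρ : DensityOp ι) (u : ι × Fin 2 → ℝ) (n : ι) (m : ι → ℕ) :
    currentIn ρ u n (m + Pi.single n 1) = current ρ u n m := by
  simp [current, currentIn]

theorem currentIn_eq_zero (ρ : DensityOp ι) (u : ι × Fin 2 → ℝ) (n : ι) {m : ι → ℕ}
    (hm : m ∉ Set.range fun m : ι → ℕ => m + Pi.single n 1) : currentIn ρ u n m = 0 := by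
  have h : m n = 0 := by
    by_contra h
    exact hm (mem_range_add_single h)
  simp [currentIn, h]

/-- Summation by parts: the trace of the commutator against a cutoff. -/
theorem norm_tsum_cutoff_le (ρ : DensityOp ι) (u : ι × Fin 2 → ℝ) (K : ℕ) :
    ‖∑' m, (cutoff K m : ℂ) * commForm ρ u (ketVec m) (ketVec m)‖ ≤
      (∑ n, 4 * ‖ladderCoeff u n‖) * (Real.sqrt K)⁻¹ := by
  set p : (ι → ℕ) → ℝ := fun m => (⟪ket m, ρ.op (ket m)⟫_ℂ).re with hp
  have hp0 : ∀ m, 0 ≤ p m := fun m => by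
    have := (norm_nonneg _).trans (norm_inner_ket_op_le ρ m m)
    simp only [hp]
    linarith
  have hps : HasSum p 1 := by simpa using Complex.hasSum_re ρ.hasSum_trace
  have hpn : ∀ n, Summable fun m : ι → ℕ => p (m + Pi.single n 1) := fun n =>
    hps.summable.comp_injective (add_single_injective n)
  have hpn1 : ∀ n, ∑' m : ι → ℕ, p (m + Pi.single n 1) ≤ 1 := fun n => by
    rw [← hps.tsum_eq]
    exact tsum_comp_le_tsum_of_inj hps.summable hp0 (add_single_injective n)
  have hcur : ∀ n m, ‖current ρ u n m‖ ≤
      2 * ‖ladderCoeff u n‖ * (p m + p (m + Pi.single n 1)) * Real.sqrt (m n + 1) := by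
    intro n m
    rw [current, norm_mul, Complex.norm_real, Real.norm_of_nonneg (Real.sqrt_nonneg _), mul_comm]
    refine mul_le_mul_of_nonneg_right ?_ (Real.sqrt_nonneg _)
    refine (norm_sub_le _ _).trans ?_
    rw [norm_mul, norm_mul, RCLike.norm_conj]
    have h1 := norm_inner_ket_op_le ρ (m + Pi.single n 1) m
    have h2 := norm_inner_ket_op_le ρ m (m + Pi.single n 1)
    nlinarith [mul_le_mul_of_nonneg_left h1 (norm_nonneg (ladderCoeff u n)),
      mul_le_mul_of_nonneg_left h2 (norm_nonneg (ladderCoeff u n))]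
  have hbound : ∀ (n : ι) (y : (ι → ℕ) → ℝ) (B : ℝ), (∀ m, 0 ≤ y m) →
      (∀ m, y m * Real.sqrt (m n + 1) ≤ B) → ∀ m, ‖(y m : ℂ) * current ρ u n m‖ ≤
        2 * ‖ladderCoeff u n‖ * B * (p m + p (m + Pi.single n 1)) := by
    intro n y B hy hB m
    rw [norm_mul, Complex.norm_real, Real.norm_of_nonneg (hy m)]
    have h1 := mul_le_mul_of_nonneg_left (hcur n m) (hy m)
    have h2 : 0 ≤ 2 * ‖ladderCoeff u n‖ * (p m + p (m + Pi.single n 1)) :=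
      mul_nonneg (by positivity) (add_nonneg (hp0 _) (hp0 _))
    nlinarith [mul_le_mul_of_nonneg_left (hB m) h2]
  have hdom : ∀ n (B : ℝ), Summable fun m =>
      2 * ‖ladderCoeff u n‖ * B * (p m + p (m + Pi.single n 1)) := fun n B =>
    (hps.summable.add (hpn n)).mul_left _
  have hs1 : ∀ n, Summable fun m => (cutoff K m : ℂ) * current ρ u n m := fun n =>
    Summable.of_norm_bounded (hdom n _) (hbound n (cutoff K) _ (cutoff_nonneg K)
      fun m => cutoff_mul_sqrt_le K m n)
  have hs2 : ∀ n, Summable fun m =>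
      (cutoff K (m + Pi.single n 1) : ℂ) * current ρ u n m := fun n =>
    Summable.of_norm_bounded (hdom n _) (hbound n (fun m => cutoff K (m + Pi.single n 1)) _
      (fun m => cutoff_nonneg K _) fun m =>
        (mul_le_mul_of_nonneg_right (cutoff_add_single_le K m n) (Real.sqrt_nonneg _)).trans
          (cutoff_mul_sqrt_le K m n))
  have hs3 : ∀ n, HasSum (fun m => (cutoff K m : ℂ) * currentIn ρ u n m)
      (∑' m, (cutoff K (m + Pi.single n 1) : ℂ) * current ρ u n m) := fun n => by
    rw [← (add_single_injective n).hasSum_iff]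
    · refine hasSum_of_eq (hs2 n).hasSum (fun m => ?_) rfl
      simp only [Function.comp, currentIn_add_single]
    · intro m hm
      rw [currentIn_eq_zero ρ u n hm, mul_zero]
  have htot : HasSum (fun m => (cutoff K m : ℂ) * commForm ρ u (ketVec m) (ketVec m))
      (∑ n, ∑' m, ((cutoff K m - cutoff K (m + Pi.single n 1) : ℝ) : ℂ) * current ρ u n m) := by
    have h1 := hasSum_sum fun n (_ : n ∈ Finset.univ) => (hs1 n).hasSum.sub (hs3 n)
    refine hasSum_of_eq h1 (fun m => ?_) ?_
    · rw [commForm_diag, Finset.mul_sum]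
      exact Finset.sum_congr rfl fun n _ => mul_sub _ _ _
    · refine Finset.sum_congr rfl fun n _ => ?_
      rw [← (hs1 n).tsum_sub (hs2 n)]
      refine tsum_congr fun m => ?_
      push_cast
      ring
  rw [htot.tsum_eq, Finset.sum_mul]
  refine (norm_sum_le _ _).trans (Finset.sum_le_sum fun n _ => ?_)
  have h1 := tsum_of_norm_bounded (hdom n (Real.sqrt K)⁻¹).hasSum
    (hbound n (fun m => cutoff K m - cutoff K (m + Pi.single n 1)) _
      (fun m => sub_nonneg.2 (cutoff_add_single_le K m n))
      fun m => cutoff_sub_mul_sqrt_le K m n)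
  refine h1.trans ?_
  rw [tsum_mul_left, hps.summable.tsum_add (hpn n), hps.tsum_eq]
  have h2 : 0 ≤ 2 * ‖ladderCoeff u n‖ * (Real.sqrt K)⁻¹ := by positivity
  nlinarith [mul_le_mul_of_nonneg_left (hpn1 n) h2]

/-- The trace of a commutator that has a decomposition vanishes. -/
theorem IsDecomposition.hasSum_trace {α : Type*} {ρ : DensityOp ι} {u : ι × Fin 2 → ℝ}
    {v l : α → Fock ι} (h : IsDecomposition ρ u v l) :
    HasSum (fun a => ⟪v a, l a⟫_ℂ - ⟪l a, v a⟫_ℂ) 0 := by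
  have hv := (hasSum_norm_sq_of_state h.state).summable
  set F : α × (ι → ℕ) → ℂ := fun p => ⟪ket p.2, l p.1⟫_ℂ * ⟪v p.1, ket p.2⟫_ℂ
      - ⟪ket p.2, v p.1⟫_ℂ * ⟪l p.1, ket p.2⟫_ℂ with hF
  have hb : Summable fun p : α × (ι → ℕ) => ‖l p.1 p.2‖ ^ 2 + ‖v p.1 p.2‖ ^ 2 := by
    refine (summable_prod_of_nonneg fun p => by positivity).2 ⟨fun a => ?_, ?_⟩
    · exact ((hasSum_norm_sq_apply (l a)).add (hasSum_norm_sq_apply (v a))).summable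
    · simp only [fun a => ((hasSum_norm_sq_apply (l a)).add (hasSum_norm_sq_apply (v a))).tsum_eq]
      exact h.summable.add hv
  have hFle : ∀ p, ‖F p‖ ≤ ‖l p.1 p.2‖ ^ 2 + ‖v p.1 p.2‖ ^ 2 := by
    intro p
    rw [hF]
    refine (norm_sub_le _ _).trans ?_
    simp only [inner_ket, inner_ket', norm_mul, RCLike.norm_conj]
    nlinarith [sq_nonneg (‖l p.1 p.2‖ - ‖v p.1 p.2‖)]
  have hFs : Summable F := Summable.of_norm_bounded hb hFle
  have hFn : Summable fun p => ‖F p‖ := Summable.of_nonneg_of_le (fun _ => norm_nonneg _) hFle hb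
  have h1 : HasSum (fun a => ⟪v a, l a⟫_ℂ - ⟪l a, v a⟫_ℂ) (∑' p, F p) := by
    refine hFs.hasSum.prod_fiberwise fun a => ?_
    have e1 := (ketBasis (ι := ι)).hasSum_inner_mul_inner (v a) (l a)
    have e2 := (ketBasis (ι := ι)).hasSum_inner_mul_inner (l a) (v a)
    refine hasSum_of_eq (e1.sub e2) (fun m => ?_) rfl
    rw [hF, ketBasis_apply]
    ring
  have hswap := (Equiv.prodComm (ι → ℕ) α).hasSum_iff.2 hFs.hasSum
  have h2 : HasSum (fun m => commForm ρ u (ketVec m) (ketVec m)) (∑' p, F p) :=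
    hswap.prod_fiberwise fun m => h.comm (ketVec m) (ketVec m)
  have h3 : Summable fun m => ‖commForm ρ u (ketVec m) (ketVec m)‖ := by
    have h4 := (Equiv.prodComm (ι → ℕ) α).summable_iff.2 hFn
    refine Summable.of_nonneg_of_le (fun _ => norm_nonneg _) (fun m => ?_) h4.prod
    rw [← (h.comm (ketVec m) (ketVec m)).tsum_eq]
    exact norm_tsum_le_tsum_norm (h4.prod_factor m)
  have h5 : Filter.Tendsto (fun K : ℕ => ∑' m, (cutoff K m : ℂ) *
      commForm ρ u (ketVec m) (ketVec m)) Filter.atTop (nhds (∑' p, F p)) := by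
    rw [← h2.tsum_eq]
    refine tendsto_tsum_of_dominated_convergence h3 (fun m => ?_) (Filter.Eventually.of_forall
      fun K m => ?_)
    · have := ((Complex.continuous_ofReal.tendsto 1).comp (tendsto_cutoff m)).mul_const
        (commForm ρ u (ketVec m) (ketVec m))
      simpa using this
    · rw [norm_mul, Complex.norm_real, Real.norm_of_nonneg (cutoff_nonneg K m)]
      exact mul_le_of_le_one_left (norm_nonneg _) (cutoff_le_one K m)
  have h6 : Filter.Tendsto (fun K : ℕ => (∑ n, 4 * ‖ladderCoeff u n‖) * (Real.sqrt K)⁻¹)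
      Filter.atTop (nhds ((∑ n, 4 * ‖ladderCoeff u n‖) * 0)) :=
    (tendsto_inv_atTop_zero.comp
      (Real.tendsto_sqrt_atTop.comp tendsto_natCast_atTop_atTop)).const_mul _
  rw [mul_zero] at h6
  have h7 := squeeze_zero_norm (norm_tsum_cutoff_le ρ u) h6
  rw [← tendsto_nhds_unique h5 h7]
  exact h1

end Trace

/-! ### Product states -/

section Tensor

variable {ι : Type u} [Fintype ι] [DecidableEq ι] {κ : Type v} [Fintype κ] [DecidableEq κ]

theorem inner_tensorVec (ψ ψ' : Fock ι) (φ φ' : Fock κ) :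
    ⟪tensorVec ψ φ, tensorVec ψ' φ'⟫_ℂ = ⟪ψ, ψ'⟫_ℂ * ⟪φ, φ'⟫_ℂ := by
  have h1 := hasSum_mul_complex (hasSum_inner_apply ψ ψ') (hasSum_inner_apply φ φ')
  rw [← (Equiv.sumArrowEquivProdArrow ι κ ℕ).hasSum_iff] at h1
  refine (hasSum_inner_apply _ _).unique (hasSum_of_eq h1 (fun m => ?_) rfl)
  simp only [tensorVec_apply, map_mul, Function.comp, Equiv.sumArrowEquivProdArrow, Equiv.coe_fn_mk]
  ring

theorem inner_ket_tensorVec (m : ι → ℕ) (k : κ → ℕ) (ψ : Fock ι) (φ : Fock κ) :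
    ⟪ket (Sum.elim m k), tensorVec ψ φ⟫_ℂ = ⟪ket m, ψ⟫_ℂ * ⟪ket k, φ⟫_ℂ := by
  simp only [inner_ket, tensorVec_apply, Sum.elim_comp_inl, Sum.elim_comp_inr]

theorem inner_quad_tensorVec_inl (p : ι × Fin 2) (m : ι → ℕ) (k : κ → ℕ) (ψ : Fock ι)
    (φ : Fock κ) : ⟪quad (Sum.inl p.1, p.2) (ketVec (Sum.elim m k)), tensorVec ψ φ⟫_ℂ
      = ⟪quad p (ketVec m), ψ⟫_ℂ * ⟪ket k, φ⟫_ℂ := by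
  have h := (subsystemInl (ι := ι) (κ := κ)).quadFun_slice p k m (tensorVec ψ φ)
  have e : (subsystemInl (ι := ι) (κ := κ)).slice k (tensorVec ψ φ) = φ k • ψ := by
    apply lp.ext
    funext m
    simp [Subsystem.slice, subsystemInl, tensorVec_apply, mul_comm]
  rw [inner_quad_ketVec, inner_quad_ketVec, inner_ket]
  refine h.trans ?_
  rw [e, lp.coeFn_smul, map_smul]
  simp [mul_comm]

theorem inner_quad_tensorVec_inr (p : κ × Fin 2) (m : ι → ℕ) (k : κ → ℕ) (ψ : Fock ι)
    (φ : Fock κ) : ⟪quad (Sum.inr p.1, p.2) (ketVec (Sum.elim m k)), tensorVec ψ φ⟫_ℂ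
      = ⟪ket m, ψ⟫_ℂ * ⟪quad p (ketVec k), φ⟫_ℂ := by
  have h := (subsystemInr (ι := ι) (κ := κ)).quadFun_slice p m k (tensorVec ψ φ)
  have e : (subsystemInr (ι := ι) (κ := κ)).slice m (tensorVec ψ φ) = ψ m • φ := by
    apply lp.ext
    funext k
    simp [Subsystem.slice, subsystemInr, tensorVec_apply]
  rw [inner_quad_ketVec, inner_quad_ketVec, inner_ket]
  refine h.trans ?_
  rw [e, lp.coeFn_smul, map_smul]
  simp

theorem sum_sum_modes {M : Type*} [AddCommMonoid M] (f : (ι ⊕ κ) × Fin 2 → M) :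
    ∑ q, f q = ∑ p : ι × Fin 2, f (Sum.inl p.1, p.2) + ∑ p : κ × Fin 2, f (Sum.inr p.1, p.2) := by
  simp only [Fintype.sum_prod_type, Fintype.sum_sum_type]

theorem inner_quadDir_tensorVec (u : (ι ⊕ κ) × Fin 2 → ℝ) (m : ι → ℕ) (k : κ → ℕ) (ψ : Fock ι)
    (φ : Fock κ) : ⟪quadDir u (ketVec (Sum.elim m k)), tensorVec ψ φ⟫_ℂ
      = ⟪quadDir (fun p => u (Sum.inl p.1, p.2)) (ketVec m), ψ⟫_ℂ * ⟪ket k, φ⟫_ℂ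
        + ⟪ket m, ψ⟫_ℂ * ⟪quadDir (fun p => u (Sum.inr p.1, p.2)) (ketVec k), φ⟫_ℂ := by
  simp only [quadDir_apply, sum_inner, inner_add_left, inner_smul_left, Complex.conj_ofReal,
    sum_sum_modes, inner_quad_tensorVec_inl, inner_quad_tensorVec_inr, Finset.sum_mul,
    Finset.mul_sum]
  congr 1
  · exact Finset.sum_congr rfl fun p _ => (mul_assoc _ _ _).symm
  · exact Finset.sum_congr rfl fun p _ => mul_left_comm _ _ _

/-- Decompositions of two factors combine to a decomposition of the product state by the Leibniz
rule. -/
theorem IsDecomposition.tensor {α β : Type*} {ρ : DensityOp ι} {σ : DensityOp κ}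
    {u : (ι ⊕ κ) × Fin 2 → ℝ} {v l : α → Fock ι} {w r : β → Fock κ}
    (h : IsDecomposition ρ (fun p => u (Sum.inl p.1, p.2)) v l)
    (h' : IsDecomposition σ (fun p => u (Sum.inr p.1, p.2)) w r)
    (hs : Summable fun p : α × β => ‖tensorVec (l p.1) (w p.2) + tensorVec (v p.1) (r p.2)‖ ^ 2) :
    IsDecomposition (ρ.tensor σ) u (fun p : α × β => tensorVec (v p.1) (w p.2))
      fun p => tensorVec (l p.1) (w p.2) + tensorVec (v p.1) (r p.2) := by
  have hflip : ∀ (n : ι → ℕ) (k : κ → ℕ) ψ φ, ⟪tensorVec ψ φ, ket (Sum.elim n k)⟫_ℂ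
      = ⟪ψ, ket n⟫_ℂ * ⟪φ, ket k⟫_ℂ := fun n k ψ φ => by
    rw [← inner_conj_symm, inner_ket_tensorVec, map_mul, inner_conj_symm, inner_conj_symm]
  have hflip' : ∀ (n : ι → ℕ) (k : κ → ℕ) ψ φ, ⟪tensorVec ψ φ, quadDir u (ketVec (Sum.elim n k))⟫_ℂ
      = ⟪ψ, quadDir (fun p => u (Sum.inl p.1, p.2)) (ketVec n)⟫_ℂ * ⟪φ, ket k⟫_ℂ
        + ⟪ψ, ket n⟫_ℂ * ⟪φ, quadDir (fun p => u (Sum.inr p.1, p.2)) (ketVec k)⟫_ℂ := by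
    intro n k ψ φ
    rw [← inner_conj_symm, inner_quadDir_tensorVec, map_add, map_mul, map_mul, inner_conj_symm,
      inner_conj_symm, inner_conj_symm, inner_conj_symm]
  have hv := (hasSum_norm_tensorVec (hasSum_norm_sq_of_state h.state)
    (hasSum_norm_sq_of_state h'.state)).summable
  have hstate : ∀ φ ψ, HasSum (fun p : α × β => ⟪φ, tensorVec (v p.1) (w p.2)⟫_ℂ *
      ⟪tensorVec (v p.1) (w p.2), ψ⟫_ℂ) ⟪φ, (ρ.tensor σ).op ψ⟫_ℂ := by
    obtain ⟨T, hT⟩ := exists_hasSum_rankOne hv hv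
    have e : T = (ρ.tensor σ).op := by
      refine ext_ket fun m n => (hT (ket m) (ket n)).unique ?_
      rw [← Sum.elim_comp_inl_inr m, ← Sum.elim_comp_inl_inr n, DensityOp.inner_tensor]
      refine hasSum_of_eq (hasSum_mul_complex (h.state _ _) (h'.state _ _)) (fun p => ?_) rfl
      rw [inner_ket_tensorVec, hflip]
      ring
    rw [← e]
    exact hT
  refine IsDecomposition.of_ket hstate hs fun m n => ?_
  obtain ⟨m, k, rfl⟩ : ∃ (a : ι → ℕ) (b : κ → ℕ), m = Sum.elim a b :=
    ⟨_, _, (Sum.elim_comp_inl_inr m).symm⟩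
  obtain ⟨n, j, rfl⟩ : ∃ (a : ι → ℕ) (b : κ → ℕ), n = Sum.elim a b :=
    ⟨_, _, (Sum.elim_comp_inl_inr n).symm⟩
  have h1 := hasSum_mul_complex (h.comm (ketVec m) (ketVec n)) (h'.state (ket k) (ket j))
  have h2 := hasSum_mul_complex (h.state (ket m) (ket n)) (h'.comm (ketVec k) (ketVec j))
  refine hasSum_of_eq (h1.add h2) (fun p => ?_) ?_
  · simp only [inner_add_left, inner_add_right, inner_ket_tensorVec, hflip, coe_ketVec]
    ring
  · have e1 : ⟪quadDir u (ketVec (Sum.elim m k)), (ρ.tensor σ).op (ket (Sum.elim n j))⟫_ℂ =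
        ⟪quadDir (fun p => u (Sum.inl p.1, p.2)) (ketVec m), ρ.op (ket n)⟫_ℂ *
          ⟪ket k, σ.op (ket j)⟫_ℂ + ⟪ket m, ρ.op (ket n)⟫_ℂ *
          ⟪quadDir (fun p => u (Sum.inr p.1, p.2)) (ketVec k), σ.op (ket j)⟫_ℂ := by
      refine (hstate _ _).unique (hasSum_of_eq
        ((hasSum_mul_complex (h.state _ (ket n)) (h'.state _ (ket j))).add
          (hasSum_mul_complex (h.state _ (ket n)) (h'.state _ (ket j)))) (fun p => ?_) rfl)
      rw [inner_quadDir_tensorVec, hflip]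
      ring
    have e2 : ⟪(ρ.tensor σ).op (ket (Sum.elim m k)), quadDir u (ketVec (Sum.elim n j))⟫_ℂ =
        ⟪ρ.op (ket m), quadDir (fun p => u (Sum.inl p.1, p.2)) (ketVec n)⟫_ℂ *
          ⟪ket k, σ.op (ket j)⟫_ℂ + ⟪ket m, ρ.op (ket n)⟫_ℂ *
          ⟪σ.op (ket k), quadDir (fun p => u (Sum.inr p.1, p.2)) (ketVec j)⟫_ℂ := by
      simp only [DensityOp.inner_op]
      refine (hstate _ _).unique (hasSum_of_eq
        ((hasSum_mul_complex (h.state (ket m) _) (h'.state (ket k) _)).add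
          (hasSum_mul_complex (h.state (ket m) _) (h'.state (ket k) _))) (fun p => ?_) rfl)
      rw [hflip', inner_ket_tensorVec]
      ring
    simp only [commForm, coe_ketVec, e1, e2]
    ring

/-- The weight of the combined decomposition is additive when `∑ a, ⟨v a | l a⟩ = 0`. -/
theorem hasSum_norm_sq_tensorVec_add {α β : Type*} {v l : α → Fock ι} {w r : β → Fock κ}
    (hv : HasSum (fun a => ‖v a‖ ^ 2) 1) (hl : Summable fun a => ‖l a‖ ^ 2)
    (hw : HasSum (fun b => ‖w b‖ ^ 2) 1) (hr : Summable fun b => ‖r b‖ ^ 2)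
    (h0 : ∑' a, ⟪l a, v a⟫_ℂ = 0) :
    HasSum (fun p : α × β => ‖tensorVec (l p.1) (w p.2) + tensorVec (v p.1) (r p.2)‖ ^ 2)
      (∑' a, ‖l a‖ ^ 2 + ∑' b, ‖r b‖ ^ 2) := by
  have hn : ∀ (ψ : Fock ι) (φ : Fock κ), ‖tensorVec ψ φ‖ ^ 2 = ‖ψ‖ ^ 2 * ‖φ‖ ^ 2 := by
    intro ψ φ
    have h := inner_tensorVec ψ ψ φ φ
    simp only [inner_self_eq_norm_sq_to_K] at h
    exact_mod_cast h
  have hsl : Summable fun a => ⟪l a, v a⟫_ℂ := by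
    refine Summable.of_norm_bounded (hl.add hv.summable) fun a => ?_
    refine (norm_inner_le_norm _ _).trans ?_
    nlinarith [sq_nonneg (‖l a‖ - ‖v a‖), sq_nonneg (‖l a‖ + ‖v a‖)]
  have hsr : Summable fun b => ⟪w b, r b⟫_ℂ := by
    refine Summable.of_norm_bounded (hw.summable.add hr) fun a => ?_
    refine (norm_inner_le_norm _ _).trans ?_
    nlinarith [sq_nonneg (‖w a‖ - ‖r a‖), sq_nonneg (‖w a‖ + ‖r a‖)]
  have hmul : ∀ {f : α → ℝ} {g : β → ℝ} {x y : ℝ}, (∀ a, 0 ≤ f a) → (∀ b, 0 ≤ g b) →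
      HasSum f x → HasSum g y → HasSum (fun p : α × β => f p.1 * g p.2) (x * y) :=
    fun hf hg hx hy => hx.mul hy (hx.summable.mul_of_nonneg hy.summable hf hg)
  have h1 := hmul (fun _ => sq_nonneg _) (fun _ => sq_nonneg _) hl.hasSum hw
  have h2 := hmul (fun _ => sq_nonneg _) (fun _ => sq_nonneg _) hv hr.hasSum
  have h3 := (Complex.hasSum_re (hasSum_mul_complex hsl.hasSum hsr.hasSum)).mul_left 2
  refine hasSum_of_eq ((h1.add h3).add h2) (fun p => ?_) ?_
  · rw [norm_add_sq (𝕜 := ℂ), hn, hn, inner_tensorVec]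
    rfl
  · rw [h0]
    simp

theorem metrologicalPower_tensor_le (ρ : DensityOp ι) (σ : DensityOp κ) :
    metrologicalPower (ρ.tensor σ) ≤ max (metrologicalPower ρ) (metrologicalPower σ) := by
  refine metrologicalPower_le_of_forall (le_max_of_le_left (metrologicalPower_nonneg ρ))
    fun c hc hmax => ?_
  refine metrologicalPower_le_of_isDecomposition hc fun u => ?_
  obtain ⟨v, l, h, hl, hre⟩ := exists_isDecomposition_of_metrologicalPower_le
    ((le_max_left _ _).trans hmax.le) fun p : ι × Fin 2 => u (Sum.inl p.1, p.2)
  obtain ⟨w, r, h', hr, -⟩ := exists_isDecomposition_of_metrologicalPower_le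
    ((le_max_right _ _).trans hmax.le) fun p : κ × Fin 2 => u (Sum.inr p.1, p.2)
  -- the summands are purely imaginary, so twice their sum is the trace of the commutator
  have h0 : ∑' a, ⟪l a, v a⟫_ℂ = 0 := by
    have e : ∀ a, ⟪v a, l a⟫_ℂ - ⟪l a, v a⟫_ℂ = -2 * ⟪l a, v a⟫_ℂ := by
      intro a
      have h1 : (⟪l a, v a⟫_ℂ).re = 0 := by
        rw [← inner_conj_symm, Complex.conj_re, hre]
      have h2 : (⟪v a, l a⟫_ℂ).im = -(⟪l a, v a⟫_ℂ).im := by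
        rw [← inner_conj_symm, Complex.conj_im]
      apply Complex.ext
      · simp [h1, hre]
      · simp [h2]
        ring
    have h2 := h.hasSum_trace
    simp only [e] at h2
    have h3 := h2.tsum_eq
    rw [tsum_mul_left] at h3
    simpa using h3
  have hs := hasSum_norm_sq_tensorVec_add (hasSum_norm_sq_of_state h.state) h.summable
    (hasSum_norm_sq_of_state h'.state) h'.summable h0
  refine ⟨_, _, _, h.tensor h' hs.summable, ?_⟩
  rw [hs.tsum_eq, sum_sum_modes]
  linarith

end Tensor

/-! ### Coherent states -/

section Coherent

variable {ι : Type u} [Fintype ι] [DecidableEq ι]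

theorem coherentFun_add_single (α : ι → ℂ) (n : ι) (m : ι → ℕ) :
    (Real.sqrt (m n + 1) : ℂ) * coherentFun α (m + Pi.single n 1) = α n * coherentFun α m := by
  have h0 : (Real.sqrt (m n + 1) : ℂ) ≠ 0 := by
    exact_mod_cast (Real.sqrt_pos.2 (by positivity)).ne'
  have h1 : (Real.sqrt (m n).factorial : ℂ) ≠ 0 := by
    exact_mod_cast (Real.sqrt_pos.2 (by positivity)).ne'
  rw [coherentFun, coherentFun, ← Finset.mul_prod_erase Finset.univ _ (Finset.mem_univ n),
    ← Finset.mul_prod_erase Finset.univ _ (Finset.mem_univ n)]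
  have e : ∀ i ∈ Finset.univ.erase n, (m + Pi.single n 1 : ι → ℕ) i = m i := fun i hi => by
    simp [Pi.single_eq_of_ne (Finset.ne_of_mem_erase hi)]
  rw [Finset.prod_congr rfl fun i hi => by rw [e i hi], ← mul_assoc, ← mul_assoc]
  congr 1
  simp only [Pi.add_apply, Pi.single_eq_same, Nat.factorial_succ]
  push_cast
  rw [Real.sqrt_mul (by positivity)]
  push_cast
  field_simp
  ring

theorem memℓp_create {ψ : Fock ι} {n : ι} (h : Memℓp (annihilate n ψ) 2) :
    Memℓp (create n ψ) 2 := by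
  have hs : ∀ a : ℕ, ‖(Real.sqrt a : ℂ)‖ₑ ^ 2 = a := by
    intro a
    rw [enorm_sq_eq_ofReal, Complex.norm_real, Real.norm_of_nonneg (Real.sqrt_nonneg _),
      Real.sq_sqrt (by positivity), ENNReal.ofReal_natCast]
  rw [memℓp_iff_tsum] at h ⊢
  have h1 : ∑' m, ‖create n ψ m‖ₑ ^ 2 = ∑' m : ι → ℕ, (m n * ‖ψ m‖ₑ ^ 2 + ‖ψ m‖ₑ ^ 2) := by
    rw [← (add_single_injective n).tsum_eq]
    · refine tsum_congr fun m => ?_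
      simp only [create, LinearMap.coe_mk, AddHom.coe_mk, enorm_mul, mul_pow, hs,
        add_tsub_cancel_right]
      simp [add_mul]
    · intro m hm
      refine mem_range_add_single fun h0 => hm ?_
      simp [create, h0]
  have h2 : ∑' m, ‖annihilate n ψ m‖ₑ ^ 2 = ∑' m : ι → ℕ, m n * ‖ψ m‖ₑ ^ 2 := by
    rw [← (add_single_injective n).tsum_eq (f := fun m : ι → ℕ => (m n : ℝ≥0∞) * ‖ψ m‖ₑ ^ 2)]
    · refine tsum_congr fun m => ?_
      have := hs (m n + 1)
      push_cast at this
      simp only [annihilate, LinearMap.coe_mk, AddHom.coe_mk, enorm_mul, mul_pow, this]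
      simp
    · intro m hm
      refine mem_range_add_single fun h0 => hm ?_
      simp [h0]
  rw [h1, ENNReal.tsum_add, ← h2, ← norm_sq_eq_tsum_ket]
  exact ENNReal.add_ne_top.2 ⟨h, by simp⟩

theorem annihilate_coherentVec (α : ι → ℂ) (n : ι) :
    annihilate n (coherentVec α : Fock ι) = (α n • coherentVec α : Fock ι) :=
  funext fun m => coherentFun_add_single α n m

theorem coherentVec_mem_quadDomain (α : ι → ℂ) : coherentVec α ∈ quadDomain ι := by
  rintro ⟨n, j⟩
  have ha : Memℓp (annihilate n (coherentVec α : Fock ι)) 2 :=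
    annihilate_coherentVec α n ▸ lp.memℓp _
  have hc := memℓp_create ha
  fin_cases j
  · simp only [Fin.zero_eta, quadFun_zero]
    exact (ha.add hc).const_smul _
  · simp only [Fin.mk_one, quadFun_one]
    exact (ha.sub hc).const_smul _

/-- The coherent state as a vector of the domain of the quadratures. -/
def coherentDom (α : ι → ℂ) : quadDomain ι := ⟨coherentVec α, coherentVec_mem_quadDomain α⟩

/-- Coherent states are eigenvectors of the annihilation operators. -/
theorem annVec_coherentDom (α : ι → ℂ) (n : ι) :
    annVec n (coherentDom α) = α n • coherentVec α :=
  lp.ext (annihilate_coherentVec α n)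

theorem DensityOp.pure_op_apply {ψ : Fock ι} (hψ : ‖ψ‖ = 1) (φ : Fock ι) :
    (DensityOp.pure ψ hψ).op φ = ⟪ψ, φ⟫_ℂ • ψ := rfl

/-- For a pure state in the domain of the quadratures, the vector `(R - r) ψ` decomposes the
commutator, for every real number `r`. -/
theorem isDecomposition_pure (ψ : quadDomain ι) (hψ : ‖(ψ : Fock ι)‖ = 1) (u : ι × Fin 2 → ℝ)
    (r : ℝ) : IsDecomposition (DensityOp.pure (ψ : Fock ι) hψ) u (fun _ : Unit => (ψ : Fock ι))
      (fun _ => quadDir u ψ - (r : ℂ) • (ψ : Fock ι)) := by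
  refine ⟨fun φ χ => ?_, (hasSum_fintype _).summable, fun φ χ => ?_⟩
  · refine hasSum_of_eq (hasSum_fintype _) (fun _ => rfl) ?_
    rw [DensityOp.pure_op_apply, inner_smul_right]
    simp [mul_comm]
  · refine hasSum_of_eq (hasSum_fintype _) (fun _ => rfl) ?_
    rw [commForm, DensityOp.pure_op_apply, DensityOp.pure_op_apply, inner_smul_right,
      inner_smul_left, quadDir_symmetric, ← quadDir_symmetric u ψ χ, inner_conj_symm]
    simp only [Finset.univ_unique, Finset.sum_singleton, inner_sub_left, inner_sub_right,
      inner_smul_left, inner_smul_right, Complex.conj_ofReal]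
    ring

/-- The vector `(R - ⟨R⟩) |α⟩ = ∑ n, z n (a_n† - conj (α n)) |α⟩` for the generalized quadrature
`R = ∑ k, u k R^(k)`. -/
def coherentShift (u : ι × Fin 2 → ℝ) (α : ι → ℂ) : Fock ι :=
  ∑ n, ladderCoeff u n • (creVec n (coherentDom α) - conj (α n) • coherentVec α)

theorem exists_coherentShift_eq (u : ι × Fin 2 → ℝ) (α : ι → ℂ) :
    ∃ r : ℝ, coherentShift u α = quadDir u (coherentDom α) - (r : ℂ) • coherentVec α := by
  refine ⟨∑ n, 2 * (ladderCoeff u n * conj (α n)).re, ?_⟩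
  rw [quadDir_eq_ladder, Complex.ofReal_sum, Finset.sum_smul, ← Finset.sum_sub_distrib,
    coherentShift]
  refine Finset.sum_congr rfl fun n _ => ?_
  have h : ((2 * (ladderCoeff u n * conj (α n)).re : ℝ) : ℂ)
      = ladderCoeff u n * conj (α n) + conj (ladderCoeff u n) * α n := by
    rw [Complex.ofReal_mul, Complex.re_eq_add_conj, map_mul, Complex.conj_conj]
    push_cast
    ring
  rw [h, annVec_coherentDom]
  module

theorem inner_self_eq_ofReal_norm_sq {H : Type*} [NormedAddCommGroup H] [InnerProductSpace ℂ H]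
    (y : H) : ⟪y, y⟫_ℂ = ((‖y‖ ^ 2 : ℝ) : ℂ) := by
  rw [inner_self_eq_norm_sq_to_K]
  push_cast
  rfl

theorem inner_coherentVec_self (α : ι → ℂ) : ⟪coherentVec α, coherentVec α⟫_ℂ = 1 := by
  rw [inner_self_eq_norm_sq_to_K, norm_coherentVec]
  simp

/-- All generalized quadratures have the vacuum variance in coherent states. -/
theorem norm_sq_coherentShift (u : ι × Fin 2 → ℝ) (α : ι → ℂ) :
    ‖coherentShift u α‖ ^ 2 = (∑ k, u k ^ 2) / 2 := by
  have h : ∀ n k, ⟪creVec n (coherentDom α) - conj (α n) • coherentVec α,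
      creVec k (coherentDom α) - conj (α k) • coherentVec α⟫_ℂ = if n = k then 1 else 0 := by
    intro n k
    have h1 : ⟪creVec n (coherentDom α), coherentVec α⟫_ℂ = α n := by
      have := inner_annVec n (coherentDom α) (coherentDom α)
      rw [annVec_coherentDom] at this
      refine this.symm.trans ?_
      rw [inner_smul_right]
      exact (congrArg _ (inner_coherentVec_self α)).trans (mul_one _)
    have h2 : ⟪coherentVec α, creVec k (coherentDom α)⟫_ℂ = conj (α k) := by
      have := inner_creVec k (coherentDom α) (coherentDom α)
      rw [annVec_coherentDom] at this
      refine this.trans ?_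
      rw [inner_smul_left]
      exact (congrArg _ (inner_coherentVec_self α)).trans (mul_one _)
    have h3 : ⟪((coherentDom α : quadDomain ι) : Fock ι), (coherentDom α : quadDomain ι)⟫_ℂ = 1 :=
      inner_coherentVec_self α
    rw [inner_sub_left, inner_sub_right, inner_sub_right, inner_creVec_creVec, h3,
      annVec_coherentDom, annVec_coherentDom]
    simp only [inner_smul_left, inner_smul_right, h1, h2, inner_coherentVec_self, Complex.conj_conj]
    ring
  have h1 : ⟪coherentShift u α, coherentShift u α⟫_ℂ = ((∑ n, ‖ladderCoeff u n‖ ^ 2 : ℝ) : ℂ) := by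
    simp only [coherentShift, sum_inner, inner_sum, inner_smul_left, inner_smul_right, h]
    simp only [mul_ite, mul_one, mul_zero, Finset.sum_ite_eq', Finset.mem_univ,
      if_true]
    push_cast
    refine Finset.sum_congr rfl fun n _ => ?_
    rw [Complex.mul_conj, Complex.normSq_eq_norm_sq]
    push_cast
    rfl
  rw [sum_norm_sq_ladderCoeff, inner_self_eq_ofReal_norm_sq] at h1
  exact Complex.ofReal_injective h1

/-- The commutator of a generalized quadrature with a coherent state. -/
def coherentComm (u : ι × Fin 2 → ℝ) (α : ι → ℂ) : Fock ι →L[ℂ] Fock ι :=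
  InnerProductSpace.rankOne ℂ (coherentShift u α) (coherentVec α)
    - InnerProductSpace.rankOne ℂ (coherentVec α) (coherentShift u α)

theorem coherentComm_spec (u : ι × Fin 2 → ℝ) (α : ι → ℂ) :
    IsCommutator (DensityOp.coherent α) u (coherentComm u α) ∧
      DualBound (DensityOp.coherent α).op (coherentComm u α) (∑ k, u k ^ 2) := by
  obtain ⟨r, hr⟩ := exists_coherentShift_eq u α
  obtain ⟨C, hC, hsum, hd⟩ :=
    (isDecomposition_pure (coherentDom α) (norm_coherentVec α) u r).dualBound
  have e : C = coherentComm u α := by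
    refine ext_ket fun m n => ((hsum (ket m) (ket n)).unique (hasSum_fintype _)).trans ?_
    change ∑ _ : Unit, (⟪_, quadDir u (coherentDom α) - (r : ℂ) • coherentVec α⟫_ℂ * _
      - _ * ⟪quadDir u (coherentDom α) - (r : ℂ) • coherentVec α, _⟫_ℂ) = _
    rw [← hr, coherentComm, sub_apply, inner_sub_right, InnerProductSpace.rankOne_apply,
      InnerProductSpace.rankOne_apply, inner_smul_right, inner_smul_right]
    simp only [Finset.univ_unique, Finset.sum_singleton]
    change _ * ⟪coherentVec α, _⟫_ℂ - ⟪_, coherentVec α⟫_ℂ * _ = _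
    ring
  rw [← e]
  refine ⟨hC, hd.mono (le_of_eq ?_)⟩
  change 2 * ∑' _ : Unit, ‖quadDir u (coherentDom α) - (r : ℂ) • coherentVec α‖ ^ 2 = _
  rw [← hr, norm_sq_coherentShift]
  simp
  ring

end Coherent

/-! ### Classical states -/

section Classical

open MeasureTheory

variable {ι : Type u} [Fintype ι] [DecidableEq ι]

theorem stronglyMeasurable_of_apply {Ω : Type*} [MeasurableSpace Ω] {f : Ω → Fock ι}
    (hf : ∀ m, StronglyMeasurable fun ω => f ω m) : StronglyMeasurable f := by
  refine stronglyMeasurable_of_tendsto (Filter.atTop : Filter (Finset (ι → ℕ)))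
    (f := fun s ω => ∑ m ∈ s, f ω m • ket m) (fun s => ?_) ?_
  · exact Finset.stronglyMeasurable_fun_sum s fun m _ => (hf m).smul_const _
  · exact tendsto_pi_nhds.2 fun ω => hasSum_ket (f ω)

theorem continuous_coherentFun (m : ι → ℕ) : Continuous fun α : ι → ℂ => coherentFun α m := by
  unfold coherentFun
  fun_prop

theorem stronglyMeasurable_coherentVec :
    StronglyMeasurable (coherentVec : (ι → ℂ) → Fock ι) :=
  stronglyMeasurable_of_apply fun m => (continuous_coherentFun m).stronglyMeasurable

theorem stronglyMeasurable_coherentShift (u : ι × Fin 2 → ℝ) :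
    StronglyMeasurable (coherentShift u) := by
  refine Finset.stronglyMeasurable_fun_sum _ fun n _ => StronglyMeasurable.fun_const_smul ?_ _
  refine StronglyMeasurable.sub (stronglyMeasurable_of_apply fun m => ?_)
    (StronglyMeasurable.fun_smul ?_ stronglyMeasurable_coherentVec)
  · exact ((continuous_coherentFun (m - Pi.single n 1)).const_mul _).stronglyMeasurable
  · exact (Complex.continuous_conj.comp (continuous_apply n)).stronglyMeasurable

theorem stronglyMeasurable_rankOne {Ω : Type*} [MeasurableSpace Ω] {f g : Ω → Fock ι}
    (hf : StronglyMeasurable f) (hg : StronglyMeasurable g) :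
    StronglyMeasurable fun ω => InnerProductSpace.rankOne ℂ (f ω) (g ω) := by
  have h : Continuous fun p : Fock ι × Fock ι =>
      ContinuousLinearMap.smulRightL ℂ (Fock ι) (Fock ι) (innerSL ℂ p.2) p.1 :=
    ((ContinuousLinearMap.smulRightL ℂ (Fock ι) (Fock ι)).continuous.comp
      ((innerSL ℂ).continuous.comp continuous_snd)).clm_apply continuous_fst
  have h2 : StronglyMeasurable fun ω => (f ω, g ω) := hf.prodMk hg
  exact Continuous.comp_stronglyMeasurable (f := fun ω => (f ω, g ω)) h h2

theorem integrable_coherentComm (P : Measure (ι → ℂ)) [IsProbabilityMeasure P]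
    (u : ι × Fin 2 → ℝ) : Integrable (coherentComm u) P := by
  refine Integrable.of_bound (((stronglyMeasurable_rankOne (stronglyMeasurable_coherentShift u)
    stronglyMeasurable_coherentVec).sub (stronglyMeasurable_rankOne stronglyMeasurable_coherentVec
    (stronglyMeasurable_coherentShift u))).aestronglyMeasurable)
    (2 * Real.sqrt ((∑ k, u k ^ 2) / 2)) (Filter.Eventually.of_forall fun α => ?_)
  refine (norm_sub_le _ _).trans (le_of_eq ?_)
  rw [InnerProductSpace.norm_rankOne, InnerProductSpace.norm_rankOne, norm_coherentVec,
    ← norm_sq_coherentShift u α, Real.sqrt_sq (norm_nonneg _)]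
  ring

theorem integrable_coherent_op (P : Measure (ι → ℂ)) [IsProbabilityMeasure P] :
    Integrable (fun α => (DensityOp.coherent α).op) P := by
  refine Integrable.of_bound (stronglyMeasurable_rankOne stronglyMeasurable_coherentVec
    stronglyMeasurable_coherentVec).aestronglyMeasurable 1 (Filter.Eventually.of_forall fun α => ?_)
  change ‖InnerProductSpace.rankOne ℂ (coherentVec α) (coherentVec α)‖ ≤ 1
  rw [InnerProductSpace.norm_rankOne, norm_coherentVec, mul_one]

theorem integrable_inner_apply {P : Measure (ι → ℂ)} {A : (ι → ℂ) → Fock ι →L[ℂ] Fock ι}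
    (hA : Integrable A P) (φ ψ : Fock ι) : Integrable (fun α => ⟪φ, A α ψ⟫_ℂ) P :=
  (innerSL ℂ φ).integrable_comp (hA.apply_continuousLinearMap ψ)

theorem inner_integral_apply {P : Measure (ι → ℂ)} {A : (ι → ℂ) → Fock ι →L[ℂ] Fock ι}
    (hA : Integrable A P) (φ ψ : Fock ι) : ⟪φ, (∫ α, A α ∂P) ψ⟫_ℂ = ∫ α, ⟪φ, A α ψ⟫_ℂ ∂P := by
  rw [ContinuousLinearMap.integral_apply hA]
  exact ((innerSL ℂ φ).integral_comp_comm (hA.apply_continuousLinearMap ψ)).symm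

theorem DensityOp.IsClassical.exists_integral {ρ : DensityOp ι} (h : ρ.IsClassical) :
    ∃ P : Measure (ι → ℂ), IsProbabilityMeasure P ∧
      ρ.op = ∫ α, (DensityOp.coherent α).op ∂P := by
  obtain ⟨P, hP, hρ⟩ := h
  refine ⟨P, hP, ext_ket fun m n => ?_⟩
  rw [inner_integral_apply (integrable_coherent_op P), hρ]
  refine integral_congr_ae (Filter.Eventually.of_forall fun α => ?_)
  change _ = ⟪ket m, ⟪coherentVec α, ket n⟫_ℂ • coherentVec α⟫_ℂ
  rw [inner_smul_right]
  exact mul_comm _ _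

/-- Classical states have no metrological power: both sides of the dual bound are linear in the
state and its commutator, so that the bound for coherent states can be integrated. -/
theorem metrologicalPower_of_isClassical {ρ : DensityOp ι} (h : ρ.IsClassical) :
    metrologicalPower ρ = 0 := by
  refine le_antisymm ?_ (metrologicalPower_nonneg ρ)
  have h0 : metrologicalPower ρ ≤ ((0 : ℝ) : EReal) := by
    refine metrologicalPower_le_of_dualBound le_rfl fun u => ?_
    obtain ⟨P, hP, hρ⟩ := h.exists_integral
    have hA := integrable_coherent_op P
    have hB := integrable_coherentComm P u
    have iA := integrable_inner_apply hA
    have iB := integrable_inner_apply hB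
    refine ⟨∫ α, coherentComm u α ∂P, fun φ ψ => ?_, fun β s φ ψ => ?_⟩
    · rw [inner_integral_apply hB, commForm, ρ.inner_op, hρ, inner_integral_apply hA,
        inner_integral_apply hA, ← integral_sub (iA _ _) (iA _ _)]
      refine integral_congr_ae (Filter.Eventually.of_forall fun α => ?_)
      refine ((coherentComm_spec u α).1 φ ψ).trans ?_
      rw [commForm, DensityOp.inner_op]
    · rw [zero_add, one_mul]
      have e1 : ∑ a ∈ s, ⟪φ a, (∫ α, coherentComm u α ∂P) (ψ a)⟫_ℂ =
          ∫ α, ∑ a ∈ s, ⟪φ a, coherentComm u α (ψ a)⟫_ℂ ∂P := by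
        rw [integral_finsetSum s fun a _ => iB _ _]
        exact Finset.sum_congr rfl fun a _ => inner_integral_apply hB _ _
      have iT : ∀ a b, Integrable (fun α => ⟪φ a, (DensityOp.coherent α).op (φ b)⟫_ℂ * ⟪ψ b, ψ a⟫_ℂ
          + ⟪φ a, φ b⟫_ℂ * ⟪ψ b, (DensityOp.coherent α).op (ψ a)⟫_ℂ) P := fun a b =>
        ((iA _ _).mul_const _).add ((iA _ _).const_mul _)
      have e2 : ∑ a ∈ s, ∑ b ∈ s, (⟪φ a, ρ.op (φ b)⟫_ℂ * ⟪ψ b, ψ a⟫_ℂ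
          + ⟪φ a, φ b⟫_ℂ * ⟪ψ b, ρ.op (ψ a)⟫_ℂ) =
          ∫ α, ∑ a ∈ s, ∑ b ∈ s, (⟪φ a, (DensityOp.coherent α).op (φ b)⟫_ℂ * ⟪ψ b, ψ a⟫_ℂ
          + ⟪φ a, φ b⟫_ℂ * ⟪ψ b, (DensityOp.coherent α).op (ψ a)⟫_ℂ) ∂P := by
        rw [integral_finsetSum s fun a _ => integrable_finsetSum s fun b _ => iT a b]
        refine Finset.sum_congr rfl fun a _ => ?_
        rw [integral_finsetSum s fun b _ => iT a b]
        refine Finset.sum_congr rfl fun b _ => ?_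
        rw [integral_add ((iA _ _).mul_const _) ((iA _ _).const_mul _), integral_mul_const,
          integral_const_mul, hρ, inner_integral_apply hA, inner_integral_apply hA]
      have i1 : Integrable (fun α => ∑ a ∈ s, ⟪φ a, coherentComm u α (ψ a)⟫_ℂ) P :=
        integrable_finsetSum s fun a _ => iB _ _
      have i2 : Integrable (fun α => ∑ a ∈ s, ∑ b ∈ s,
          (⟪φ a, (DensityOp.coherent α).op (φ b)⟫_ℂ * ⟪ψ b, ψ a⟫_ℂ
          + ⟪φ a, φ b⟫_ℂ * ⟪ψ b, (DensityOp.coherent α).op (ψ a)⟫_ℂ)) P :=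
        integrable_finsetSum s fun a _ => integrable_finsetSum s fun b _ => iT a b
      rw [e1, e2]
      have r1 := integral_re i1
      have r2 := integral_re i2
      have i1r := i1.re
      have i2r := i2.re
      simp only [RCLike.re_eq_complex_re] at r1 r2 i1r i2r
      rw [← r1, ← r2, ← integral_const_mul]
      have hc : ∑ k, u k ^ 2 = ∫ _ : ι → ℂ, ∑ k, u k ^ 2 ∂P := by simp
      rw [hc, ← integral_add (integrable_const _) i2r]
      exact integral_mono (i1r.const_mul 2) ((integrable_const _).add i2r)
        fun α => (coherentComm_spec u α).2 β s φ ψ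
  simpa using h0

theorem isClassical_coherent (α : ι → ℂ) : (DensityOp.coherent α).IsClassical := by
  refine ⟨Measure.dirac α, inferInstance, fun φ ψ => ?_⟩
  rw [integral_dirac]
  change ⟪φ, ⟪coherentVec α, ψ⟫_ℂ • coherentVec α⟫_ℂ = _
  rw [inner_smul_right]
  exact mul_comm _ _

end Classical

/-! ### Pure states without metrological power -/

section Pure

variable {ι : Type u} [Fintype ι] [DecidableEq ι]

theorem exists_apply_ne_zero {ψ : Fock ι} (hψ : ‖ψ‖ = 1) : ∃ m, ψ m ≠ 0 := by
  by_contra! h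
  have : ψ = 0 := lp.ext (funext h)
  simp [this] at hψ

/-- If the commutators with a pure state are bounded, then the state vector is in the domain of the
quadratures: its image under a quadrature can be read off from a column of the commutator. -/
theorem mem_quadDomain_of_isQuadCommutator {ψ : Fock ι} (hψ : ‖ψ‖ = 1)
    (h : ∀ k, ∃ C, IsQuadCommutator (DensityOp.pure ψ hψ) k C) : ψ ∈ quadDomain ι := by
  obtain ⟨n, hn⟩ := exists_apply_ne_zero hψ
  choose C hC using h
  refine mem_quadDomain_of_inner
    (fun k => (conj (ψ n))⁻¹ • (C k (ket n) + ⟪ψ, quad k (ketVec n)⟫_ℂ • ψ)) fun k m => ?_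
  have h1 := hC k (ketVec m) (ketVec n)
  rw [DensityOp.pure_op_apply, DensityOp.pure_op_apply, inner_smul_right, inner_smul_left,
    coe_ketVec, coe_ketVec, inner_conj_symm, inner_ket', inner_ket, inner_ket] at h1
  have h2 : conj (ψ n) ≠ 0 := by simpa using hn
  rw [lp.coeFn_smul, Pi.smul_apply, lp.coeFn_add, Pi.add_apply, h1, lp.coeFn_smul, Pi.smul_apply,
    smul_eq_mul, smul_eq_mul]
  field_simp
  ring

/-- In a pure state without metrological power all generalized quadratures have at most the vacuum
variance. -/
theorem norm_sq_quadDir_sub_le {ψ : quadDomain ι} {hψ : ‖(ψ : Fock ι)‖ = 1}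
    (h : metrologicalPower (DensityOp.pure (ψ : Fock ι) hψ) = 0) (u : ι × Fin 2 → ℝ) :
    ∃ r : ℝ, ‖quadDir u ψ - (r : ℂ) • (ψ : Fock ι)‖ ^ 2 ≤ (∑ k, u k ^ 2) / 2 := by
  have h0 : metrologicalPower (DensityOp.pure (ψ : Fock ι) hψ) ≤ ((0 : ℝ) : EReal) := by simp [h]
  obtain ⟨v, l, hd, hl, -⟩ := exists_isDecomposition_of_metrologicalPower_le h0 u
  obtain ⟨C, hC, -, hb⟩ := hd.dualBound
  have hψψ : ⟪(ψ : Fock ι), (ψ : Fock ι)⟫_ℂ = 1 := by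
    rw [inner_self_eq_norm_sq_to_K, hψ]
    simp
  set r : ℝ := (⟪(ψ : Fock ι), quadDir u ψ⟫_ℂ).re with hr
  have hr' : (r : ℂ) = ⟪(ψ : Fock ι), quadDir u ψ⟫_ℂ := by
    rw [hr, ← Complex.conj_eq_iff_re, inner_conj_symm, quadDir_symmetric]
  refine ⟨r, ?_⟩
  obtain ⟨C', hC', hsum, -⟩ := (isDecomposition_pure ψ hψ u r).dualBound
  set η : Fock ι := quadDir u ψ - (r : ℂ) • (ψ : Fock ι) with hη
  have hCC : ∀ φ χ, ⟪φ, C χ⟫_ℂ =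
      ⟪φ, η⟫_ℂ * ⟪(ψ : Fock ι), χ⟫_ℂ - ⟪φ, (ψ : Fock ι)⟫_ℂ * ⟪η, χ⟫_ℂ := by
    intro φ χ
    rw [hC.unique hC']
    simpa using (hsum φ χ).unique (hasSum_fintype _)
  have hort : ⟪(ψ : Fock ι), η⟫_ℂ = 0 := by
    rw [hη, inner_sub_right, inner_smul_right, hψψ, ← hr', mul_one, sub_self]
  have hort' : ⟪η, (ψ : Fock ι)⟫_ℂ = 0 := by rw [← inner_conj_symm, hort, map_zero]
  have hηη := inner_self_eq_ofReal_norm_sq η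
  -- the optimal test operator `|η⟩⟨ψ| - |ψ⟩⟨η|`
  have key := hb (ULift Bool) Finset.univ
    (fun a => if a.down then η else -(ψ : Fock ι)) (fun a => if a.down then (ψ : Fock ι) else η)
  have huniv : (Finset.univ : Finset (ULift.{u} Bool)) = {⟨true⟩, ⟨false⟩} := by decide
  simp only [huniv, Finset.sum_pair (show (⟨true⟩ : ULift.{u} Bool) ≠ ⟨false⟩ by simp), hCC,
    DensityOp.pure_op_apply, if_true, Bool.false_eq_true, if_false, inner_neg_left,
    inner_neg_right, inner_smul_right, hort, hort', hψψ, hηη] at key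
  simp only [mul_zero, zero_mul, mul_one, one_mul, neg_mul, sub_zero, zero_sub, neg_neg,
    neg_zero, add_zero,
    zero_add, ← Complex.ofReal_add, Complex.ofReal_re] at key
  linarith

/-- By the canonical commutation relations, a pure state with at most vacuum variances is a joint
eigenvector of the annihilation operators. -/
theorem exists_annVec_eq {ψ : quadDomain ι} {hψ : ‖(ψ : Fock ι)‖ = 1}
    (h : metrologicalPower (DensityOp.pure (ψ : Fock ι) hψ) = 0) (n : ι) :
    ∃ z : ℂ, annVec n ψ = z • (ψ : Fock ι) := by
  obtain ⟨r, hr⟩ := norm_sq_quadDir_sub_le h (Pi.single (n, 0) 1)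
  obtain ⟨s, hs⟩ := norm_sq_quadDir_sub_le h (Pi.single (n, 1) 1)
  rw [quadDir_single] at hr hs
  have h1 : ∀ k : ι × Fin 2, ∑ l, (Pi.single k 1 : ι × Fin 2 → ℝ) l ^ 2 = 1 := by
    intro k
    rw [Finset.sum_eq_single k] <;> simp +contextual
  rw [h1] at hr hs
  set x := quad (n, 0) ψ - (r : ℂ) • (ψ : Fock ι) with hx
  set p := quad (n, 1) ψ - (s : ℂ) • (ψ : Fock ι) with hp
  have hψψ : ⟪(ψ : Fock ι), (ψ : Fock ι)⟫_ℂ = 1 := by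
    rw [inner_self_eq_norm_sq_to_K, hψ]
    simp
  have h2 : (Real.sqrt 2 : ℂ) * (Real.sqrt 2 : ℂ) = 2 := by
    rw [← Complex.ofReal_mul, Real.mul_self_sqrt (by norm_num)]; norm_num
  have h3 : (Real.sqrt 2 : ℂ) ≠ 0 := by intro h; simp [h] at h2
  set z : ℂ := (Real.sqrt 2 : ℂ)⁻¹ * (r + Complex.I * s) with hz
  have ea : annVec n ψ - z • (ψ : Fock ι) = (Real.sqrt 2 : ℂ)⁻¹ • (x + Complex.I • p) := by
    have e : annVec n ψ = (Real.sqrt 2 : ℂ)⁻¹ • (quad (n, 0) ψ + Complex.I • quad (n, 1) ψ) :=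
      lp.ext (annihilate_eq n _)
    rw [e, hx, hp, hz]
    module
  have ec : creVec n ψ - conj z • (ψ : Fock ι) = (Real.sqrt 2 : ℂ)⁻¹ • (x - Complex.I • p) := by
    have e : creVec n ψ = (Real.sqrt 2 : ℂ)⁻¹ • (quad (n, 0) ψ - Complex.I • quad (n, 1) ψ) :=
      lp.ext (create_eq n _)
    rw [e, hx, hp, hz]
    simp only [map_mul, map_add, map_inv₀, Complex.conj_ofReal, Complex.conj_I]
    module
  have hpar : ‖annVec n ψ - z • (ψ : Fock ι)‖ ^ 2 + ‖creVec n ψ - conj z • (ψ : Fock ι)‖ ^ 2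
      = ‖x‖ ^ 2 + ‖p‖ ^ 2 := by
    have h4 := parallelogram_law_with_norm ℂ x (Complex.I • p)
    rw [norm_smul, Complex.norm_I, one_mul] at h4
    have h5 : ‖(Real.sqrt 2 : ℂ)⁻¹‖ ^ 2 = 1 / 2 := by
      rw [norm_inv, Complex.norm_real, Real.norm_of_nonneg (Real.sqrt_nonneg _), inv_pow,
        Real.sq_sqrt (by norm_num)]
      norm_num
    rw [ea, ec, norm_smul, norm_smul, mul_pow, mul_pow, h5]
    linarith
  have hccr : ‖creVec n ψ - conj z • (ψ : Fock ι)‖ ^ 2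
      = ‖annVec n ψ - z • (ψ : Fock ι)‖ ^ 2 + 1 := by
    have h6 := inner_creVec_creVec n n ψ ψ
    rw [if_pos rfl, hψψ] at h6
    apply Complex.ofReal_injective
    rw [Complex.ofReal_add, ← inner_self_eq_ofReal_norm_sq, ← inner_self_eq_ofReal_norm_sq]
    simp only [inner_sub_left, inner_sub_right, inner_smul_left, inner_smul_right, h6, hψψ,
      ← inner_annVec, inner_creVec, Complex.conj_conj]
    push_cast
    ring
  have h7 : ‖annVec n ψ - z • (ψ : Fock ι)‖ ^ 2 ≤ 0 := by linarith
  refine ⟨z, sub_eq_zero.1 (norm_eq_zero.1 ?_)⟩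
  exact pow_eq_zero_iff (two_ne_zero) |>.1 (le_antisymm h7 (sq_nonneg _))

/-- The eigenvalue equations of the annihilation operators determine all amplitudes from the
vacuum amplitude. -/
theorem apply_mul_coherentFun_zero {ψ : Fock ι} {α : ι → ℂ}
    (h : ∀ n, annihilate n ψ = fun m => α n * ψ m) (m : ι → ℕ) :
    ψ m * coherentFun α 0 = ψ 0 * coherentFun α m := by
  induction hN : ∑ i, m i generalizing m with
  | zero =>
    have : m = 0 := funext fun i => by simpa using Finset.sum_eq_zero_iff.1 hN i (Finset.mem_univ i)
    rw [this]
  | succ N ih =>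
    obtain ⟨n, -, hn⟩ := Finset.exists_ne_zero_of_sum_ne_zero
      (by rw [hN]; exact N.succ_ne_zero : ∑ i, m i ≠ 0)
    obtain ⟨m', rfl⟩ := mem_range_add_single hn
    simp only [sum_add_single] at hN
    have h1 := congrFun (h n) m'
    have h2 := coherentFun_add_single α n m'
    have h0 : (Real.sqrt (m' n + 1) : ℂ) ≠ 0 := by
      exact_mod_cast (Real.sqrt_pos.2 (by positivity)).ne'
    simp only [annihilate, LinearMap.coe_mk, AddHom.coe_mk] at h1
    apply mul_left_cancel₀ h0
    linear_combination coherentFun α 0 * h1 - ψ 0 * h2 + α n * ih m' (by omega)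

theorem coherentFun_zero_ne_zero (α : ι → ℂ) : coherentFun α 0 ≠ 0 := by
  rw [coherentFun, Finset.prod_ne_zero_iff]
  intro n _
  simp

theorem pure_eq_coherent {ψ : Fock ι} (hψ : ‖ψ‖ = 1)
    (h : metrologicalPower (DensityOp.pure ψ hψ) = 0) :
    ∃ α : ι → ℂ, DensityOp.pure ψ hψ = DensityOp.coherent α := by
  have hfin : HasFiniteQFI (DensityOp.pure ψ hψ) := by
    by_contra hc
    rw [metrologicalPower, if_neg hc] at h
    simp at h
  have hmem := mem_quadDomain_of_isQuadCommutator hψ fun k => (hfin k).1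
  have h1 := fun n => exists_annVec_eq (ψ := ⟨ψ, hmem⟩) (hψ := hψ) h n
  choose α hα using h1
  refine ⟨α, DensityOp.ext_op ?_⟩
  have h2 := apply_mul_coherentFun_zero (ψ := ψ) (α := α) fun n =>
    congrArg (fun χ : Fock ι => (χ : (ι → ℕ) → ℂ)) (hα n)
  set c : ℂ := ψ 0 / coherentFun α 0 with hc
  have h3 : ψ = c • coherentVec α := by
    apply lp.ext
    funext m
    have h0 := coherentFun_zero_ne_zero α
    change ψ m = c * coherentFun α m
    rw [hc, div_mul_eq_mul_div, eq_div_iff h0, h2]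
  have h4 : ‖c‖ = 1 := by
    rw [h3, norm_smul, norm_coherentVec, mul_one] at hψ
    exact hψ
  ext1 φ
  change ⟪ψ, φ⟫_ℂ • ψ = ⟪coherentVec α, φ⟫_ℂ • coherentVec α
  rw [h3, inner_smul_left, smul_smul, mul_right_comm, mul_comm (conj c), Complex.mul_conj,
    Complex.normSq_eq_norm_sq, h4]
  simp

theorem metrologicalPower_pure_eq_zero_iff {ψ : Fock ι} (hψ : ‖ψ‖ = 1) :
    metrologicalPower (DensityOp.pure ψ hψ) = 0 ↔
      ∃ α : ι → ℂ, DensityOp.pure ψ hψ = DensityOp.coherent α := by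
  refine ⟨pure_eq_coherent hψ, ?_⟩
  rintro ⟨α, h⟩
  rw [h]
  exact metrologicalPower_of_isClassical (isClassical_coherent α)

end Pure

/-! ### Mixtures -/

section Mix

variable {ι : Type u} [Fintype ι] [DecidableEq ι]

theorem DensityOp.mix_op_apply {p : ℝ} (hp : p ∈ Set.Icc (0 : ℝ) 1) (ρ σ : DensityOp ι)
    (ψ : Fock ι) : (DensityOp.mix p hp ρ σ).op ψ = (p : ℂ) • ρ.op ψ + ((1 - p : ℝ) : ℂ) • σ.op ψ :=
  rfl

/-- The dual bound is linear in the state, its commutator and the bound. -/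
theorem DualBound.mix {H : Type u} [NormedAddCommGroup H] [InnerProductSpace ℂ H]
    {T C T' C' : H →L[ℂ] H} {B B' p q : ℝ} (hp : 0 ≤ p) (hq : 0 ≤ q) (h : DualBound T C B)
    (h' : DualBound T' C' B') : DualBound ((p : ℂ) • T + (q : ℂ) • T')
      ((p : ℂ) • C + (q : ℂ) • C') (p * B + q * B') := by
  intro α s φ ψ
  have e1 : ∑ a ∈ s, ⟪φ a, ((p : ℂ) • C + (q : ℂ) • C') (ψ a)⟫_ℂ =
      p * ∑ a ∈ s, ⟪φ a, C (ψ a)⟫_ℂ + q * ∑ a ∈ s, ⟪φ a, C' (ψ a)⟫_ℂ := by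
    simp only [add_apply, smul_apply, inner_add_right, inner_smul_right, Finset.sum_add_distrib,
      Finset.mul_sum]
  have e2 : ∑ a ∈ s, ∑ b ∈ s, (⟪φ a, ((p : ℂ) • T + (q : ℂ) • T') (φ b)⟫_ℂ * ⟪ψ b, ψ a⟫_ℂ
      + ⟪φ a, φ b⟫_ℂ * ⟪ψ b, ((p : ℂ) • T + (q : ℂ) • T') (ψ a)⟫_ℂ) =
      p * (∑ a ∈ s, ∑ b ∈ s, (⟪φ a, T (φ b)⟫_ℂ * ⟪ψ b, ψ a⟫_ℂ + ⟪φ a, φ b⟫_ℂ * ⟪ψ b, T (ψ a)⟫_ℂ))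
      + q * (∑ a ∈ s, ∑ b ∈ s,
        (⟪φ a, T' (φ b)⟫_ℂ * ⟪ψ b, ψ a⟫_ℂ + ⟪φ a, φ b⟫_ℂ * ⟪ψ b, T' (ψ a)⟫_ℂ)) := by
    simp only [add_apply, smul_apply, inner_add_right, inner_smul_right, Finset.mul_sum,
      ← Finset.sum_add_distrib]
    refine Finset.sum_congr rfl fun a _ => Finset.sum_congr rfl fun b _ => ?_
    ring
  rw [e1, e2, Complex.add_re, Complex.add_re, Complex.re_ofReal_mul, Complex.re_ofReal_mul,
    Complex.re_ofReal_mul, Complex.re_ofReal_mul]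
  nlinarith [mul_le_mul_of_nonneg_left (h α s φ ψ) hp, mul_le_mul_of_nonneg_left (h' α s φ ψ) hq]

theorem metrologicalPower_mix_le_of_le {ρ σ : DensityOp ι} {p a b : ℝ}
    (hp : p ∈ Set.Icc (0 : ℝ) 1) (ha : 0 ≤ a) (hb : 0 ≤ b)
    (hρ : metrologicalPower ρ ≤ (a : EReal)) (hσ : metrologicalPower σ ≤ (b : EReal)) :
    metrologicalPower (DensityOp.mix p hp ρ σ) ≤ ((p * a + (1 - p) * b : ℝ) : EReal) := by
  have hq : 0 ≤ 1 - p := sub_nonneg.2 hp.2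
  refine metrologicalPower_le_of_dualBound
    (add_nonneg (mul_nonneg hp.1 ha) (mul_nonneg hq hb)) fun u => ?_
  obtain ⟨v, l, h, hl, -⟩ := exists_isDecomposition_of_metrologicalPower_le hρ u
  obtain ⟨w, r, h', hr, -⟩ := exists_isDecomposition_of_metrologicalPower_le hσ u
  obtain ⟨C, hC, -, hd⟩ := h.dualBound
  obtain ⟨C', hC', -, hd'⟩ := h'.dualBound
  refine ⟨_, fun φ ψ => ?_, (DualBound.mix hp.1 hq hd hd').mono ?_⟩
  · rw [add_apply, smul_apply, smul_apply, inner_add_right, inner_smul_right, inner_smul_right,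
      hC, hC', commForm, commForm, commForm, DensityOp.mix_op_apply, DensityOp.mix_op_apply,
      inner_add_left, inner_add_right, inner_smul_left, inner_smul_left, inner_smul_right,
      inner_smul_right, Complex.conj_ofReal, Complex.conj_ofReal]
    ring
  · nlinarith [mul_le_mul_of_nonneg_left hl hp.1, mul_le_mul_of_nonneg_left hr hq]

theorem metrologicalPower_mix_le (ρ σ : DensityOp ι) {p : ℝ} (hp : p ∈ Set.Icc (0 : ℝ) 1) :
    metrologicalPower (DensityOp.mix p hp ρ σ) ≤
      (p : EReal) * metrologicalPower ρ + ((1 - p : ℝ) : EReal) * metrologicalPower σ := by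
  have hq : 0 ≤ 1 - p := sub_nonneg.2 hp.2
  -- the conventions `0 * ⊤ = 0` matter for trivial mixtures
  rcases hp.1.eq_or_lt with h0 | h0
  · have e : DensityOp.mix p hp ρ σ = σ := by
      apply DensityOp.ext_op
      ext1 ψ
      rw [DensityOp.mix_op_apply, ← h0]
      simp
    rw [e, ← h0]
    simp
  rcases hq.eq_or_lt with h1 | h1
  · have hp1 : p = 1 := by linarith
    have e : DensityOp.mix p hp ρ σ = ρ := by
      apply DensityOp.ext_op
      ext1 ψ
      rw [DensityOp.mix_op_apply, hp1]
      simp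
    rw [e, hp1]
    simp
  have hρ := metrologicalPower_nonneg ρ
  have hσ := metrologicalPower_nonneg σ
  induction hx : metrologicalPower ρ with
  | bot => simp [hx] at hρ
  | top =>
    rw [EReal.coe_mul_top_of_pos h0, EReal.top_add_of_ne_bot]
    · exact le_top
    · exact ne_of_gt (lt_of_lt_of_le EReal.bot_lt_zero (mul_nonneg (by exact_mod_cast hq) hσ))
  | coe a =>
    induction hy : metrologicalPower σ with
    | bot => simp [hy] at hσ
    | top =>
      rw [EReal.coe_mul_top_of_pos h1, ← EReal.coe_mul, EReal.coe_add_top]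
      exact le_top
    | coe b =>
      rw [hx] at hρ
      rw [hy] at hσ
      have h := metrologicalPower_mix_le_of_le hp (by exact_mod_cast hρ) (by exact_mod_cast hσ)
        hx.le hy.le
      exact_mod_cast h

end Mix

end Bosonic

end

/-- The metrological power is nonnegative, vanishes on classical states and, among pure states,
exactly on the coherent ones; it is invariant under linear optical unitaries, monotone under linear
optical maps, convex, and the maximum over the factors on product states. -/
theorem theorem2 {ι κ : Type*} [Fintype ι] [DecidableEq ι] [Fintype κ] [DecidableEq κ] :
    (∀ ρ : DensityOp ι, 0 ≤ metrologicalPower ρ) ∧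
    (∀ ρ : DensityOp ι, ρ.IsClassical → metrologicalPower ρ = 0) ∧
    (∀ (ψ : Fock ι) (hψ : ‖ψ‖ = 1), metrologicalPower (DensityOp.pure ψ hψ) = 0 ↔
      ∃ α : ι → ℂ, DensityOp.pure ψ hψ = DensityOp.coherent α) ∧
    (∀ (ρ : DensityOp ι) (U : Fock ι ≃ₗᵢ[ℂ] Fock ι), IsLinearOptical U →
      metrologicalPower (ρ.conj U) = metrologicalPower ρ) ∧
    (∀ (ρ : DensityOp ι) (σ : DensityOp κ) (U : Fock (ι ⊕ κ) ≃ₗᵢ[ℂ] Fock (ι ⊕ κ)),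
      IsLinearOptical U → σ.IsClassical →
      metrologicalPower (dilationMap U σ ρ) ≤ metrologicalPower ρ) ∧
    (∀ (ρ σ : DensityOp ι) (p : ℝ) (hp : p ∈ Set.Icc (0 : ℝ) 1),
      metrologicalPower (DensityOp.mix p hp ρ σ) ≤
        (p : EReal) * metrologicalPower ρ + ((1 - p : ℝ) : EReal) * metrologicalPower σ) ∧
    (∀ (ρ : DensityOp ι) (σ : DensityOp κ),
      metrologicalPower (ρ.tensor σ) = max (metrologicalPower ρ) (metrologicalPower σ)) := by
  refine ⟨metrologicalPower_nonneg, fun ρ h => metrologicalPower_of_isClassical h,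
    fun ψ hψ => metrologicalPower_pure_eq_zero_iff hψ,
    fun ρ U hU => le_antisymm (metrologicalPower_conj_le ρ hU) ?_, fun ρ σ U hU hσ => ?_,
    fun ρ σ p hp => metrologicalPower_mix_le ρ σ hp,
    fun ρ σ => le_antisymm (metrologicalPower_tensor_le ρ σ) (max_le
      (metrologicalPower_le_tensor_left ρ σ) (metrologicalPower_le_tensor_right ρ σ))⟩
  · simpa only [DensityOp.conj_conj_symm] using metrologicalPower_conj_le (ρ.conj U) hU.symm
  · calc metrologicalPower (dilationMap U σ ρ)
        ≤ metrologicalPower ((ρ.tensor σ).conj U) := metrologicalPower_partialTrace_le _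
      _ ≤ metrologicalPower (ρ.tensor σ) := metrologicalPower_conj_le _ hU
      _ ≤ max (metrologicalPower ρ) (metrologicalPower σ) := metrologicalPower_tensor_le ρ σ
      _ = metrologicalPower ρ := by
        rw [metrologicalPower_of_isClassical hσ, max_eq_left (metrologicalPower_nonneg ρ)]
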